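/- **Setting.** Let $x^\mu$, $\mu=1,\dots,n$, be coordinates on $\mathbb R^n$ and let $\Psi^A$ be a set of fields, each with a Grassmann parity $|A|\in\mathbb Z_2$ and a ghost number $\mathrm{gh}(A)\in\mathbb Z$. *Local functions* are functions of $x^\mu$ and of finitely many jet coordinates $\Psi^A_{(\mu)}$ ($(\mu)$ a symmetric multi-index), smooth in the commuting and Grassmann-polynomial in the anticommuting ones; $\partial_\mu$ is the total derivative. The original BRST differential $s$ is the odd nilpotent vector field of ghost number one with $s x^\mu=0$, $s\Psi^A=S^A[x,\Psi]$ (local functions), $[s,\partial_\mu]=0$. A *local change of fields* is a set of local functions (new fields, with definite parities and ghost numbers) such that the prolongation $u_{(\mu)}\mapsto\partial_{(\mu)}u$, $x^\mu\mapsto x^\mu$, is an isomorphism of the algebras of local functions. *Algebraically trivial pairs* for $s$: new fields $w^a,v^a,\varphi^i$ obtained by a local change of fields with $s w^a=v^a$ and $s\varphi^i=S_R^i[x,\varphi]$. The reduced original theory has the fields $\varphi^i$ and the differential $s_R\varphi^i=S_R^i$. *Generalized auxiliary fields* for a differential $s$ commuting with $\partial_\mu$: fields $w^a,v^a$ that are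 part of a system of new fields $w^a,v^a,\varphi^i$, obtained by a local change of fields, such that the equations $s w^a|_{w=0}=0$ are algebraically equivalent to $v^a=V^a[x,\varphi]$ for some local functions $V^a$; that is, the ideal generated by $w^a$, $s w^a$ and all their total derivatives equals the ideal generated by $w^a$, $v^a-V^a$ and all their total derivatives. The reduced differential acts on the local functions of the $\varphi^i$ by $f\mapsto (s f)|_{w=0,\,v=V[\varphi]}$, i.e. as $s$ modulo this ideal. **Parent theory.** Its fields are $\Psi^A_{(\lambda)[\nu]}$, with $(\lambda)$ a symmetric and $[\nu]=\nu_1\dots\nu_l$ a skew-symmetric multi-index, of parity $|A|+l$ and ghost number $\mathrm{gh}(A)-l$; $\Psi^A_{()[]}=\Psi^A$. On the coordinates $\Psi^A_{(\mu)(\lambda)[\nu]}$ one has the vector fields, not acting on $x$, $$\tfrac{\partial^F}{\partial y^\rho}\Psi^A_{(\mu)(\lambda)[\nu]}=\Psi^A_{(\mu)(\lambda\rho)[\nu]},\qquad \tfrac{\partial^F}{\partial\theta^\rho}\Psi^A_{(\mu)(\lambda)\nu_1\dots\nu_l}=(-1)^{|A|}\Psi^A_{(\mu)(\lambda)\rho\nu_1\dots\nu_l},$$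 $$d^F\Psi^A_{(\mu)(\lambda)\nu_1\dots\nu_l}=(-1)^{|A|}\sum_{i}(-1)^{i-1}\Psi^A_{(\mu\nu_i)(\lambda)\nu_1\dots\widehat{\nu_i}\dots\nu_l},\quad \sigma^F\Psi^A_{(\mu)(\lambda)\nu_1\dots\nu_l}=(-1)^{|A|}\sum_{i}(-1)^{i-1}\Psi^A_{(\mu)(\lambda\nu_i)\nu_1\dots\widehat{\nu_i}\dots\nu_l}.$$ For a local function $f$ of the original theory let $\bar f$ be obtained by replacing $\Psi^A_{(\mu)}$ by $\Psi^A_{()(\mu)[]}$ ($x$-derivatives of the fields by $y$-derivatives), and let its *descendants* be, for $f$ of parity $|f|$ and $\nu_1<\dots<\nu_l$, $$f_{(\lambda)[\nu]}=(-1)^{l|f|}\,\tfrac{\partial^F}{\partial\theta^{\nu_1}}\cdots\tfrac{\partial^F}{\partial\theta^{\nu_l}}\Big(\tfrac{\partial}{\partial x}+\tfrac{\partial^F}{\partial y}\Big)_{(\lambda)}\bar f .$$ The parent extension of $s$ is $s^P=d^F-\sigma^F+\bar s$, where $\bar s$ is the vector field with $\bar s x^\mu=0$, $\bar s\Psi^A=\bar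 S^A$ that commutes (in the graded sense) with $\partial_\mu$, $\partial^F/\partial\theta^\nu$ and $\partial/\partial x^\lambda+\partial^F/\partial y^\lambda$, i.e. $\bar s\Psi^A_{(\mu)(\lambda)[\nu]}=\partial_{(\mu)}\big(S^A\big)_{(\lambda)[\nu]}$. **Proposition.** Let $w^a,\ v^a=s w^a$ be algebraically trivial pairs for $s$, with remaining fields $\varphi^i$ and $s\varphi^i=S^i_R[x,\varphi]$. Then all the descendants $w^a_{(\lambda)[\nu]},v^a_{(\lambda)[\nu]},\varphi^i_{(\lambda)[\nu]}$ together define a local change of fields of the parent theory, in which the $w^a_{(\lambda)[\nu]},v^a_{(\lambda)[\nu]}$ are generalized auxiliary fields for $s^P$. The corresponding reduced differential on the local functions of the $\varphi^i_{(\lambda)[\nu]}$ is the parent extension $(s_R)^P$ of the reduced original differential $s_R$. Moreover, for every new field $u$ among $w^a,v^a,\varphi^i$ that does not depend explicitly on $x$, the descendants are the ones obtained through $\partial^F/\partial\theta^\nu$ and $\partial^F/\partial y^\lambda$ alone. -/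

import Mathlib

open scoped TensorProduct ContDiff

universe u v

noncomputable section

namespace ParentBRST

/-! ## Smooth functions of finitely many among the variables `E` -/

/-- Smooth real functions on `E → ℝ` each of which depends on finitely many variables only. -/
def SmoothFun (E : Type u) : Subalgebra ℝ ((E → ℝ) → ℝ) where
  carrier := {f | ∃ (T : Finset E) (g : (T → ℝ) → ℝ), ContDiff ℝ ∞ g ∧
    ∀ q : E → ℝ, f q = g (fun i => q i)}
  mul_mem' := by
    classical
    rintro a b ⟨T, g, hg, ha⟩ ⟨T', g', hg', hb⟩
    refine ⟨T ∪ T', fun q =>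
      g (fun i => q ⟨i.1, Finset.mem_union_left _ i.2⟩) *
      g' (fun i => q ⟨i.1, Finset.mem_union_right _ i.2⟩), ?_, fun q => ?_⟩
    · exact (hg.comp (contDiff_pi.2 fun i => contDiff_apply ℝ ℝ _)).mul
        (hg'.comp (contDiff_pi.2 fun i => contDiff_apply ℝ ℝ _))
    · simp [ha, hb]
  add_mem' := by
    classical
    rintro a b ⟨T, g, hg, ha⟩ ⟨T', g', hg', hb⟩
    refine ⟨T ∪ T', fun q =>
      g (fun i => q ⟨i.1, Finset.mem_union_left _ i.2⟩) +
      g' (fun i => q ⟨i.1, Finset.mem_union_right _ i.2⟩), ?_, fun q => ?_⟩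
    · exact (hg.comp (contDiff_pi.2 fun i => contDiff_apply ℝ ℝ _)).add
        (hg'.comp (contDiff_pi.2 fun i => contDiff_apply ℝ ℝ _))
    · simp [ha, hb]
  algebraMap_mem' := fun r => ⟨∅, fun _ => r, contDiff_const, fun _ => rfl⟩

namespace SmoothFun

/-- The coordinate function of the variable `e`. -/
def var {E : Type u} (e : E) : SmoothFun E :=
  ⟨fun q => q e, {e}, fun q => q ⟨e, Finset.mem_singleton_self e⟩, contDiff_apply ℝ ℝ _,
    fun _ => rfl⟩

/-- A function written through finitely many variables has the expected partial derivatives. -/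
theorem hasDerivAt_update {E : Type u} [DecidableEq E] {f : (E → ℝ) → ℝ} (T : Finset E)
    (g : (T → ℝ) → ℝ) (hg : ContDiff ℝ ∞ g) (hf : ∀ q : E → ℝ, f q = g (fun i => q i))
    (e : E) (q : E → ℝ) :
    HasDerivAt (fun t => f (Function.update q e t))
      (fderiv ℝ g (fun i => q i) (fun i => if i.1 = e then 1 else 0)) (q e) := by
  have h1 : HasDerivAt (fun t => (fun i : T => Function.update q e t i))
      (fun i : T => if i.1 = e then (1 : ℝ) else 0) (q e) := by
    rw [hasDerivAt_pi]
    intro i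
    by_cases hi : i.1 = e
    · subst hi
      simpa using hasDerivAt_id' (q i.1)
    · simpa [Function.update_of_ne hi, hi] using hasDerivAt_const (q e) (q i.1)
  have h2 : HasFDerivAt g (fderiv ℝ g (fun i => q i))
      (fun i : T => Function.update q e (q e) i) := by
    rw [Function.update_eq_self]
    exact (hg.differentiable (by simp) _).hasFDerivAt
  have h3 := h2.comp_hasDerivAt (q e) h1
  simpa [Function.comp_def, hf] using h3

/-- The partial derivative with respect to the variable `e`. -/
def pderiv {E : Type u} (e : E) : SmoothFun E →ₗ[ℝ] SmoothFun E := by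
  classical
  exact
  { toFun := fun f => ⟨fun q => deriv (fun t => f.1 (Function.update q e t)) (q e), by
      obtain ⟨T, g, hg, hf⟩ := f.2
      refine ⟨T, fun p => fderiv ℝ g p (fun i => if i.1 = e then 1 else 0), ?_, fun q => ?_⟩
      · exact (hg.fderiv_right (m := ∞) (by simp)).clm_apply contDiff_const
      · exact (hasDerivAt_update T g hg hf e q).deriv⟩
    map_add' := fun f f' => by
      obtain ⟨T, g, hg, hf⟩ := f.2
      obtain ⟨T', g', hg', hf'⟩ := f'.2
      ext q
      have h := hasDerivAt_update T g hg hf e q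
      have h' := hasDerivAt_update T' g' hg' hf' e q
      have h'' := (h.add h').deriv
      simp only [Subalgebra.coe_add, Pi.add_apply]
      rw [h.deriv, h'.deriv]
      exact h''
    map_smul' := fun r f => by
      obtain ⟨T, g, hg, hf⟩ := f.2
      ext q
      have h := hasDerivAt_update T g hg hf e q
      have h'' := (h.const_mul r).deriv
      simp only [SetLike.val_smul, Pi.smul_apply, smul_eq_mul, RingHom.id_apply]
      rw [h.deriv]
      exact h'' }

theorem finite_pderiv {E : Type u} (f : SmoothFun E) : {e | pderiv e f ≠ 0}.Finite := by
  classical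
  obtain ⟨T, g, hg, hf⟩ := f.2
  refine T.finite_toSet.subset fun e he => ?_
  by_contra hT
  apply he
  ext q
  have h := (hasDerivAt_update T g hg hf e q).deriv
  have h0 : (fun i : T => if i.1 = e then (1 : ℝ) else 0) = 0 := by
    funext i
    have : i.1 ≠ e := fun hi => hT (hi ▸ i.2)
    simp [this]
  rw [h0, map_zero] at h
  simpa [pderiv] using h

/-- Renaming the variables along `r`. -/
def rename {E : Type u} {E' : Type v} (r : E → E') : SmoothFun E →ₐ[ℝ] SmoothFun E' where
  toFun f := ⟨fun q => f.1 (fun e => q (r e)), by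
    classical
    obtain ⟨T, g, hg, hf⟩ := f.2
    refine ⟨T.image r, fun p =>
      g (fun i => p ⟨r i.1, Finset.mem_image_of_mem r i.2⟩), ?_, fun q => by simp [hf]⟩
    exact hg.comp (contDiff_pi.2 fun i => contDiff_apply ℝ ℝ _)⟩
  map_one' := rfl
  map_mul' _ _ := rfl
  map_zero' := rfl
  map_add' _ _ := rfl
  commutes' _ := rfl

end SmoothFun

/-! ## Fields, jets and local functions -/

/-- A set of fields with their Grassmann parities and ghost numbers. -/
structure FieldContent where
  Idx : Type u
  parity : Idx → ZMod 2
  gh : Idx → ℤ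

/-- Symmetric multi-indices in dimension `n`; `l i` is the multiplicity of the index `i`. -/
abbrev MultiIdx (n : ℕ) := Fin n →₀ ℕ

/-- The multi-index with the single index `i`. -/
abbrev MultiIdx.one {n : ℕ} (i : Fin n) : MultiIdx n := Finsupp.single i 1

/-- The sign `(-1)^p`. -/
def sgn (p : ZMod 2) : ℝ := if p = 0 then 1 else -1

/-- Jet coordinates `z^α_(μ)`. -/
abbrev Jet (n : ℕ) (F : FieldContent.{u}) := F.Idx × MultiIdx n

/-- Commuting coordinates: the `x^μ` and the even jet coordinates. -/
abbrev EvenVar (n : ℕ) (F : FieldContent.{u}) := Fin n ⊕ {j : Jet n F // F.parity j.1 = 0}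

/-- Anticommuting coordinates: the odd jet coordinates. -/
abbrev OddVar (n : ℕ) (F : FieldContent.{u}) := {j : Jet n F // F.parity j.1 ≠ 0}

/-- The superalgebra of local functions: functions of `x^μ` and of finitely many jet coordinates,
smooth in the commuting ones, with values in the Grassmann algebra on the anticommuting ones. -/
def Loc (n : ℕ) (F : FieldContent.{u}) : Type u :=
  SmoothFun (EvenVar n F) ⊗[ℝ] ExteriorAlgebra ℝ (OddVar n F →₀ ℝ)

instance (n : ℕ) (F : FieldContent.{u}) : Ring (Loc n F) :=
  inferInstanceAs (Ring (SmoothFun (EvenVar n F) ⊗[ℝ] ExteriorAlgebra ℝ (OddVar n F →₀ ℝ)))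

instance (n : ℕ) (F : FieldContent.{u}) : Algebra ℝ (Loc n F) :=
  inferInstanceAs (Algebra ℝ (SmoothFun (EvenVar n F) ⊗[ℝ] ExteriorAlgebra ℝ (OddVar n F →₀ ℝ)))

section Basic

variable {n : ℕ} {F : FieldContent.{u}}

/-- The product of a function of the commuting and a function of the anticommuting coordinates. -/
def Loc.tmul (a : SmoothFun (EvenVar n F)) (b : ExteriorAlgebra ℝ (OddVar n F →₀ ℝ)) : Loc n F :=
  a ⊗ₜ[ℝ] b

/-- Linear maps acting on the commuting and on the anticommuting factor. -/
def Loc.map (A : SmoothFun (EvenVar n F) →ₗ[ℝ] SmoothFun (EvenVar n F))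
    (B : ExteriorAlgebra ℝ (OddVar n F →₀ ℝ) →ₗ[ℝ] ExteriorAlgebra ℝ (OddVar n F →₀ ℝ)) :
    Module.End ℝ (Loc n F) :=
  TensorProduct.map A B

theorem Loc.map_tmul (A : SmoothFun (EvenVar n F) →ₗ[ℝ] SmoothFun (EvenVar n F))
    (B : ExteriorAlgebra ℝ (OddVar n F →₀ ℝ) →ₗ[ℝ] ExteriorAlgebra ℝ (OddVar n F →₀ ℝ))
    (a : SmoothFun (EvenVar n F)) (b : ExteriorAlgebra ℝ (OddVar n F →₀ ℝ)) :
    Loc.map A B (Loc.tmul a b) = Loc.tmul (A a) (B b) :=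
  TensorProduct.map_tmul A B a b

theorem Loc.zero_tmul (b : ExteriorAlgebra ℝ (OddVar n F →₀ ℝ)) :
    (Loc.tmul 0 b : Loc n F) = 0 :=
  TensorProduct.zero_tmul _ b

theorem Loc.tmul_zero (a : SmoothFun (EvenVar n F)) : (Loc.tmul a 0 : Loc n F) = 0 :=
  TensorProduct.tmul_zero _ a

theorem Loc.induction {p : Loc n F → Prop} (f : Loc n F) (zero : p 0)
    (tmul : ∀ a b, p (Loc.tmul a b)) (add : ∀ f g, p f → p g → p (f + g)) : p f :=
  TensorProduct.induction_on (motive := p) f zero tmul add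

/-- The coordinate `x^μ`. -/
def xcoord (F : FieldContent.{u}) (m : Fin n) : Loc n F := Loc.tmul (SmoothFun.var (Sum.inl m)) 1

/-- The coordinate function `z^α_(μ)`. -/
def coord (j : Jet n F) : Loc n F :=
  if h : F.parity j.1 = 0 then Loc.tmul (SmoothFun.var (Sum.inr ⟨j, h⟩)) 1
  else Loc.tmul 1 (ExteriorAlgebra.ι ℝ (Finsupp.single ⟨j, h⟩ 1))

/-- Explicit derivative `∂/∂x^μ`, at fixed jet coordinates. -/
def dx (m : Fin n) : Module.End ℝ (Loc n F) :=
  Loc.map (SmoothFun.pderiv (Sum.inl m)) LinearMap.id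

/-- Partial (left) derivative `∂/∂z^α_(μ)`. -/
def pd (j : Jet n F) : Module.End ℝ (Loc n F) :=
  if h : F.parity j.1 = 0 then
    Loc.map (SmoothFun.pderiv (Sum.inr ⟨j, h⟩)) LinearMap.id
  else
    Loc.map LinearMap.id
      (CliffordAlgebra.contractLeft (Q := (0 : QuadraticForm ℝ (OddVar n F →₀ ℝ)))
        (Finsupp.lapply ⟨j, h⟩))

/-- The parity involution: `+1` on even and `-1` on odd functions. -/
def parityOp : Module.End ℝ (Loc n F) :=
  Loc.map LinearMap.id
    (CliffordAlgebra.involute (Q := (0 : QuadraticForm ℝ (OddVar n F →₀ ℝ)))).toLinearMap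

theorem finite_contract {O : Type u} (b : ExteriorAlgebra ℝ (O →₀ ℝ)) :
    {o : O | CliffordAlgebra.contractLeft (Q := (0 : QuadraticForm ℝ (O →₀ ℝ)))
      (Finsupp.lapply o) b ≠ 0}.Finite := by
  induction b using CliffordAlgebra.left_induction with
  | algebraMap r => simp [CliffordAlgebra.contractLeft_algebraMap]
  | add x y hx hy =>
    refine (hx.union hy).subset fun o ho => ?_
    by_contra hc
    simp only [Set.mem_union, Set.mem_ofPred_eq, not_or, not_not] at hc
    exact ho (by rw [map_add, hc.1, hc.2, add_zero])
  | ι_mul x m hx =>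
    refine (hx.union m.support.finite_toSet).subset fun o ho => ?_
    by_contra hc
    simp only [Set.mem_union, Set.mem_ofPred_eq, not_or, not_not, Finset.mem_coe,
      Finsupp.mem_support_iff] at hc
    apply ho
    rw [CliffordAlgebra.contractLeft_ι_mul, hc.1]
    simp [hc.2]

/-- A local function depends on finitely many jet coordinates. -/
theorem finite_pd (f : Loc n F) : {j : Jet n F | pd j f ≠ 0}.Finite := by
  induction f using Loc.induction with
  | zero => simp
  | add x y hx hy =>
    refine (hx.union hy).subset fun o ho => ?_
    by_contra hc
    simp only [Set.mem_union, Set.mem_ofPred_eq, not_or, not_not] at hc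
    exact ho (by rw [map_add, hc.1, hc.2, add_zero])
  | tmul a b =>
    have h1 : {j : Jet n F | ∃ h : F.parity j.1 = 0,
        SmoothFun.pderiv (Sum.inr ⟨j, h⟩ : EvenVar n F) a ≠ 0}.Finite := by
      refine ((SmoothFun.finite_pderiv a).preimage (Sum.inr_injective.injOn)).image
        Subtype.val |>.subset ?_
      rintro j ⟨h, hj⟩
      exact ⟨⟨j, h⟩, hj, rfl⟩
    have h2 : {j : Jet n F | ∃ h : F.parity j.1 ≠ 0,
        CliffordAlgebra.contractLeft (Q := (0 : QuadraticForm ℝ (OddVar n F →₀ ℝ)))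
          (Finsupp.lapply ⟨j, h⟩) b ≠ 0}.Finite := by
      refine (finite_contract b).image Subtype.val |>.subset ?_
      rintro j ⟨h, hj⟩
      exact ⟨⟨j, h⟩, hj, rfl⟩
    refine (h1.union h2).subset fun j hj => ?_
    by_contra hc
    simp only [Set.mem_union, Set.mem_ofPred_eq, not_or, not_exists, not_not] at hc
    apply hj
    by_cases h : F.parity j.1 = 0
    · simp [pd, h, Loc.map_tmul, hc.1 h, Loc.zero_tmul]
    · simp [pd, h, Loc.map_tmul, hc.2 h, Loc.tmul_zero]

/-- The vector field `∑ c^j ∂/∂z^j` on the jet coordinates, acting from the left and not acting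
on `x^μ`; the sum is finite on every local function. -/
def vectorField (c : Jet n F → Loc n F) : Module.End ℝ (Loc n F) where
  toFun f := ∑ᶠ j, c j * pd j f
  map_add' f g := by
    rw [← finsum_add_distrib]
    · exact finsum_congr fun j => by rw [map_add, mul_add]
    · exact (finite_pd f).subset fun j hj h => hj (by simp [h])
    · exact (finite_pd g).subset fun j hj h => hj (by simp [h])
  map_smul' r f := by
    rw [RingHom.id_apply, smul_finsum' r
      ((finite_pd f).subset fun j hj h => hj (by simp [h]))]
    exact finsum_congr fun j => by rw [map_smul, mul_smul_comm]

/-- The total derivative `∂_μ = ∂/∂x^μ + z^α_μ ∂/∂z^α + …`. -/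
def totalD (m : Fin n) : Module.End ℝ (Loc n F) :=
  dx m + vectorField (fun j => coord (j.1, j.2 + MultiIdx.one m))

/-- `D_(μ)`: the operators `D i` applied with the multiplicities of a multi-index. -/
def iter {M : Type u} [AddCommGroup M] [Module ℝ M] (D : Fin n → Module.End ℝ M)
    (l : MultiIdx n) : Module.End ℝ M :=
  ((List.finRange n).map fun i => D i ^ l i).prod

/-- The vector field with `z^α ↦ S^α`, prolonged to the derivatives of the fields so that it
commutes with the total derivatives. -/
def evol (S : F.Idx → Loc n F) : Module.End ℝ (Loc n F) :=
  vectorField (fun j => iter totalD j.2 (S j.1))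

/-- The vector field counting ghost number: `f` has ghost number `k` iff `ghostOp f = k f`. -/
def ghostOp : Module.End ℝ (Loc n F) :=
  vectorField (fun j => (F.gh j.1 : ℝ) • coord j)

/-- `f` is homogeneous of parity `p` and ghost number `g`. -/
def HasDegree (p : ZMod 2) (g : ℤ) (f : Loc n F) : Prop :=
  parityOp f = sgn p • f ∧ ghostOp f = (g : ℝ) • f

/-- `s z^α = S^α`, `[s, ∂_μ] = 0`, defines a nilpotent odd differential of ghost number one. -/
structure IsBRST (S : F.Idx → Loc n F) : Prop where
  degree : ∀ A, HasDegree (F.parity A + 1) (F.gh A + 1) (S A)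
  nilpotent : ∀ f, evol S (evol S f) = 0

/-- Renaming of jet coordinates along a parity preserving map. -/
def rename {G : FieldContent.{v}} (r : Jet n F → Jet n G)
    (hr : ∀ j, G.parity (r j).1 = F.parity j.1) : Loc n F →ₐ[ℝ] Loc n G :=
  Algebra.TensorProduct.map
    (SmoothFun.rename (Sum.map id fun j : {j : Jet n F // F.parity j.1 = 0} =>
      (⟨r j.1, (hr j.1).trans j.2⟩ : {j : Jet n G // G.parity j.1 = 0})))
    (ExteriorAlgebra.map (Finsupp.lmapDomain ℝ ℝ fun j : OddVar n F =>
      (⟨r j.1, fun h => j.2 ((hr j.1).symm.trans h)⟩ : OddVar n G)))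

end Basic

/-! ## Changes of fields, generalized auxiliary fields, algebraically trivial pairs -/

/-- An invertible local change of fields, with new fields `G` and old fields `F`: an isomorphism of
the algebras of local functions that fixes `x^μ`, commutes with the total derivatives, and preserves
parity and ghost number. It sends the new jet coordinate `u^β_(μ)` to the local function
`∂_(μ) u^β` of the old fields. -/
structure FieldChange (n : ℕ) (G : FieldContent.{u}) (F : FieldContent.{v}) where
  equiv : Loc n G ≃ₐ[ℝ] Loc n F
  map_x : ∀ m, equiv (xcoord G m) = xcoord F m
  map_totalD : ∀ m f, equiv (totalD m f) = totalD m (equiv f)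
  map_parity : ∀ f, equiv (parityOp f) = parityOp (equiv f)
  map_ghost : ∀ f, equiv (ghostOp f) = ghostOp (equiv f)

/-- Fields `w^a, v^a, φ^i`, with `a` labelling `W` and `i` labelling `P`, where `v^a` has parity and
ghost number shifted by one with respect to `w^a`. -/
def withPairs (W P : FieldContent.{u}) : FieldContent.{u} where
  Idx := (W.Idx ⊕ W.Idx) ⊕ P.Idx
  parity := Sum.elim (Sum.elim W.parity fun a => W.parity a + 1) P.parity
  gh := Sum.elim (Sum.elim W.gh fun a => W.gh a + 1) P.gh

section Pairs

variable {n : ℕ} {F W P : FieldContent.{u}}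

/-- Label of `w^a`. -/
def wIdx (P : FieldContent.{u}) (a : W.Idx) : (withPairs W P).Idx := Sum.inl (Sum.inl a)

/-- Label of `v^a`. -/
def vIdx (P : FieldContent.{u}) (a : W.Idx) : (withPairs W P).Idx := Sum.inl (Sum.inr a)

/-- Label of `φ^i`. -/
def phiIdx (W : FieldContent.{u}) (i : P.Idx) : (withPairs W P).Idx := Sum.inr i

/-- Local functions of the `φ^i` alone, seen as local functions of `w, v, φ`. -/
def phiIncl (W P : FieldContent.{u}) : Loc n P →ₐ[ℝ] Loc n (withPairs W P) :=
  rename (fun j => (phiIdx W j.1, j.2)) (fun _ => rfl)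

/-- The field (without derivatives) `u^β` as a local function of the old fields. -/
def newField {G : FieldContent.{u}} (e : FieldChange n G F) (b : G.Idx) : Loc n F :=
  e.equiv (coord (b, 0))

/-- The fields `w^a, v^a` are algebraically trivial pairs for `s z^α = S^α`: there are new
fields `w^a, v^a, φ^i` with `s w^a = v^a` and `s φ^i = S_R^i[φ]`. -/
structure AlgTrivialPairs (S : F.Idx → Loc n F) (e : FieldChange n (withPairs W P) F)
    (SR : P.Idx → Loc n P) : Prop where
  s_w : ∀ a, evol S (newField e (wIdx P a)) = newField e (vIdx P a)
  s_phi : ∀ i, evol S (newField e (phiIdx W i)) = e.equiv (phiIncl W P (SR i))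

/-- The ideal of the surface `w^a = 0`, `v^a = V^a[φ]` and all its derivatives. (The generators are
homogeneous, so that the left ideal they generate is two-sided.) -/
def reductionIdeal (e : FieldChange n (withPairs W P) F) (V : W.Idx → Loc n P) :
    Ideal (Loc n F) :=
  Ideal.span
    ({f | ∃ a l, f = iter totalD l (newField e (wIdx P a))} ∪
     {f | ∃ a l, f = iter totalD l (newField e (vIdx P a) - e.equiv (phiIncl W P (V a)))})

/-- The ideal of the equations `w^a = 0`, `s w^a = 0` and all their derivatives. -/
def equationIdeal (s : Module.End ℝ (Loc n F)) (e : FieldChange n (withPairs W P) F) :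
    Ideal (Loc n F) :=
  Ideal.span
    ({f | ∃ a l, f = iter totalD l (newField e (wIdx P a))} ∪
     {f | ∃ a l, f = iter totalD l (s (newField e (wIdx P a)))})

/-- After the change of fields `e`, the fields `w, v` are generalized auxiliary fields for the
differential `s`: the algebraic equations `s w^a = 0` at `w = 0` are equivalent to
`v^a = V^a[φ]`. -/
structure IsGenAux (s : Module.End ℝ (Loc n F)) (e : FieldChange n (withPairs W P) F)
    (V : W.Idx → Loc n P) : Prop where
  degree : ∀ a, HasDegree (W.parity a + 1) (W.gh a + 1) (V a)
  solve : equationIdeal s e = reductionIdeal e V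

/-- `sR`, acting on local functions of the `φ^i`, is the reduced differential
`s f[φ]` at `w = 0, v = V[φ]`. -/
def IsReduced (s : Module.End ℝ (Loc n F)) (e : FieldChange n (withPairs W P) F)
    (V : W.Idx → Loc n P) (sR : Module.End ℝ (Loc n P)) : Prop :=
  ∀ f : Loc n P,
    s (e.equiv (phiIncl W P f)) - e.equiv (phiIncl W P (sR f)) ∈ reductionIdeal e V

end Pairs

/-! ## The parent theory -/

/-- The fields `Ψ^A_(λ)[ν]`. A skew-symmetric multi-index `ν_1 … ν_k` is represented by the set
`{ν_1 < … < ν_k}`, standing for the component with the indices in increasing order. -/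
def parent (n : ℕ) (F : FieldContent.{u}) : FieldContent.{u} where
  Idx := F.Idx × MultiIdx n × Finset (Fin n)
  parity := fun A => F.parity A.1 + (A.2.2.card : ZMod 2)
  gh := fun A => F.gh A.1 - (A.2.2.card : ℤ)

section Parent

variable {n : ℕ} {F : FieldContent.{u}}

/-- The coordinate `Ψ^A_(μ)(λ)[ν]`. -/
def pcoord (A : F.Idx) (m l : MultiIdx n) (I : Finset (Fin n)) : Loc n (parent n F) :=
  coord (F := parent n F) ((A, l, I), m)

/-- The sign of moving the index `i` in `i ν_1 … ν_k` to its place in increasing order. -/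
def insSign (i : Fin n) (I : Finset (Fin n)) : ℝ := (-1) ^ (I.filter (· < i)).card

/-- `∂^F/∂y^λ`: adds an index `λ`. -/
def dyF (i : Fin n) : Module.End ℝ (Loc n (parent n F)) :=
  vectorField fun j => pcoord j.1.1 j.2 (j.1.2.1 + MultiIdx.one i) j.1.2.2

/-- `∂^F/∂θ^ν`: `Ψ^A_{ν_1…ν_k} ↦ (-1)^A Ψ^A_{ν ν_1…ν_k}`. -/
def dthetaF (i : Fin n) : Module.End ℝ (Loc n (parent n F)) :=
  vectorField fun j =>
    if i ∈ j.1.2.2 then 0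
    else (sgn (F.parity j.1.1) * insSign i j.1.2.2) •
      pcoord j.1.1 j.2 j.1.2.1 (insert i j.1.2.2)

/-- `d^F`: `Ψ^A_(μ)(λ)[ν_1…ν_p] ↦ (-1)^A ∑_i (-1)^(i-1) Ψ^A_(μ ν_i)(λ)[ν_1…ν̂_i…ν_p]`. -/
def dF : Module.End ℝ (Loc n (parent n F)) :=
  vectorField fun j => ∑ i ∈ j.1.2.2, (sgn (F.parity j.1.1) * insSign i j.1.2.2) •
    pcoord j.1.1 (j.2 + MultiIdx.one i) j.1.2.1 (j.1.2.2.erase i)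

/-- `σ^F`: `Ψ^A_(μ)(λ)[ν_1…ν_p] ↦ (-1)^A ∑_i (-1)^(i-1) Ψ^A_(μ)(λ ν_i)[ν_1…ν̂_i…ν_p]`. -/
def sigmaF : Module.End ℝ (Loc n (parent n F)) :=
  vectorField fun j => ∑ i ∈ j.1.2.2, (sgn (F.parity j.1.1) * insSign i j.1.2.2) •
    pcoord j.1.1 j.2 (j.1.2.1 + MultiIdx.one i) (j.1.2.2.erase i)

/-- Total `y`-derivative `∂/∂x^λ + ∂^F/∂y^λ`. -/
def totalY (i : Fin n) : Module.End ℝ (Loc n (parent n F)) := dx i + dyF i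

/-- `f ↦ f̄`: replaces the `x`-derivatives of the fields by their `y`-derivatives,
`Ψ^A_(μ) ↦ Ψ^A_()(μ)[]`. -/
def bar (n : ℕ) (F : FieldContent.{u}) : Loc n F →ₐ[ℝ] Loc n (parent n F) :=
  rename (G := parent n F) (fun j => ((j.1, j.2, ∅), 0)) (fun j => by simp [parent])

/-- `∂^F/∂θ^{ν_1} ∘ … ∘ ∂^F/∂θ^{ν_k}` for `ν_1 < … < ν_k`. -/
def dthetaIter (I : Finset (Fin n)) : Module.End ℝ (Loc n (parent n F)) :=
  ((I.sort (· ≤ ·)).map dthetaF).prod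

/-- The descendant `f_(λ)[ν]` in the parent theory of a local function `f` of parity `p` of the
original theory. The sign is the one of `Ψ^A_(λ)[ν] = ± ∂_θ … ∂_θ ∂_y … ∂_y Ψ^A`. -/
def descendant (p : ZMod 2) (f : Loc n F) (l : MultiIdx n) (I : Finset (Fin n)) :
    Loc n (parent n F) :=
  sgn p ^ I.card • dthetaIter I (iter totalY l (bar n F f))

/-- `s̄`: the odd vector field with `s̄ Ψ^A = S̄^A`, prolonged to all `Ψ^A_(μ)(λ)[ν]` so as to commute
with `∂_μ`, with `∂/∂x^λ + ∂^F/∂y^λ` and (in the graded sense) with `∂^F/∂θ^ν`. -/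
def sBar (S : F.Idx → Loc n F) : Module.End ℝ (Loc n (parent n F)) :=
  vectorField fun j =>
    iter totalD j.2 (descendant (F.parity j.1.1 + 1) (S j.1.1) j.1.2.1 j.1.2.2)

/-- The parent differential `s^P = d^F - σ^F + s̄`. -/
def parentBRST (S : F.Idx → Loc n F) : Module.End ℝ (Loc n (parent n F)) :=
  dF - sigmaF + sBar S

end Parent

end ParentBRST

end

noncomputable section

namespace ParentBRST

/-!
The parent extension is functorial. A homomorphism `φ` of algebras of local functions that fixes
`x`, preserves parity and commutes with the total derivatives extends to the parent theories by
sending the descendants of each field to the descendants of its image (`exists_parentHom`). The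
extension commutes with `∂_μ`, `∂/∂x + ∂^F/∂y` and `∂^F/∂θ`, and these operators generate all
coordinates `Ψ^A_(μ)(λ)[ν]` from the `Ψ^A` (`coord_mem_of_closed`), so that it is determined by `φ`
(`IsParentHom.ext`). Hence the extension of an invertible `φ` is invertible, which gives the change
of fields of the parent theory (`exists_parent_fieldChange`).

The differential `s^P` restricts to `s` on the functions `f̄`, commutes with `∂_μ` and
`∂/∂x + ∂^F/∂y`, and satisfies `[s^P, ∂^F/∂θ^ν] = ∂_ν - (∂/∂x^ν + ∂^F/∂y^ν)`
(`parentBRST_anticomm_dthetaF`). These relations have the same form before and after the change of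
fields; so if `φ` intertwines two differentials, its extension intertwines their parent extensions
(`IsParentHom.map_parentBRST`). One can therefore compute in the fields `w, v, φ`, where the
differential is `w ↦ v ↦ 0`, `φ ↦ S_R`. There `s^P w_(λ)[ν] - v_(λ)[ν]` is a combination of
derivatives of `w`'s (`parentBRST_pairsBRST_w`), so that the equations `w = 0`, `s^P w = 0` are
equivalent to `w = v = 0`, and `s^P` acts on the functions of the `φ_(λ)[ν]` as `(s_R)^P`.

All identities between (graded) derivations and homomorphisms are checked on the coordinates. That
this is enough is `Loc.twisted_derivation_eq_zero`, a consequence of Hadamard's lemma: a derivation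
that vanishes on the coordinates maps a smooth function into all powers of an ideal that is
nilpotent at every point. Conversely, homomorphisms exist with arbitrary values of the right parity
on the jet coordinates (`exists_subst`), by Taylor expansion of smooth functions in the nilpotent
part of their arguments.
-/

/-! ### Hadamard's lemma -/

theorem hasFDerivAt_parametric_integral {T : Type u} [Fintype T] {G : (T → ℝ) × ℝ → ℝ}
    (hG : ContDiff ℝ 1 G) (x : T → ℝ) :
    HasFDerivAt (fun x => ∫ t in (0 : ℝ)..1, G (x, t))
      (∫ t in (0 : ℝ)..1, (fderiv ℝ G (x, t)).comp (ContinuousLinearMap.inl ℝ (T → ℝ) ℝ)) x := by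
  have hc : Continuous G := hG.continuous
  have hd : Continuous fun p => (fderiv ℝ G p).comp (ContinuousLinearMap.inl ℝ (T → ℝ) ℝ) :=
    (hG.continuous_fderiv (by simp)).clm_comp continuous_const
  obtain ⟨C, hC⟩ := ((isCompact_closedBall x (1 : ℝ)).prod
    (isCompact_Icc (a := (0 : ℝ)) (b := 1))).exists_bound_of_continuousOn hd.continuousOn
  refine intervalIntegral.hasFDerivAt_integral_of_dominated_of_fderiv_le
    (F := fun x t => G (x, t))
    (F' := fun x t => (fderiv ℝ G (x, t)).comp (ContinuousLinearMap.inl ℝ (T → ℝ) ℝ))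
    (s := Metric.closedBall x 1) (bound := fun _ => C)
    (Metric.closedBall_mem_nhds x one_pos) ?_ ?_ ?_ ?_ ?_ ?_
  · exact Filter.Eventually.of_forall fun y =>
      (hc.comp (Continuous.prodMk_right y)).aestronglyMeasurable
  · exact (hc.comp (Continuous.prodMk_right x)).intervalIntegrable _ _
  · exact (hd.comp (Continuous.prodMk_right x)).aestronglyMeasurable
  · refine Filter.Eventually.of_forall fun t ht y hy => hC (y, t) ⟨hy, ?_⟩
    rw [Set.uIoc_of_le zero_le_one] at ht
    exact ⟨ht.1.le, ht.2⟩
  · exact intervalIntegrable_const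
  · refine Filter.Eventually.of_forall fun t _ y _ => ?_
    exact ((hG.differentiable (by simp)) (y, t)).hasFDerivAt.comp y (hasFDerivAt_prodMk_left y t)

/-- Smoothness follows by induction on the order: the partial derivatives of the integral are
integrals of the same kind. -/
theorem contDiff_parametric_integral {T : Type u} [Fintype T] {G : (T → ℝ) × ℝ → ℝ}
    (hG : ContDiff ℝ ∞ G) : ContDiff ℝ ∞ fun x => ∫ t in (0 : ℝ)..1, G (x, t) := by
  classical
  rw [contDiff_infty]
  intro k
  induction k generalizing G with
  | zero =>
    rw [Nat.cast_zero, contDiff_zero, continuous_iff_continuousAt]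
    exact fun x => (hasFDerivAt_parametric_integral (hG.of_le (by simp)) x).continuousAt
  | succ k ih =>
    have hG1 : ContDiff ℝ 1 G := hG.of_le (by simp)
    push_cast
    refine contDiff_succ_iff_hasFDerivAt.2 ⟨fun x => ∑ i : T,
      (∫ t in (0 : ℝ)..1, fderiv ℝ G (x, t) (Pi.single i 1, 0)) •
        (ContinuousLinearMap.proj (R := ℝ) (φ := fun _ : T => ℝ) i), ?_, fun x => ?_⟩
    · refine ContDiff.sum fun i _ => ?_
      have h := ih (G := fun p => fderiv ℝ G p (Pi.single i 1, 0))
        ((hG.fderiv_right (m := ∞) (by simp)).clm_apply contDiff_const)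
      exact h.smul contDiff_const
    · refine (hasFDerivAt_parametric_integral hG1 x).congr_fderiv ?_
      have hd : Continuous fun t : ℝ =>
          (fderiv ℝ G (x, t)).comp (ContinuousLinearMap.inl ℝ (T → ℝ) ℝ) :=
        ((hG1.continuous_fderiv (by simp)).comp (Continuous.prodMk_right x)).clm_comp
          continuous_const
      refine ContinuousLinearMap.coe_injective (LinearMap.pi_ext fun i c => ?_)
      rw [ContinuousLinearMap.coe_coe, ContinuousLinearMap.coe_coe,
        ContinuousLinearMap.intervalIntegral_apply (hd.intervalIntegrable _ _)]
      have h1 : (Pi.single i c : T → ℝ) = c • Pi.single i 1 := by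
        rw [← Pi.single_smul, smul_eq_mul, mul_one]
      simp only [sum_apply, smul_apply,
        ContinuousLinearMap.proj_apply, ContinuousLinearMap.comp_apply,
        ContinuousLinearMap.inl_apply, smul_eq_mul]
      rw [Finset.sum_eq_single i (fun j _ hj => by simp [Pi.single_eq_of_ne hj]) (by simp)]
      have h2 : ∀ t : ℝ, fderiv ℝ G (x, t) (Pi.single i c, 0) =
          c * fderiv ℝ G (x, t) (Pi.single i 1, 0) := fun t => by
        rw [← smul_eq_mul, ← map_smul, Prod.smul_mk, smul_zero, ← h1]
      simp [h2, mul_comm]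

/-- Hadamard's lemma: the remainder `g x - g a` is the integral of the derivative of `g` along the
segment from `a` to `x`. -/
theorem hadamard {T : Type u} [Fintype T] {g : (T → ℝ) → ℝ} (hg : ContDiff ℝ ∞ g) (a : T → ℝ) :
    ∃ h : T → (T → ℝ) → ℝ, (∀ i, ContDiff ℝ ∞ (h i)) ∧
      ∀ x, g x = g a + ∑ i, (x i - a i) * h i x := by
  classical
  have hl : ContDiff ℝ ∞ fun p : (T → ℝ) × ℝ => a + p.2 • (p.1 - a) :=
    contDiff_const.add (contDiff_snd.smul (contDiff_fst.sub contDiff_const))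
  have hG : ∀ i, ContDiff ℝ ∞ fun p : (T → ℝ) × ℝ =>
      fderiv ℝ g (a + p.2 • (p.1 - a)) (Pi.single i 1) := fun i =>
    ((hg.fderiv_right (m := ∞) (by simp)).comp hl).clm_apply contDiff_const
  refine ⟨fun i x => ∫ t in (0 : ℝ)..1, fderiv ℝ g (a + t • (x - a)) (Pi.single i 1),
    fun i => contDiff_parametric_integral (hG i), fun x => ?_⟩
  have hi : ∀ i, Continuous fun t : ℝ => fderiv ℝ g (a + t • (x - a)) (Pi.single i 1) :=
    fun i => (hG i).continuous.comp (Continuous.prodMk_right x)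
  have hderiv : ∀ t : ℝ, HasDerivAt (fun t : ℝ => g (a + t • (x - a)))
      (∑ i, (x i - a i) * fderiv ℝ g (a + t • (x - a)) (Pi.single i 1)) t := fun t => by
    have h1 : HasDerivAt (fun t : ℝ => a + t • (x - a)) (x - a) t := by
      simpa using ((hasDerivAt_id t).smul_const (x - a)).const_add a
    have h2 := ((hg.differentiable (by simp)) (a + t • (x - a))).hasFDerivAt.comp_hasDerivAt t h1
    have h3 : x - a = ∑ i, (x i - a i) • (Pi.single i 1 : T → ℝ) := by
      funext j
      simp [Finset.sum_apply, Pi.single_apply]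
    refine h2.congr_deriv ?_
    rw [congrArg (fderiv ℝ g (a + t • (x - a))) h3, map_sum]
    simp
  have key := intervalIntegral.integral_eq_sub_of_hasDerivAt (a := 0) (b := 1)
    (fun t _ => hderiv t)
    (Continuous.intervalIntegrable (continuous_finsetSum _ fun i _ =>
      continuous_const.mul (hi i)) _ _)
  rw [intervalIntegral.integral_finsetSum
    (f := fun i t => (x i - a i) * fderiv ℝ g (a + t • (x - a)) (Pi.single i 1)) fun i _ =>
    (continuous_const.mul (hi i)).intervalIntegrable _ _] at key
  simp only [intervalIntegral.integral_const_mul, one_smul, zero_smul, add_zero] at key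
  rw [key]
  simp

/-! ### Smooth functions of finitely many variables -/

/-- Finitely many nilpotent elements generate a nilpotent ideal. -/
theorem exists_span_pow_eq_bot {R : Type*} [CommRing R] {ι : Type*} (T : Finset ι)
    (z : ι → R) (hz : ∀ i, IsNilpotent (z i)) :
    ∃ N, Ideal.span (z '' (T : Set ι)) ^ N = ⊥ := by
  have h1 : Ideal.span (z '' (T : Set ι)) ≤ (⊥ : Ideal R).radical := by
    rw [Ideal.span_le]
    rintro _ ⟨i, _, rfl⟩
    exact mem_nilradical.2 (hz i)
  obtain ⟨N, hN⟩ := Ideal.exists_pow_le_of_le_radical_of_fg h1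
    (Submodule.fg_span (T.finite_toSet.image z))
  exact ⟨N, le_bot_iff.1 hN⟩

namespace SmoothFun

variable {E : Type u} {E' : Type v}

/-- `f` is a smooth function of the variables in `T`. -/
def DependsOn (T : Finset E) (f : SmoothFun E) : Prop :=
  ∃ g : (T → ℝ) → ℝ, ContDiff ℝ ∞ g ∧ ∀ q : E → ℝ, f.1 q = g (fun i => q i)

theorem exists_dependsOn (f : SmoothFun E) : ∃ T, DependsOn T f := f.2

theorem DependsOn.mono {T T' : Finset E} (h : T ⊆ T') {f : SmoothFun E} (hf : DependsOn T f) :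
    DependsOn T' f := by
  obtain ⟨g, hg, hfg⟩ := hf
  exact ⟨fun p => g fun i => p ⟨i.1, h i.2⟩,
    hg.comp (contDiff_pi.2 fun i => contDiff_apply ℝ ℝ _), hfg⟩

theorem exists_dependsOn₂ (f f' : SmoothFun E) : ∃ T, DependsOn T f ∧ DependsOn T f' := by
  classical
  obtain ⟨T, h⟩ := exists_dependsOn f
  obtain ⟨T', h'⟩ := exists_dependsOn f'
  exact ⟨T ∪ T', h.mono Finset.subset_union_left, h'.mono Finset.subset_union_right⟩

/-- Hadamard's lemma at the point `a`. -/
theorem DependsOn.exists_hadamard {T : Finset E} {f : SmoothFun E} (hf : DependsOn T f)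
    (a : E → ℝ) : ∃ h : T → SmoothFun E, (∀ i, DependsOn T (h i)) ∧
      f = algebraMap ℝ _ (f.1 a) + ∑ i : T, (var i.1 - algebraMap ℝ _ (a i)) * h i := by
  obtain ⟨g, hg, hfg⟩ := hf
  obtain ⟨h, hh, hgh⟩ := hadamard hg (fun i => a i)
  refine ⟨fun i => ⟨fun q => h i fun j => q j, T, h i, hh i, fun _ => rfl⟩,
    fun i => ⟨h i, hh i, fun _ => rfl⟩, Subtype.ext (funext fun q => ?_)⟩
  have := hgh fun i => q i
  rw [← hfg, ← hfg] at this
  rw [this]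
  simp [var, Pi.algebraMap_def]

/-- `pderiv` is a partial derivative in the sense of calculus. -/
theorem DependsOn.hasDerivAt [hE : DecidableEq E] {T : Finset E} {f : SmoothFun E}
    (hf : DependsOn T f) (e : E) (q : E → ℝ) :
    HasDerivAt (fun t => f.1 (Function.update q e t)) ((pderiv e f).1 q) (q e) := by
  obtain ⟨g, hg, hfg⟩ := hf
  have h := hasDerivAt_update T g hg hfg e q
  have h' := h.differentiableAt.hasDerivAt
  obtain rfl : hE = fun a b => Classical.propDecidable (a = b) := Subsingleton.elim _ _
  exact h'

theorem DependsOn.pderiv {T : Finset E} {f : SmoothFun E} (hf : DependsOn T f) (e : E) :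
    DependsOn T (pderiv e f) := by
  classical
  have hd := hf.hasDerivAt e
  obtain ⟨g, hg, hfg⟩ := hf
  exact ⟨fun p => fderiv ℝ g p (fun i => if i.1 = e then 1 else 0),
    (hg.fderiv_right (m := ∞) (by simp)).clm_apply contDiff_const,
    fun q => (hd q).unique (hasDerivAt_update T g hg hfg e q)⟩

theorem DependsOn.pderiv_eq_zero {T : Finset E} {f : SmoothFun E} (hf : DependsOn T f) {e : E}
    (he : e ∉ T) : SmoothFun.pderiv e f = 0 := by
  classical
  refine Subtype.ext (funext fun q => ?_)
  refine (hf.hasDerivAt e q).unique ?_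
  obtain ⟨g, hg, hfg⟩ := hf
  have : (fun t => f.1 (Function.update q e t)) = fun _ => g fun i => q i := by
    funext t
    rw [hfg]
    congr 1
    funext i
    rw [Function.update_of_ne]
    exact fun h => he (h ▸ i.2)
  rw [this]
  exact hasDerivAt_const _ _

theorem pderiv_mul (e : E) (f f' : SmoothFun E) :
    pderiv e (f * f') = pderiv e f * f' + f * pderiv e f' := by
  classical
  obtain ⟨T, h, h'⟩ := exists_dependsOn₂ f f'
  obtain ⟨T'', h''⟩ := exists_dependsOn (f * f')
  refine Subtype.ext (funext fun q => ?_)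
  refine (h''.hasDerivAt e q).unique ?_
  exact ((h.hasDerivAt e q).mul (h'.hasDerivAt e q)).congr_deriv (by simp)

theorem pderiv_algebraMap (e : E) (r : ℝ) : pderiv e (algebraMap ℝ (SmoothFun E) r) = 0 :=
  DependsOn.pderiv_eq_zero (T := ∅) ⟨fun _ => r, contDiff_const, fun _ => rfl⟩ (by simp)

theorem pderiv_one (e : E) : pderiv e (1 : SmoothFun E) = 0 := by
  simpa using pderiv_algebraMap e 1

theorem dependsOn_var (e : E) : DependsOn {e} (var e) :=
  ⟨fun q => q ⟨e, Finset.mem_singleton_self e⟩, contDiff_apply ℝ ℝ _, fun _ => rfl⟩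

theorem pderiv_var_self (e : E) : pderiv e (var e) = 1 := by
  classical
  refine Subtype.ext (funext fun q => ((dependsOn_var e).hasDerivAt e q).unique ?_)
  simpa [var] using hasDerivAt_id' (q e)

theorem pderiv_var_of_ne {e e' : E} (h : e ≠ e') : pderiv e (var e') = 0 :=
  (dependsOn_var e').pderiv_eq_zero (by simpa using h)

/-- Evaluation at a point. -/
def eval (q : E → ℝ) : SmoothFun E →ₐ[ℝ] ℝ where
  toFun f := f.1 q
  map_one' := rfl
  map_mul' _ _ := rfl
  map_zero' := rfl
  map_add' _ _ := rfl
  commutes' _ := rfl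

/-- Composition of a function of the variables `E` with functions `b e` of the variables `E'`. -/
def comp (b : E → SmoothFun E') : SmoothFun E →ₐ[ℝ] SmoothFun E' where
  toFun f := ⟨fun q => f.1 fun e => (b e).1 q, by
    classical
    obtain ⟨T, g, hg, hf⟩ := f.2
    choose U k hk hb using fun e => (b e).2
    refine ⟨T.biUnion U, fun p => g fun i => k i.1 fun j =>
      p ⟨j.1, Finset.mem_biUnion.2 ⟨i.1, i.2, j.2⟩⟩, ?_, fun q => ?_⟩
    · exact hg.comp (contDiff_pi.2 fun i =>
        (hk i.1).comp (contDiff_pi.2 fun j => contDiff_apply ℝ ℝ _))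
    · change f.1 _ = g _
      simp only [hf, hb]⟩
  map_one' := rfl
  map_mul' _ _ := rfl
  map_zero' := rfl
  map_add' _ _ := rfl
  commutes' _ := rfl

/-! ### Uniqueness of twisted derivations -/

/-- A derivation along two homomorphisms `φ`, `ψ` that vanishes on the variables vanishes, provided
that `φ` takes every variable to a real number plus a central nilpotent. By Hadamard's lemma at
those real numbers, iterated, the value on a function of the variables in `T` lies in every power of
the ideal generated by the corresponding finitely many nilpotents. With `D = φ - ψ` this says that
homomorphisms are determined by the variables. -/
theorem twisted_derivation_eq_zero {B : Type*} [Ring B] [Algebra ℝ B]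
    (φ ψ : SmoothFun E →ₐ[ℝ] B) (D : SmoothFun E →ₗ[ℝ] B)
    (hD : ∀ f g, D (f * g) = D f * ψ g + φ f * D g) (hvar : ∀ e, D (var e) = 0)
    (hφ : ∀ e, ∃ (r : ℝ) (z : Subalgebra.center ℝ B), IsNilpotent z ∧
      φ (var e) = algebraMap ℝ B r + z) (f : SmoothFun E) : D f = 0 := by
  choose r z hz hφ using hφ
  have hD1 : D 1 = 0 := by
    have := hD 1 1
    simpa using this
  have hDr : ∀ c : ℝ, D (algebraMap ℝ _ c) = 0 := fun c => by
    rw [Algebra.algebraMap_eq_smul_one, map_smul, hD1, smul_zero]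
  obtain ⟨T, hf⟩ := exists_dependsOn f
  have key : ∀ N : ℕ, ∀ f, DependsOn T f →
      D f ∈ (Ideal.span (z '' (T : Set E)) ^ N) • (⊤ : Submodule (Subalgebra.center ℝ B) B) := by
    intro N
    induction N with
    | zero => simp
    | succ N ih =>
      intro f hf
      obtain ⟨h, hh, hfh⟩ := hf.exists_hadamard r
      rw [hfh, map_add, hDr, zero_add, map_sum]
      refine Submodule.sum_mem _ fun i _ => ?_
      rw [hD, map_sub, hvar, hDr, sub_zero, zero_mul, zero_add, map_sub, hφ, AlgHom.commutes,
        add_sub_cancel_left, pow_succ', ← smul_eq_mul, Submodule.smul_assoc]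
      exact Submodule.smul_mem_smul (Ideal.subset_span ⟨i, i.2, rfl⟩) (ih _ (hh i))
  obtain ⟨N, hN⟩ := exists_span_pow_eq_bot T z hz
  have := key N f hf
  rwa [hN, Submodule.bot_smul, Submodule.mem_bot] at this

/-! ### Taylor expansion at nilpotent arguments -/

section Taylor

variable {C : Type v} [CommRing C] [Algebra ℝ C]

/-- The operator `f ↦ ∑ n_i τ(∂_i f)`. -/
def taylorStep (n : E → C) (τ : SmoothFun E →ₗ[ℝ] C) : SmoothFun E →ₗ[ℝ] C where
  toFun f := ∑ᶠ i, n i * τ (pderiv i f)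
  map_add' f g := by
    rw [← finsum_add_distrib]
    · exact finsum_congr fun j => by rw [map_add, map_add, mul_add]
    · exact (finite_pderiv f).subset fun j hj h => hj (by simp [h])
    · exact (finite_pderiv g).subset fun j hj h => hj (by simp [h])
  map_smul' r f := by
    rw [RingHom.id_apply, smul_finsum' r
      ((finite_pderiv f).subset fun j hj h => hj (by simp [h]))]
    exact finsum_congr fun j => by rw [map_smul, map_smul, mul_smul_comm]

theorem taylorStep_apply (n : E → C) (τ : SmoothFun E →ₗ[ℝ] C) {T : Finset E} {f : SmoothFun E}
    (hf : DependsOn T f) : taylorStep n τ f = ∑ i ∈ T, n i * τ (pderiv i f) := by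
  refine finsum_eq_sum_of_support_subset _ fun i hi => ?_
  by_contra h
  exact hi (by simp [hf.pderiv_eq_zero h])

/-- The homogeneous terms of the Taylor expansion of `f` at `β + n`. -/
def taylorTerm (β : SmoothFun E →ₐ[ℝ] C) (n : E → C) : ℕ → SmoothFun E →ₗ[ℝ] C
  | 0 => β.toLinearMap
  | k + 1 => ((k + 1 : ℝ)⁻¹) • taylorStep n (taylorTerm β n k)

theorem succ_smul_taylorTerm (β : SmoothFun E →ₐ[ℝ] C) (n : E → C) (k : ℕ) (f : SmoothFun E) :
    ((k + 1 : ℕ) : ℝ) • taylorTerm β n (k + 1) f = taylorStep n (taylorTerm β n k) f := by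
  rw [taylorTerm, LinearMap.smul_apply, smul_smul]
  push_cast
  rw [mul_inv_cancel₀ (by positivity), one_smul]

/-- The Leibniz rule for the terms of the Taylor expansion; it makes the sum of the terms
multiplicative. -/
theorem taylorTerm_mul (β : SmoothFun E →ₐ[ℝ] C) (n : E → C) (k : ℕ) (f g : SmoothFun E) :
    taylorTerm β n k (f * g) =
      ∑ p ∈ Finset.HasAntidiagonal.antidiagonal k, taylorTerm β n p.1 f * taylorTerm β n p.2 g := by
  induction k generalizing f g with
  | zero => simp [taylorTerm]
  | succ k ih =>
    obtain ⟨T, hf, hg⟩ := exists_dependsOn₂ f g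
    obtain ⟨T', hfg⟩ := exists_dependsOn (f * g)
    obtain ⟨U, hf, hg, hfg⟩ : ∃ U, DependsOn U f ∧ DependsOn U g ∧ DependsOn U (f * g) := by
      classical
      exact ⟨T ∪ T', hf.mono Finset.subset_union_left, hg.mono Finset.subset_union_left,
        hfg.mono Finset.subset_union_right⟩
    have hk : ((k + 1 : ℕ) : ℝ) ≠ 0 := by positivity
    refine (smul_right_inj hk).1 ?_
    rw [succ_smul_taylorTerm, taylorStep_apply _ _ hfg]
    have h1 : ((k + 1 : ℕ) : ℝ) • ∑ p ∈ Finset.HasAntidiagonal.antidiagonal (k + 1),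
          taylorTerm β n p.1 f * taylorTerm β n p.2 g =
        ∑ p ∈ Finset.HasAntidiagonal.antidiagonal (k + 1),
          ((p.1 : ℝ) • taylorTerm β n p.1 f) * taylorTerm β n p.2 g +
        ∑ p ∈ Finset.HasAntidiagonal.antidiagonal (k + 1),
          taylorTerm β n p.1 f * ((p.2 : ℝ) • taylorTerm β n p.2 g) := by
      rw [Finset.smul_sum, ← Finset.sum_add_distrib]
      refine Finset.sum_congr rfl fun p hp => ?_
      rw [← Finset.HasAntidiagonal.mem_antidiagonal.1 hp, smul_mul_assoc, mul_smul_comm, ← add_smul]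
      push_cast
      rfl
    rw [h1, Finset.Nat.sum_antidiagonal_succ, Finset.Nat.sum_antidiagonal_succ']
    simp only [Nat.cast_zero, zero_smul, zero_mul, mul_zero, zero_add,
      succ_smul_taylorTerm, taylorStep_apply _ _ hf, taylorStep_apply _ _ hg]
    simp only [pderiv_mul, map_add, ih, Finset.sum_mul, Finset.mul_sum, mul_add,
      Finset.sum_add_distrib]
    congr 1
    · rw [Finset.sum_comm]
      exact Finset.sum_congr rfl fun p _ => Finset.sum_congr rfl fun i _ => by ring
    · rw [Finset.sum_comm]
      exact Finset.sum_congr rfl fun p _ => Finset.sum_congr rfl fun i _ => by ring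

/-- The expansion terminates, since the `n e` that occur are finitely many nilpotents. -/
theorem taylorTerm_mem_pow (β : SmoothFun E →ₐ[ℝ] C) (n : E → C) {T : Finset E} (k : ℕ)
    {f : SmoothFun E} (hf : DependsOn T f) :
    taylorTerm β n k f ∈ Ideal.span (n '' (T : Set E)) ^ k := by
  induction k generalizing f with
  | zero => simp
  | succ k ih =>
    rw [taylorTerm, LinearMap.smul_apply, taylorStep_apply _ _ hf, Algebra.smul_def, pow_succ']
    exact Ideal.mul_mem_left _ _ (Ideal.sum_mem _ fun i hi =>
      Ideal.mul_mem_mul (Ideal.subset_span ⟨i, hi, rfl⟩) (ih (hf.pderiv i)))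

/-- The terms of the expansion are the coefficients of a polynomial; its value at `1` is their
sum. -/
theorem exists_taylorPoly (β : SmoothFun E →ₐ[ℝ] C) (n : E → C) (hn : ∀ e, IsNilpotent (n e))
    (f : SmoothFun E) : ∃ P : Polynomial C, ∀ k, P.coeff k = taylorTerm β n k f := by
  obtain ⟨T, hf⟩ := exists_dependsOn f
  obtain ⟨N, hN⟩ := exists_span_pow_eq_bot T n hn
  refine ⟨∑ k ∈ Finset.range N, Polynomial.monomial k (taylorTerm β n k f), fun k => ?_⟩
  rw [Polynomial.finsetSum_coeff]
  simp only [Polynomial.coeff_monomial, Finset.sum_ite_eq', Finset.mem_range]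
  split_ifs with h
  · rfl
  · have := taylorTerm_mem_pow β n k hf
    rw [← Nat.sub_add_cancel (not_lt.1 h), pow_add, hN, Ideal.mul_bot] at this
    rw [Nat.sub_add_cancel (not_lt.1 h)] at this
    exact ((Submodule.mem_bot _).1 this).symm

theorem taylorTerm_succ_algebraMap (β : SmoothFun E →ₐ[ℝ] C) (n : E → C) (k : ℕ) (r : ℝ) :
    taylorTerm β n (k + 1) (algebraMap ℝ _ r) = 0 := by
  have : DependsOn ∅ (algebraMap ℝ (SmoothFun E) r) :=
    ⟨fun _ => r, contDiff_const, fun _ => rfl⟩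
  rw [taylorTerm, LinearMap.smul_apply, taylorStep_apply _ _ this]
  simp

/-- A homomorphism out of the smooth functions can be shifted by arbitrary nilpotent values on the
variables. -/
theorem exists_nilpotent_shift (β : SmoothFun E →ₐ[ℝ] C) (n : E → C)
    (hn : ∀ e, IsNilpotent (n e)) :
    ∃ Φ : SmoothFun E →ₐ[ℝ] C, ∀ e, Φ (var e) = β (var e) + n e := by
  choose P hP using exists_taylorPoly β n hn
  have hadd : ∀ f g, P (f + g) = P f + P g := fun f g => by
    ext k
    simp [hP]
  have hmul : ∀ f g, P (f * g) = P f * P g := fun f g => by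
    ext k
    simp [hP, Polynomial.coeff_mul, taylorTerm_mul]
  have halg : ∀ r : ℝ, P (algebraMap ℝ _ r) = Polynomial.C (algebraMap ℝ C r) := fun r => by
    ext k
    rw [hP, Polynomial.coeff_C]
    cases k with
    | zero => simp [taylorTerm]
    | succ k => simp [taylorTerm_succ_algebraMap]
  have hvar : ∀ e, P (var e) = Polynomial.C (β (var e)) + Polynomial.X * Polynomial.C (n e) := by
    intro e
    ext k
    rw [hP, Polynomial.coeff_add, Polynomial.coeff_C]
    match k with
    | 0 => simp [taylorTerm]
    | 1 =>
      rw [taylorTerm, LinearMap.smul_apply, taylorStep_apply _ _ (dependsOn_var e)]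
      simp [taylorTerm, pderiv_var_self]
    | k + 2 =>
      have h1 := taylorTerm_succ_algebraMap β n k 1
      rw [map_one] at h1
      rw [taylorTerm, LinearMap.smul_apply, taylorStep_apply _ _ (dependsOn_var e)]
      simp [pderiv_var_self, h1]
  refine ⟨{ toFun := fun f => (P f).eval 1
            map_one' := ?_, map_mul' := ?_, map_zero' := ?_, map_add' := ?_, commutes' := ?_ }, ?_⟩
  · rw [← map_one (algebraMap ℝ (SmoothFun E)), halg]
    simp
  · intro f g
    rw [hmul, Polynomial.eval_mul]
  · rw [← map_zero (algebraMap ℝ (SmoothFun E)), halg]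
    simp
  · intro f g
    rw [hadd, Polynomial.eval_add]
  · intro r
    rw [halg, Polynomial.eval_C]
  · intro e
    change (P (var e)).eval 1 = _
    rw [hvar]
    simp

end Taylor

end SmoothFun

/-! ### The Grassmann algebra -/

section Grassmann

variable {V : Type u} [AddCommGroup V] [Module ℝ V]

open CliffordAlgebra (involute contractLeft)

/-- The parity involution of the Grassmann algebra. -/
def grInv : ExteriorAlgebra ℝ V →ₐ[ℝ] ExteriorAlgebra ℝ V :=
  involute (Q := (0 : QuadraticForm ℝ V))

theorem grInv_ι (m : V) : grInv (ExteriorAlgebra.ι ℝ m) = -ExteriorAlgebra.ι ℝ m :=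
  CliffordAlgebra.involute_ι m

theorem grInv_grInv (x : ExteriorAlgebra ℝ V) : grInv (grInv x) = x :=
  CliffordAlgebra.involute_involute x

@[elab_as_elim]
theorem grassmann_induction {P : ExteriorAlgebra ℝ V → Prop} (x : ExteriorAlgebra ℝ V)
    (algebraMap : ∀ r : ℝ, P (algebraMap ℝ _ r)) (add : ∀ x y, P x → P y → P (x + y))
    (ι_mul : ∀ x m, P x → P (ExteriorAlgebra.ι ℝ m * x)) : P x :=
  CliffordAlgebra.left_induction (Q := (0 : QuadraticForm ℝ V)) algebraMap add ι_mul x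

theorem ι_mul_grassmann (m : V) (x : ExteriorAlgebra ℝ V) :
    ExteriorAlgebra.ι ℝ m * x = grInv x * ExteriorAlgebra.ι ℝ m := by
  induction x using grassmann_induction with
  | algebraMap r => rw [AlgHom.commutes, Algebra.commutes]
  | add x y hx hy => rw [mul_add, map_add, add_mul, hx, hy]
  | ι_mul x m' hx =>
    rw [map_mul, grInv_ι, ← mul_assoc,
      eq_neg_of_add_eq_zero_left (ExteriorAlgebra.ι_add_mul_swap m m'), neg_mul, mul_assoc, hx,
      neg_mul, neg_mul, mul_assoc]

/-- Graded commutativity, for the even and the odd part of `x` (up to a factor `2`). -/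
theorem grassmann_supercomm (x y : ExteriorAlgebra ℝ V) :
    (x + grInv x) * y = y * (x + grInv x) ∧ (x - grInv x) * y = grInv y * (x - grInv x) := by
  induction x using grassmann_induction generalizing y with
  | algebraMap r =>
    rw [AlgHom.commutes, sub_self, zero_mul, mul_zero, ← map_add, Algebra.commutes]
    exact ⟨rfl, rfl⟩
  | add x x' hx hx' =>
    obtain ⟨h1, h2⟩ := hx y
    obtain ⟨h3, h4⟩ := hx' y
    rw [map_add, add_add_add_comm, add_mul, mul_add, h1, h3, add_sub_add_comm, add_mul, mul_add,
      h2, h4]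
    exact ⟨rfl, (mul_add _ _ _).symm⟩
  | ι_mul x m hx =>
    obtain ⟨h1, h2⟩ := hx y
    rw [map_mul, grInv_ι, neg_mul, ← sub_eq_add_neg, sub_neg_eq_add, ← mul_sub, ← mul_add]
    constructor
    · rw [mul_assoc, h2, ← mul_assoc, ι_mul_grassmann, grInv_grInv, mul_assoc]
    · rw [mul_assoc, h1, ← mul_assoc, ι_mul_grassmann, mul_assoc]

/-- The even part of a Grassmann number differs from its body by a nilpotent element. -/
theorem grassmann_soul_nilpotent (x : ExteriorAlgebra ℝ V) :
    IsNilpotent (x + grInv x - (2 : ℝ) • algebraMap ℝ _ (ExteriorAlgebra.algebraMapInv x)) := by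
  induction x using grassmann_induction with
  | algebraMap r =>
    rw [AlgHom.commutes, ExteriorAlgebra.algebraMap_leftInverse, two_smul, sub_self]
    exact IsNilpotent.zero
  | add x y hx hy =>
    have hc : Commute (x + grInv x - (2 : ℝ) • algebraMap ℝ _ (ExteriorAlgebra.algebraMapInv x))
        (y + grInv y - (2 : ℝ) • algebraMap ℝ _ (ExteriorAlgebra.algebraMapInv y)) := by
      refine Commute.sub_left (grassmann_supercomm x _).1 ?_
      exact Commute.smul_left (Algebra.commutes _ _) _
    convert hc.isNilpotent_add hx hy using 1
    simp only [map_add, smul_add]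
    abel
  | ι_mul x m hx =>
    have h : ExteriorAlgebra.algebraMapInv (ExteriorAlgebra.ι ℝ m) = (0 : ℝ) := by
      simp [ExteriorAlgebra.algebraMapInv]
    rw [map_mul, map_mul, h, zero_mul, map_zero, smul_zero, sub_zero, grInv_ι, neg_mul,
      ← sub_eq_add_neg, ← mul_sub]
    refine ⟨2, ?_⟩
    rw [pow_two, mul_assoc, ← mul_assoc (x - grInv x), (grassmann_supercomm x _).2, grInv_ι,
      neg_mul, neg_mul, mul_neg, ← mul_assoc, ← mul_assoc, ExteriorAlgebra.ι_sq_zero, zero_mul,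
      zero_mul, neg_zero]

/-- Contraction is an odd derivation. -/
theorem contractLeft_grassmann_mul (d : Module.Dual ℝ V) (x y : ExteriorAlgebra ℝ V) :
    contractLeft (Q := (0 : QuadraticForm ℝ V)) d (x * y) =
      contractLeft (Q := (0 : QuadraticForm ℝ V)) d x * y +
        grInv x * contractLeft (Q := (0 : QuadraticForm ℝ V)) d y := by
  induction x using grassmann_induction with
  | algebraMap r =>
    rw [AlgHom.commutes]
    refine (CliffordAlgebra.contractLeft_algebraMap_mul d r y).trans ?_
    rw [(CliffordAlgebra.contractLeft_algebraMap _ d r :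
      contractLeft (Q := (0 : QuadraticForm ℝ V)) d (algebraMap ℝ (ExteriorAlgebra ℝ V) r) = 0),
      zero_mul, zero_add]
  | add x x' hx hx' =>
    rw [add_mul, map_add, hx, hx', map_add, map_add, add_mul, add_mul]
    abel
  | ι_mul x m hx =>
    have h := fun z : ExteriorAlgebra ℝ V =>
      (CliffordAlgebra.contractLeft_ι_mul (Q := (0 : QuadraticForm ℝ V)) d m z :
        contractLeft (Q := (0 : QuadraticForm ℝ V)) d (ExteriorAlgebra.ι ℝ m * z) =
          d m • z - ExteriorAlgebra.ι ℝ m * contractLeft (Q := (0 : QuadraticForm ℝ V)) d z)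
    rw [mul_assoc, h, h, hx, map_mul, grInv_ι, mul_add, sub_mul, smul_mul_assoc, mul_assoc,
      neg_mul, neg_mul, mul_assoc]
    abel

theorem grInv_contractLeft (d : Module.Dual ℝ V) (x : ExteriorAlgebra ℝ V) :
    contractLeft (Q := (0 : QuadraticForm ℝ V)) d (grInv x) =
      -grInv (contractLeft (Q := (0 : QuadraticForm ℝ V)) d x) := by
  induction x using grassmann_induction with
  | algebraMap r =>
    rw [AlgHom.commutes]
    rw [(CliffordAlgebra.contractLeft_algebraMap _ d r :
      contractLeft (Q := (0 : QuadraticForm ℝ V)) d (algebraMap ℝ (ExteriorAlgebra ℝ V) r) = 0),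
      map_zero, neg_zero]
  | add x x' hx hx' => rw [map_add, map_add, hx, hx', map_add, map_add, neg_add]
  | ι_mul x m hx =>
    have h := fun z : ExteriorAlgebra ℝ V =>
      (CliffordAlgebra.contractLeft_ι_mul (Q := (0 : QuadraticForm ℝ V)) d m z :
        contractLeft (Q := (0 : QuadraticForm ℝ V)) d (ExteriorAlgebra.ι ℝ m * z) =
          d m • z - ExteriorAlgebra.ι ℝ m * contractLeft (Q := (0 : QuadraticForm ℝ V)) d z)
    rw [map_mul, grInv_ι, neg_mul, map_neg, h, h, hx, map_sub, map_smul, map_mul, grInv_ι, mul_neg,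
      neg_mul]

end Grassmann

/-! ### The superalgebra of local functions -/

section LocAlgebra

variable {n : ℕ} {F : FieldContent.{u}}

theorem Loc.tmul_mul (a a' : SmoothFun (EvenVar n F)) (b b' : ExteriorAlgebra ℝ (OddVar n F →₀ ℝ)) :
    Loc.tmul a b * Loc.tmul a' b' = Loc.tmul (a * a') (b * b') :=
  Algebra.TensorProduct.tmul_mul_tmul a a' b b'

theorem Loc.tmul_add (a : SmoothFun (EvenVar n F)) (b b' : ExteriorAlgebra ℝ (OddVar n F →₀ ℝ)) :
    (Loc.tmul a (b + b') : Loc n F) = Loc.tmul a b + Loc.tmul a b' :=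
  TensorProduct.tmul_add a b b'

theorem Loc.add_tmul (a a' : SmoothFun (EvenVar n F)) (b : ExteriorAlgebra ℝ (OddVar n F →₀ ℝ)) :
    (Loc.tmul (a + a') b : Loc n F) = Loc.tmul a b + Loc.tmul a' b :=
  TensorProduct.add_tmul a a' b

theorem Loc.tmul_sub (a : SmoothFun (EvenVar n F)) (b b' : ExteriorAlgebra ℝ (OddVar n F →₀ ℝ)) :
    (Loc.tmul a (b - b') : Loc n F) = Loc.tmul a b - Loc.tmul a b' :=
  TensorProduct.tmul_sub a b b'

theorem Loc.tmul_neg (a : SmoothFun (EvenVar n F)) (b : ExteriorAlgebra ℝ (OddVar n F →₀ ℝ)) :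
    (Loc.tmul a (-b) : Loc n F) = -Loc.tmul a b :=
  TensorProduct.tmul_neg a b

/-- Functions of the commuting coordinates alone. -/
def Loc.inclEven : SmoothFun (EvenVar n F) →ₐ[ℝ] Loc n F :=
  (Algebra.TensorProduct.includeLeft :
    _ →ₐ[ℝ] SmoothFun (EvenVar n F) ⊗[ℝ] ExteriorAlgebra ℝ (OddVar n F →₀ ℝ))

/-- Functions of the anticommuting coordinates alone. -/
def Loc.inclOdd : ExteriorAlgebra ℝ (OddVar n F →₀ ℝ) →ₐ[ℝ] Loc n F :=
  (Algebra.TensorProduct.includeRight :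
    _ →ₐ[ℝ] SmoothFun (EvenVar n F) ⊗[ℝ] ExteriorAlgebra ℝ (OddVar n F →₀ ℝ))

theorem Loc.inclEven_apply (a : SmoothFun (EvenVar n F)) :
    (Loc.inclEven a : Loc n F) = Loc.tmul a 1 := rfl

theorem Loc.inclOdd_apply (b : ExteriorAlgebra ℝ (OddVar n F →₀ ℝ)) :
    (Loc.inclOdd b : Loc n F) = Loc.tmul 1 b := rfl

theorem Loc.tmul_eq (a : SmoothFun (EvenVar n F)) (b : ExteriorAlgebra ℝ (OddVar n F →₀ ℝ)) :
    (Loc.tmul a b : Loc n F) = Loc.inclEven a * Loc.inclOdd b := by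
  rw [inclEven_apply, inclOdd_apply, tmul_mul, mul_one, one_mul]

/-- The parity involution as an algebra homomorphism. -/
def parityHom : Loc n F →ₐ[ℝ] Loc n F :=
  (Algebra.TensorProduct.map (AlgHom.id ℝ _) grInv :
    SmoothFun (EvenVar n F) ⊗[ℝ] ExteriorAlgebra ℝ (OddVar n F →₀ ℝ) →ₐ[ℝ]
      SmoothFun (EvenVar n F) ⊗[ℝ] ExteriorAlgebra ℝ (OddVar n F →₀ ℝ))

theorem parityHom_tmul (a : SmoothFun (EvenVar n F)) (b : ExteriorAlgebra ℝ (OddVar n F →₀ ℝ)) :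
    parityHom (Loc.tmul a b : Loc n F) = Loc.tmul a (grInv b) :=
  Loc.map_tmul _ _ _ _

theorem parityHom_parityHom (f : Loc n F) : parityHom (parityHom f) = f := by
  induction f using Loc.induction with
  | zero => simp
  | tmul a b => rw [parityHom_tmul, parityHom_tmul, grInv_grInv]
  | add f g hf hg => rw [map_add, map_add, hf, hg]

theorem Loc.supercomm (x y : Loc n F) :
    (x + parityHom x) * y = y * (x + parityHom x) ∧
      (x - parityHom x) * y = parityHom y * (x - parityHom x) := by
  induction x using Loc.induction with
  | zero => simp
  | add x x' hx hx' =>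
    obtain ⟨h1, h2⟩ := hx
    obtain ⟨h3, h4⟩ := hx'
    rw [map_add, add_add_add_comm, add_mul, mul_add, h1, h3, add_sub_add_comm, add_mul, mul_add,
      h2, h4]
    exact ⟨rfl, (mul_add _ _ _).symm⟩
  | tmul a b =>
    rw [parityHom_tmul, ← Loc.tmul_add, ← Loc.tmul_sub]
    induction y using Loc.induction with
    | zero => simp
    | add y y' hy hy' =>
      rw [mul_add, add_mul, hy.1, hy'.1, mul_add, map_add, add_mul, hy.2, hy'.2]
      exact ⟨rfl, rfl⟩
    | tmul a' b' =>
      rw [parityHom_tmul, tmul_mul, tmul_mul, tmul_mul, tmul_mul, (grassmann_supercomm b b').1,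
        (grassmann_supercomm b b').2, mul_comm a a']
      exact ⟨rfl, rfl⟩

/-- The twist `f ↦ (-1)^{p|f|} f` of local functions. -/
def twist (p : ZMod 2) : Loc n F →ₐ[ℝ] Loc n F := if p = 0 then AlgHom.id ℝ _ else parityHom

/-- `f` has parity `p`. -/
def HasParity (p : ZMod 2) (f : Loc n F) : Prop := parityHom f = sgn p • f

theorem sgn_zero : sgn 0 = 1 := by simp [sgn]

theorem sgn_one : sgn 1 = -1 := by simp [sgn]

theorem zmod_two_cases (p : ZMod 2) : p = 0 ∨ p = 1 := by
  fin_cases p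
  · exact Or.inl rfl
  · exact Or.inr rfl

theorem sgn_add (p q : ZMod 2) : sgn (p + q) = sgn p * sgn q := by
  have h : (1 + 1 : ZMod 2) = 0 := rfl
  rcases zmod_two_cases p with rfl | rfl <;> rcases zmod_two_cases q with rfl | rfl <;>
    simp [sgn_zero, sgn_one, h]

theorem sgn_mul_self (p : ZMod 2) : sgn p * sgn p = 1 := by
  rcases zmod_two_cases p with rfl | rfl <;> simp [sgn_zero, sgn_one]

theorem twist_zero : (twist 0 : Loc n F →ₐ[ℝ] Loc n F) = AlgHom.id ℝ _ := if_pos rfl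

theorem twist_one : (twist 1 : Loc n F →ₐ[ℝ] Loc n F) = parityHom := if_neg one_ne_zero

theorem twist_zero_apply (f : Loc n F) : twist 0 f = f := by rw [twist_zero]; rfl

theorem twist_one_apply (f : Loc n F) : twist 1 f = parityHom f := by rw [twist_one]

theorem twist_twist (p q : ZMod 2) (f : Loc n F) : twist p (twist q f) = twist (p + q) f := by
  have h : (1 + 1 : ZMod 2) = 0 := rfl
  rcases zmod_two_cases p with rfl | rfl <;> rcases zmod_two_cases q with rfl | rfl <;>
    simp [twist_zero_apply, twist_one_apply, h, parityHom_parityHom]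

/-- Graded commutativity. -/
theorem HasParity.mul_comm {p : ZMod 2} {c : Loc n F} (hc : HasParity p c) (f : Loc n F) :
    c * f = twist p f * c := by
  have h := Loc.supercomm c f
  have h2 : (2 : ℝ) ≠ 0 := two_ne_zero
  rcases zmod_two_cases p with rfl | rfl
  · rw [HasParity, sgn_zero, one_smul] at hc
    rw [hc, ← two_smul ℝ, smul_mul_assoc, mul_smul_comm] at h
    rw [twist_zero_apply]
    exact (smul_right_inj h2).1 h.1
  · rw [HasParity, sgn_one, neg_one_smul] at hc
    rw [hc, sub_neg_eq_add, ← two_smul ℝ, smul_mul_assoc, mul_smul_comm] at h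
    rw [twist_one_apply]
    exact (smul_right_inj h2).1 h.2

theorem HasParity.zero (p : ZMod 2) : HasParity p (0 : Loc n F) := by simp [HasParity]

theorem HasParity.add {p : ZMod 2} {f g : Loc n F} (hf : HasParity p f) (hg : HasParity p g) :
    HasParity p (f + g) := by
  rw [HasParity] at *
  rw [map_add, hf, hg, smul_add]

theorem HasParity.smul {p : ZMod 2} {f : Loc n F} (r : ℝ) (hf : HasParity p f) :
    HasParity p (r • f) := by
  rw [HasParity] at *
  rw [map_smul, hf, smul_comm]

theorem HasParity.sum {ι : Type*} {p : ZMod 2} {s : Finset ι} {f : ι → Loc n F}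
    (hf : ∀ i ∈ s, HasParity p (f i)) : HasParity p (∑ i ∈ s, f i) :=
  Finset.sum_induction _ _ (fun _ _ => HasParity.add) (HasParity.zero p) hf

theorem HasParity.mul_self {c : Loc n F} (hc : HasParity 1 c) : c * c = 0 := by
  have h := hc.mul_comm c
  rw [twist_one_apply, hc, sgn_one, neg_one_smul, neg_mul] at h
  have h2 : (2 : ℝ) ≠ 0 := two_ne_zero
  refine (smul_right_inj h2).1 ?_
  rw [two_smul, smul_zero]
  exact add_eq_zero_iff_eq_neg.2 h

theorem parityHom_inclEven (a : SmoothFun (EvenVar n F)) :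
    HasParity 0 (Loc.inclEven a : Loc n F) := by
  rw [HasParity, sgn_zero, one_smul, Loc.inclEven_apply, parityHom_tmul, map_one]

theorem hasParity_xcoord (m : Fin n) : HasParity 0 (xcoord F m) := parityHom_inclEven _

theorem coord_of_even {j : Jet n F} (h : F.parity j.1 = 0) :
    coord j = Loc.inclEven (SmoothFun.var (Sum.inr ⟨j, h⟩ : EvenVar n F)) := dif_pos h

theorem coord_of_odd {j : Jet n F} (h : F.parity j.1 ≠ 0) :
    coord j = Loc.inclOdd (ExteriorAlgebra.ι ℝ (Finsupp.single (⟨j, h⟩ : OddVar n F) 1)) :=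
  dif_neg h

theorem hasParity_coord (j : Jet n F) : HasParity (F.parity j.1) (coord j) := by
  by_cases h : F.parity j.1 = 0
  · rw [h, coord_of_even h]
    exact parityHom_inclEven _
  · rw [(zmod_two_cases _).resolve_left h, coord_of_odd h, HasParity, Loc.inclOdd_apply,
      parityHom_tmul, grInv_ι, sgn_one, neg_one_smul, Loc.tmul_neg]

/-- The body of a local function. -/
def Loc.body : Loc n F →ₐ[ℝ] SmoothFun (EvenVar n F) :=
  ((Algebra.TensorProduct.rid ℝ ℝ _).toAlgHom.comp
    (Algebra.TensorProduct.map (AlgHom.id ℝ _) ExteriorAlgebra.algebraMapInv) :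
    SmoothFun (EvenVar n F) ⊗[ℝ] ExteriorAlgebra ℝ (OddVar n F →₀ ℝ) →ₐ[ℝ] _)

theorem Loc.body_tmul (a : SmoothFun (EvenVar n F)) (b : ExteriorAlgebra ℝ (OddVar n F →₀ ℝ)) :
    (Loc.tmul a b : Loc n F).body = ExteriorAlgebra.algebraMapInv b • a := rfl

theorem HasParity.mem_center {c : Loc n F} (hc : HasParity 0 c) :
    c ∈ Subalgebra.center ℝ (Loc n F) := by
  rw [Subalgebra.mem_center_iff]
  intro b
  rw [hc.mul_comm, twist_zero_apply]

/-- The even part of a local function differs from its body by a nilpotent local function. -/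
theorem Loc.soul_nilpotent (x : Loc n F) :
    IsNilpotent (x + parityHom x - (2 : ℝ) • Loc.inclEven x.body) := by
  induction x using Loc.induction with
  | zero => simp
  | add x y hx hy =>
    have hc : Commute (x + parityHom x - (2 : ℝ) • Loc.inclEven x.body)
        (y + parityHom y - (2 : ℝ) • Loc.inclEven y.body) := by
      refine Commute.sub_left (Loc.supercomm x _).1 ?_
      have := ((parityHom_inclEven x.body).smul 2).mul_comm
        (y + parityHom y - (2 : ℝ) • Loc.inclEven y.body)
      rwa [twist_zero_apply] at this
    convert hc.isNilpotent_add hx hy using 1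
    simp only [map_add, smul_add]
    abel
  | tmul a b =>
    obtain ⟨N, hN⟩ := grassmann_soul_nilpotent b
    refine ⟨N, ?_⟩
    have h : (Loc.tmul a b : Loc n F) + parityHom (Loc.tmul a b) -
        (2 : ℝ) • Loc.inclEven (Loc.tmul a b : Loc n F).body = Loc.inclEven a *
          Loc.inclOdd (b + grInv b -
            (2 : ℝ) • algebraMap ℝ _ (ExteriorAlgebra.algebraMapInv b)) := by
      rw [parityHom_tmul, Loc.body_tmul, Loc.tmul_eq, Loc.tmul_eq, map_sub, map_add, map_smul,
        map_smul, AlgHom.commutes, mul_sub, mul_add, Algebra.algebraMap_eq_smul_one, mul_smul_comm,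
        mul_smul_comm, mul_one]
    have hc : Commute (Loc.inclEven a : Loc n F) (Loc.inclOdd (b + grInv b -
            (2 : ℝ) • algebraMap ℝ _ (ExteriorAlgebra.algebraMapInv b))) := by
      have := (parityHom_inclEven (F := F) a).mul_comm (Loc.inclOdd (b + grInv b -
            (2 : ℝ) • algebraMap ℝ _ (ExteriorAlgebra.algebraMapInv b)))
      rwa [twist_zero_apply] at this
    rw [h, hc.mul_pow, ← map_pow Loc.inclOdd, hN, map_zero, mul_zero]

theorem HasParity.soul_nilpotent {c : Loc n F} (hc : HasParity 0 c) :
    IsNilpotent (c - Loc.inclEven c.body) := by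
  have h := Loc.soul_nilpotent c
  rw [hc, sgn_zero, one_smul, ← two_smul ℝ, ← smul_sub] at h
  obtain ⟨N, hN⟩ := h
  refine ⟨N, ?_⟩
  rw [smul_pow] at hN
  exact (smul_eq_zero.1 hN).resolve_left (by positivity)

/-- The value at a point of the space of commuting coordinates, a Grassmann number. -/
def Loc.evalAt (q : EvenVar n F → ℝ) : Loc n F →ₐ[ℝ] ExteriorAlgebra ℝ (OddVar n F →₀ ℝ) :=
  ((Algebra.TensorProduct.lid ℝ _).toAlgHom.comp
    (Algebra.TensorProduct.map (SmoothFun.eval q) (AlgHom.id ℝ _)) :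
    SmoothFun (EvenVar n F) ⊗[ℝ] ExteriorAlgebra ℝ (OddVar n F →₀ ℝ) →ₐ[ℝ] _)

theorem Loc.evalAt_tmul (q : EvenVar n F → ℝ) (a : SmoothFun (EvenVar n F))
    (b : ExteriorAlgebra ℝ (OddVar n F →₀ ℝ)) :
    (Loc.tmul a b : Loc n F).evalAt q = a.1 q • b := rfl

/-- A local function is determined by its values at the points. -/
theorem Loc.eq_zero_of_evalAt {f : Loc n F} (h : ∀ q, f.evalAt q = 0) : f = 0 := by
  classical
  let B := Module.Basis.ofVectorSpace ℝ (ExteriorAlgebra ℝ (OddVar n F →₀ ℝ))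
  let T : Loc n F ≃ₗ[ℝ] _ :=
    TensorProduct.equivFinsuppOfBasisRight (M := SmoothFun (EvenVar n F)) B
  have key : ∀ (f : Loc n F) q i, B.repr (f.evalAt q) i = (T f i).1 q := by
    intro f q i
    induction f using Loc.induction with
    | zero => simp
    | add f g hf hg =>
      rw [map_add, map_add, Finsupp.add_apply, hf, hg, map_add, Finsupp.add_apply]
      rfl
    | tmul a b =>
      rw [Loc.evalAt_tmul, map_smul, Finsupp.smul_apply]
      have : T (Loc.tmul a b) i = B.repr b i • a :=
        TensorProduct.equivFinsuppOfBasisRight_apply_tmul_apply B a b i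
      rw [this]
      exact mul_comm _ _
  refine (LinearEquiv.map_eq_zero_iff T).1 (Finsupp.ext fun i => Subtype.ext (funext fun q => ?_))
  rw [← key, h, map_zero]
  rfl

theorem HasParity.evalAt_mem_center {c : Loc n F} (hc : HasParity 0 c) (q : EvenVar n F → ℝ) :
    c.evalAt q ∈ Subalgebra.center ℝ (ExteriorAlgebra ℝ (OddVar n F →₀ ℝ)) := by
  rw [Subalgebra.mem_center_iff]
  intro b
  have h := congrArg (Loc.evalAt q) (hc.mul_comm (Loc.inclOdd b))
  have hb : (Loc.inclOdd b : Loc n F).evalAt q = b := by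
    rw [Loc.inclOdd_apply, Loc.evalAt_tmul]
    exact one_smul _ _
  rw [twist_zero_apply, map_mul, map_mul, hb] at h
  exact h.symm

end LocAlgebra

section Derivations

variable {n : ℕ} {F G : FieldContent.{u}}

/-! ### Homomorphisms and derivations are determined by the coordinates -/

/-- A derivation from one algebra of local functions to another, twisted by two homomorphisms, is
determined by its values on the coordinates. -/
theorem Loc.twisted_derivation_eq_zero (φ ψ : Loc n G →ₐ[ℝ] Loc n F) (D : Loc n G →ₗ[ℝ] Loc n F)
    (hD : ∀ f g, D (f * g) = D f * ψ g + φ f * D g)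
    (hx : ∀ m, HasParity 0 (φ (xcoord G m)))
    (hc : ∀ j, G.parity j.1 = 0 → HasParity 0 (φ (coord j)))
    (Dx : ∀ m, D (xcoord G m) = 0) (Dc : ∀ j, D (coord j) = 0) (f : Loc n G) : D f = 0 := by
  have hD1 : D 1 = 0 := by simpa using hD 1 1
  have hEven : ∀ a, D (Loc.inclEven a) = 0 := by
    intro a
    refine Loc.eq_zero_of_evalAt fun q => ?_
    refine SmoothFun.twisted_derivation_eq_zero
      ((Loc.evalAt q).comp (φ.comp Loc.inclEven)) ((Loc.evalAt q).comp (ψ.comp Loc.inclEven))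
      ((Loc.evalAt q).toLinearMap ∘ₗ D ∘ₗ Loc.inclEven.toLinearMap) ?_ ?_ ?_ a
    · intro f g
      simp [hD]
    · rintro (m | j)
      · exact (congrArg (Loc.evalAt q) (Dx m)).trans (map_zero _)
      · have := Dc j.1
        rw [coord_of_even j.2] at this
        exact (congrArg (Loc.evalAt q) this).trans (map_zero _)
    · have hpar : ∀ e, HasParity 0 (φ (Loc.inclEven (SmoothFun.var e))) := by
        rintro (m | j)
        · exact hx m
        · have := hc j.1 j.2
          rwa [coord_of_even j.2] at this
      intro e
      -- the real number is the value of the body at `q`, the nilpotent is the value of the soul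
      let c := φ (Loc.inclEven (SmoothFun.var e))
      have h0 : HasParity 0 (c - Loc.inclEven c.body) := by
        rw [sub_eq_add_neg, ← neg_one_smul ℝ]
        exact (hpar e).add ((parityHom_inclEven _).smul _)
      refine ⟨c.body.1 q, ⟨_, h0.evalAt_mem_center q⟩, ?_, ?_⟩
      · obtain ⟨N, hN⟩ := (hpar e).soul_nilpotent
        refine ⟨N, Subtype.ext ?_⟩
        have := congrArg (Loc.evalAt q) hN
        rwa [map_pow, map_zero] at this
      · change Loc.evalAt q c = _ + Loc.evalAt q (c - Loc.inclEven c.body)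
        rw [map_sub, Loc.inclEven_apply, Loc.evalAt_tmul, Algebra.algebraMap_eq_smul_one,
          add_sub_cancel]
  have hOdd : ∀ b, D (Loc.inclOdd b) = 0 := by
    intro b
    induction b using grassmann_induction with
    | algebraMap r => rw [AlgHom.commutes, Algebra.algebraMap_eq_smul_one, map_smul, hD1, smul_zero]
    | add x y hx hy => rw [map_add, map_add, hx, hy, add_zero]
    | ι_mul x m hxx =>
      rw [map_mul, hD, hxx, mul_zero, add_zero]
      have : D (Loc.inclOdd (ExteriorAlgebra.ι ℝ m)) = 0 := by
        induction m using Finsupp.induction_linear with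
        | zero => simp
        | add m m' h h' => rw [map_add, map_add, map_add, h, h', add_zero]
        | single j r =>
          rw [← mul_one r, ← smul_eq_mul, ← Finsupp.smul_single, map_smul, map_smul, map_smul,
            ← coord_of_odd j.2, Dc, smul_zero]
      rw [this, zero_mul]
  induction f using Loc.induction with
  | zero => exact map_zero D
  | add f g hf hg => rw [map_add, hf, hg, add_zero]
  | tmul a b => rw [Loc.tmul_eq, hD, hEven, hOdd, zero_mul, mul_zero, add_zero]

theorem Loc.hom_ext {φ ψ : Loc n G →ₐ[ℝ] Loc n F}
    (hx : ∀ m, HasParity 0 (φ (xcoord G m)))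
    (hc : ∀ j, G.parity j.1 = 0 → HasParity 0 (φ (coord j)))
    (h₁ : ∀ m, φ (xcoord G m) = ψ (xcoord G m)) (h₂ : ∀ j, φ (coord j) = ψ (coord j)) :
    φ = ψ := by
  refine AlgHom.ext fun f => sub_eq_zero.1 ?_
  refine Loc.twisted_derivation_eq_zero φ ψ (φ.toLinearMap - ψ.toLinearMap) ?_ hx hc
    (fun m => sub_eq_zero.2 (h₁ m)) (fun j => sub_eq_zero.2 (h₂ j)) f
  intro f g
  change φ (f * g) - ψ (f * g) = (φ f - ψ f) * ψ g + φ f * (φ g - ψ g)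
  rw [map_mul, map_mul, sub_mul, mul_sub]
  abel

/-- Homomorphisms of superalgebras of local functions over the functions of `x`. -/
structure IsSuperHom (φ : Loc n G →ₐ[ℝ] Loc n F) : Prop where
  map_x : ∀ m, φ (xcoord G m) = xcoord F m
  map_parity : ∀ f, φ (parityHom f) = parityHom (φ f)

theorem IsSuperHom.of_coord {φ : Loc n G →ₐ[ℝ] Loc n F} (hx : ∀ m, φ (xcoord G m) = xcoord F m)
    (hc : ∀ j, HasParity (G.parity j.1) (φ (coord j))) : IsSuperHom φ := by
  refine ⟨hx, fun f => ?_⟩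
  have : φ.comp parityHom = parityHom.comp φ := by
    have h1 : ∀ m, φ (parityHom (xcoord G m)) = xcoord F m := fun m => by
      rw [hasParity_xcoord, sgn_zero, one_smul, hx]
    have h2 : ∀ j, φ (parityHom (coord j)) = sgn (G.parity j.1) • φ (coord j) := fun j => by
      rw [hasParity_coord, map_smul]
    refine Loc.hom_ext (fun m => ?_) (fun j hj => ?_) (fun m => ?_) fun j => ?_
    · rw [AlgHom.comp_apply, h1]
      exact hasParity_xcoord m
    · rw [AlgHom.comp_apply, h2]
      exact (hj ▸ hc j).smul _
    · rw [AlgHom.comp_apply, AlgHom.comp_apply, h1, hx, hasParity_xcoord, sgn_zero, one_smul]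
    · rw [AlgHom.comp_apply, AlgHom.comp_apply, h2, hc]
  exact DFunLike.congr_fun this f

theorem IsSuperHom.hasParity {φ : Loc n G →ₐ[ℝ] Loc n F} (hφ : IsSuperHom φ) {p : ZMod 2}
    {f : Loc n G} (hf : HasParity p f) : HasParity p (φ f) := by
  rw [HasParity, ← hφ.map_parity, hf, map_smul]

theorem IsSuperHom.map_twist {φ : Loc n G →ₐ[ℝ] Loc n F} (hφ : IsSuperHom φ) (p : ZMod 2)
    (f : Loc n G) : φ (twist p f) = twist p (φ f) := by
  rcases zmod_two_cases p with rfl | rfl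
  · rw [twist_zero_apply, twist_zero_apply]
  · rw [twist_one_apply, twist_one_apply, hφ.map_parity]

theorem IsSuperHom.ext {φ ψ : Loc n G →ₐ[ℝ] Loc n F} (hφ : IsSuperHom φ) (hψ : IsSuperHom ψ)
    (h : ∀ j, φ (coord j) = ψ (coord j)) : φ = ψ :=
  Loc.hom_ext (fun m => hφ.hasParity (hasParity_xcoord m))
    (fun j hj => by simpa only [hj] using hφ.hasParity (hasParity_coord j))
    (fun m => by rw [hφ.map_x, hψ.map_x]) h

theorem IsSuperHom.id : IsSuperHom (AlgHom.id ℝ (Loc n F)) := ⟨fun _ => rfl, fun _ => rfl⟩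

theorem IsSuperHom.comp {H : FieldContent.{u}} {φ : Loc n G →ₐ[ℝ] Loc n F}
    {ψ : Loc n H →ₐ[ℝ] Loc n G} (hφ : IsSuperHom φ) (hψ : IsSuperHom ψ) :
    IsSuperHom (φ.comp ψ) :=
  ⟨fun m => by rw [AlgHom.comp_apply, hψ.map_x, hφ.map_x],
    fun f => by rw [AlgHom.comp_apply, hψ.map_parity, hφ.map_parity, AlgHom.comp_apply]⟩

/-- Arbitrary local functions of the right parity may be substituted for the jet coordinates. -/
theorem exists_subst (c : Jet n G → Loc n F) (hc : ∀ j, HasParity (G.parity j.1) (c j)) :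
    ∃ φ : Loc n G →ₐ[ℝ] Loc n F, IsSuperHom φ ∧ ∀ j, φ (coord j) = c j := by
  have hc0 : ∀ j : {j : Jet n G // G.parity j.1 = 0}, HasParity 0 (c j.1) := fun j => by
    have := hc j.1
    rwa [j.2] at this
  -- the images of the commuting coordinates lie in the centre `C`, a commutative algebra in which
  -- they are a body plus a nilpotent soul
  let C := Subalgebra.center ℝ (Loc n F)
  let b : EvenVar n G → SmoothFun (EvenVar n F) :=
    Sum.elim (fun m => SmoothFun.var (Sum.inl m)) fun j => (c j.1).body
  let β : SmoothFun (EvenVar n G) →ₐ[ℝ] C :=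
    (Loc.inclEven.codRestrict C fun a => (parityHom_inclEven a).mem_center).comp (SmoothFun.comp b)
  have hsoul : ∀ j : {j : Jet n G // G.parity j.1 = 0},
      c j.1 - Loc.inclEven (c j.1).body ∈ C := fun j =>
    sub_mem (hc0 j).mem_center (parityHom_inclEven _).mem_center
  let s : EvenVar n G → C := Sum.elim (fun _ => 0) fun j => ⟨_, hsoul j⟩
  have hs : ∀ e, IsNilpotent (s e) := by
    rintro (m | j)
    · exact IsNilpotent.zero
    · obtain ⟨N, hN⟩ := (hc0 j).soul_nilpotent
      exact ⟨N, Subtype.ext hN⟩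
  obtain ⟨Φ, hΦ⟩ := SmoothFun.exists_nilpotent_shift β s hs
  let L : (OddVar n G →₀ ℝ) →ₗ[ℝ] Loc n F := Finsupp.linearCombination ℝ fun j => c j.1
  have hL : ∀ m, L m * L m = 0 := fun m => by
    refine HasParity.mul_self (HasParity.sum fun j _ => HasParity.smul _ ?_)
    have := hc j.1
    rwa [(zmod_two_cases _).resolve_left j.2] at this
  let φ : Loc n G →ₐ[ℝ] Loc n F :=
    Algebra.TensorProduct.lift (C.val.comp Φ) (ExteriorAlgebra.lift ℝ ⟨L, hL⟩) fun a b =>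
      ((Subalgebra.mem_center_iff.1 (Φ a).2 _).symm :)
  have hφ : ∀ a b, φ (Loc.tmul a b) = (Φ a : Loc n F) * ExteriorAlgebra.lift ℝ ⟨L, hL⟩ b :=
    fun a b => Algebra.TensorProduct.lift_tmul _ _ _ a b
  have hφc : ∀ j, φ (coord j) = c j := by
    intro j
    by_cases hj : G.parity j.1 = 0
    · rw [coord_of_even hj, Loc.inclEven_apply, hφ, map_one, mul_one, hΦ]
      change Loc.inclEven (c j).body + (c j - Loc.inclEven (c j).body) = c j
      abel
    · rw [coord_of_odd hj, Loc.inclOdd_apply, hφ, map_one, ExteriorAlgebra.lift_ι_apply]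
      simp [L]
  refine ⟨φ, IsSuperHom.of_coord (fun m => ?_) fun j => ?_, hφc⟩
  · rw [xcoord, hφ, map_one, mul_one, hΦ]
    exact add_zero _
  · rw [hφc]
    exact hc j

/-! ### Graded derivations -/

/-- Derivations of parity `p`, acting from the left. -/
structure IsGDer (p : ZMod 2) (D : Module.End ℝ (Loc n F)) : Prop where
  leibniz : ∀ f g, D (f * g) = D f * g + twist p f * D g
  map_parity : ∀ f, D (parityHom f) = sgn p • parityHom (D f)

namespace IsGDer

variable {p q : ZMod 2} {D D' : Module.End ℝ (Loc n F)}

theorem hasParity (hD : IsGDer p D) {f : Loc n F} (hf : HasParity q f) :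
    HasParity (q + p) (D f) := by
  have h := hD.map_parity f
  rw [hf, map_smul] at h
  rw [HasParity, sgn_add, mul_comm, mul_smul, h, smul_smul, sgn_mul_self, one_smul]

theorem add (hD : IsGDer p D) (hD' : IsGDer p D') : IsGDer p (D + D') :=
  ⟨fun f g => by
    simp only [LinearMap.add_apply, hD.leibniz, hD'.leibniz, add_mul, mul_add]
    abel, fun f => by
    simp only [LinearMap.add_apply, hD.map_parity, hD'.map_parity, map_add, smul_add]⟩

theorem smul (r : ℝ) (hD : IsGDer p D) : IsGDer p (r • D) :=
  ⟨fun f g => by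
    simp only [LinearMap.smul_apply, hD.leibniz, smul_add, smul_mul_assoc, mul_smul_comm], fun f => by
    simp only [LinearMap.smul_apply, hD.map_parity, map_smul, smul_comm r]⟩

theorem sub (hD : IsGDer p D) (hD' : IsGDer p D') : IsGDer p (D - D') := by
  rw [sub_eq_add_neg, ← neg_one_smul ℝ D']
  exact hD.add (hD'.smul _)

theorem map_twist (hD : IsGDer p D) (q : ZMod 2) (f : Loc n F) :
    D (twist q f) = sgn (p * q) • twist q (D f) := by
  rcases zmod_two_cases q with rfl | rfl
  · rw [twist_zero_apply, twist_zero_apply, mul_zero, sgn_zero, one_smul]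
  · rw [twist_one_apply, twist_one_apply, mul_one, hD.map_parity]

/-- The graded commutator of graded derivations is a graded derivation. -/
theorem bracket (hD : IsGDer p D) (hD' : IsGDer q D') :
    IsGDer (p + q) (D * D' - sgn (p * q) • (D' * D)) := by
  have hs := sgn_mul_self (p * q)
  refine ⟨fun f g => ?_, fun f => ?_⟩
  · simp only [LinearMap.sub_apply, LinearMap.smul_apply, Module.End.mul_apply, hD.leibniz,
      hD'.leibniz, map_add, hD.map_twist, hD'.map_twist, smul_add, mul_sub, sub_mul,
      smul_mul_assoc, smul_smul, mul_comm q p, hs, one_smul, twist_twist, add_comm q p,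
      mul_smul_comm]
    abel
  · simp only [LinearMap.sub_apply, LinearMap.smul_apply, Module.End.mul_apply, hD.map_parity,
      hD'.map_parity, map_smul, map_sub, smul_sub, sgn_add, smul_smul]
    congr 2 <;> ring

/-- The failure of a homomorphism to intertwine two graded derivations is a twisted derivation. -/
theorem intertwine {p : ZMod 2} {φ : Loc n G →ₐ[ℝ] Loc n F} (hφ : IsSuperHom φ)
    {D : Module.End ℝ (Loc n G)} {D' : Module.End ℝ (Loc n F)} (hD : IsGDer p D)
    (hD' : IsGDer p D') (f g : Loc n G) :
    φ (D (f * g)) - D' (φ (f * g)) =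
      (φ (D f) - D' (φ f)) * φ g + φ (twist p f) * (φ (D g) - D' (φ g)) := by
  rw [hD.leibniz, map_mul, hD'.leibniz, map_add, map_mul, map_mul, hφ.map_twist, sub_mul, mul_sub]
  abel

/-- A homomorphism that intertwines two graded derivations on the coordinates does so
everywhere. -/
theorem intertwine_of_coord {φ : Loc n G →ₐ[ℝ] Loc n F} (hφ : IsSuperHom φ)
    {D : Module.End ℝ (Loc n G)} {D' : Module.End ℝ (Loc n F)} (hD : IsGDer p D)
    (hD' : IsGDer p D') (hx : ∀ m, φ (D (xcoord G m)) = D' (xcoord F m))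
    (hc : ∀ j, φ (D (coord j)) = D' (φ (coord j))) (f : Loc n G) : φ (D f) = D' (φ f) := by
  refine sub_eq_zero.1 (Loc.twisted_derivation_eq_zero (φ.comp (twist p)) φ
    (φ.toLinearMap ∘ₗ D - D' ∘ₗ φ.toLinearMap) (intertwine hφ hD hD') ?_ ?_ ?_ ?_ f)
  · intro m
    have h := hφ.hasParity (hasParity_xcoord (F := G) m)
    rw [AlgHom.comp_apply, hφ.map_twist]
    rcases zmod_two_cases p with rfl | rfl
    · rwa [twist_zero_apply]
    · rw [twist_one_apply, h]
      exact h.smul _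
  · intro j hj
    have h := hφ.hasParity (hj ▸ hasParity_coord j)
    rw [AlgHom.comp_apply, hφ.map_twist]
    rcases zmod_two_cases p with rfl | rfl
    · rwa [twist_zero_apply]
    · rw [twist_one_apply, h]
      exact h.smul _
  · intro m
    refine sub_eq_zero.2 ((hx m).trans ?_)
    rw [← hφ.map_x m]
    rfl
  · exact fun j => sub_eq_zero.2 (hc j)

theorem ext (hD : IsGDer p D) (hD' : IsGDer p D') (hx : ∀ m, D (xcoord F m) = D' (xcoord F m))
    (hc : ∀ j, D (coord j) = D' (coord j)) : D = D' :=
  LinearMap.ext fun f =>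
    intertwine_of_coord (φ := AlgHom.id ℝ _) IsSuperHom.id hD hD' hx hc f

theorem zero : IsGDer p (0 : Module.End ℝ (Loc n F)) :=
  ⟨fun f g => by simp, fun f => by simp⟩

theorem commute_of_coord (hD : IsGDer 0 D) (hD' : IsGDer q D')
    (hx : ∀ m, D (D' (xcoord F m)) = D' (D (xcoord F m)))
    (hc : ∀ j, D (D' (coord j)) = D' (D (coord j))) : Commute D D' := by
  have h := hD.bracket hD'
  rw [zero_mul, sgn_zero, one_smul] at h
  refine sub_eq_zero.1 (h.ext zero (fun m => sub_eq_zero.2 (hx m)) fun j => sub_eq_zero.2 (hc j))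

theorem anticommutator (hD : IsGDer 1 D) (hD' : IsGDer 1 D') : IsGDer 0 (D * D' + D' * D) := by
  have h := hD.bracket hD'
  have h1 : (-1 : ℝ) • (D' * D) = -(D' * D) := LinearMap.ext fun f => neg_one_smul ℝ _
  rwa [mul_one, sgn_one, h1, sub_neg_eq_add] at h

end IsGDer

/-! ### Partial derivatives and vector fields -/

theorem isGDer_dx (m : Fin n) : IsGDer 0 (dx m : Module.End ℝ (Loc n F)) := by
  have hd : ∀ a b, dx m (Loc.tmul a b : Loc n F) = Loc.tmul (SmoothFun.pderiv (Sum.inl m) a) b :=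
    fun a b => Loc.map_tmul _ _ a b
  refine ⟨fun f g => ?_, fun f => ?_⟩
  · rw [twist_zero_apply]
    induction f using Loc.induction with
    | zero => simp
    | add f f' hf hf' =>
      rw [add_mul, map_add, hf, hf', map_add, add_mul, add_mul]
      abel
    | tmul a b =>
      induction g using Loc.induction with
      | zero => simp
      | add g g' hg hg' =>
        rw [mul_add, map_add, hg, hg', map_add, mul_add, mul_add]
        abel
      | tmul a' b' =>
        rw [Loc.tmul_mul, hd, hd, hd, Loc.tmul_mul, Loc.tmul_mul, ← Loc.add_tmul,
          SmoothFun.pderiv_mul]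
  · rw [sgn_zero, one_smul]
    induction f using Loc.induction with
    | zero => simp
    | add f f' hf hf' => rw [map_add, map_add, hf, hf', map_add, map_add]
    | tmul a b => rw [parityHom_tmul, hd, hd, parityHom_tmul]

theorem isGDer_pd (j : Jet n F) : IsGDer (F.parity j.1) (pd j) := by
  by_cases hj : F.parity j.1 = 0
  · have hd : ∀ a b, pd j (Loc.tmul a b : Loc n F) =
        Loc.tmul (SmoothFun.pderiv (Sum.inr ⟨j, hj⟩) a) b := fun a b => by
      rw [pd, dif_pos hj]
      exact Loc.map_tmul _ _ a b
    rw [hj]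
    refine ⟨fun f g => ?_, fun f => ?_⟩
    · rw [twist_zero_apply]
      induction f using Loc.induction with
      | zero => simp
      | add f f' hf hf' =>
        rw [add_mul, map_add, hf, hf', map_add, add_mul, add_mul]
        abel
      | tmul a b =>
        induction g using Loc.induction with
        | zero => simp
        | add g g' hg hg' =>
          rw [mul_add, map_add, hg, hg', map_add, mul_add, mul_add]
          abel
        | tmul a' b' =>
          rw [Loc.tmul_mul, hd, hd, hd, Loc.tmul_mul, Loc.tmul_mul, ← Loc.add_tmul,
            SmoothFun.pderiv_mul]
    · rw [sgn_zero, one_smul]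
      induction f using Loc.induction with
      | zero => simp
      | add f f' hf hf' => rw [map_add, map_add, hf, hf', map_add, map_add]
      | tmul a b => rw [parityHom_tmul, hd, hd, parityHom_tmul]
  · have hd : ∀ a b, pd j (Loc.tmul a b : Loc n F) =
        Loc.tmul a (CliffordAlgebra.contractLeft
          (Q := (0 : QuadraticForm ℝ (OddVar n F →₀ ℝ))) (Finsupp.lapply ⟨j, hj⟩) b) :=
      fun a b => by
        rw [pd, dif_neg hj]
        exact Loc.map_tmul _ _ a b
    rw [(zmod_two_cases _).resolve_left hj]
    refine ⟨fun f g => ?_, fun f => ?_⟩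
    · rw [twist_one_apply]
      induction f using Loc.induction with
      | zero => simp
      | add f f' hf hf' =>
        rw [add_mul, map_add, hf, hf', map_add, map_add, add_mul, add_mul]
        abel
      | tmul a b =>
        induction g using Loc.induction with
        | zero => simp
        | add g g' hg hg' =>
          rw [mul_add, map_add, hg, hg', map_add, mul_add, mul_add]
          abel
        | tmul a' b' =>
          rw [Loc.tmul_mul, hd, hd, hd, parityHom_tmul, Loc.tmul_mul, Loc.tmul_mul,
            ← Loc.tmul_add, contractLeft_grassmann_mul]
    · rw [sgn_one, neg_one_smul]
      induction f using Loc.induction with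
      | zero => simp
      | add f f' hf hf' => rw [map_add, map_add, hf, hf', map_add, map_add, neg_add]
      | tmul a b => rw [parityHom_tmul, hd, hd, parityHom_tmul, grInv_contractLeft, Loc.tmul_neg]

theorem dx_xcoord_self (m : Fin n) : dx m (xcoord F m) = 1 := by
  refine (Loc.map_tmul _ _ _ _).trans ?_
  rw [SmoothFun.pderiv_var_self]
  rfl

theorem dx_xcoord_of_ne {m m' : Fin n} (h : m ≠ m') : dx m (xcoord F m') = 0 := by
  refine (Loc.map_tmul _ _ _ _).trans ?_
  rw [SmoothFun.pderiv_var_of_ne (by simpa using h), Loc.zero_tmul]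

theorem dx_coord (m : Fin n) (j : Jet n F) : dx m (coord j) = 0 := by
  by_cases hj : F.parity j.1 = 0
  · rw [coord_of_even hj, Loc.inclEven_apply]
    refine (Loc.map_tmul _ _ _ _).trans ?_
    rw [SmoothFun.pderiv_var_of_ne (by simp), Loc.zero_tmul]
  · rw [coord_of_odd hj, Loc.inclOdd_apply]
    refine (Loc.map_tmul _ _ _ _).trans ?_
    rw [SmoothFun.pderiv_one, Loc.zero_tmul]

theorem contractLeft_one_grassmann {V : Type u} [AddCommGroup V] [Module ℝ V]
    (d : Module.Dual ℝ V) : CliffordAlgebra.contractLeft (Q := (0 : QuadraticForm ℝ V)) d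
      (1 : ExteriorAlgebra ℝ V) = 0 :=
  CliffordAlgebra.contractLeft_one _ d

theorem pd_xcoord (j : Jet n F) (m : Fin n) : pd j (xcoord F m) = 0 := by
  by_cases hj : F.parity j.1 = 0
  · rw [pd, dif_pos hj]
    refine (Loc.map_tmul _ _ _ _).trans ?_
    rw [SmoothFun.pderiv_var_of_ne (by simp), Loc.zero_tmul]
  · rw [pd, dif_neg hj]
    refine (Loc.map_tmul _ _ _ _).trans ?_
    rw [contractLeft_one_grassmann, Loc.tmul_zero]

theorem pd_coord_self (j : Jet n F) : pd j (coord j) = 1 := by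
  by_cases hj : F.parity j.1 = 0
  · rw [coord_of_even hj, Loc.inclEven_apply, pd, dif_pos hj]
    refine (Loc.map_tmul _ _ _ _).trans ?_
    rw [SmoothFun.pderiv_var_self]
    rfl
  · rw [coord_of_odd hj, Loc.inclOdd_apply, pd, dif_neg hj]
    refine (Loc.map_tmul _ _ _ _).trans ?_
    have : CliffordAlgebra.contractLeft (Q := (0 : QuadraticForm ℝ (OddVar n F →₀ ℝ)))
        (Finsupp.lapply ⟨j, hj⟩) (ExteriorAlgebra.ι ℝ (Finsupp.single (⟨j, hj⟩ : OddVar n F) 1)) =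
        1 := by
      refine (CliffordAlgebra.contractLeft_ι _ _ _).trans ?_
      simp
    rw [this]
    rfl

theorem pd_coord_of_ne {j j' : Jet n F} (h : j ≠ j') : pd j (coord j') = 0 := by
  by_cases hj : F.parity j.1 = 0
  · rw [pd, dif_pos hj]
    by_cases hj' : F.parity j'.1 = 0
    · rw [coord_of_even hj', Loc.inclEven_apply]
      refine (Loc.map_tmul _ _ _ _).trans ?_
      rw [SmoothFun.pderiv_var_of_ne (by simpa using h), Loc.zero_tmul]
    · rw [coord_of_odd hj', Loc.inclOdd_apply]
      refine (Loc.map_tmul _ _ _ _).trans ?_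
      rw [SmoothFun.pderiv_one, Loc.zero_tmul]
  · rw [pd, dif_neg hj]
    by_cases hj' : F.parity j'.1 = 0
    · rw [coord_of_even hj', Loc.inclEven_apply]
      refine (Loc.map_tmul _ _ _ _).trans ?_
      rw [contractLeft_one_grassmann, Loc.tmul_zero]
    · rw [coord_of_odd hj', Loc.inclOdd_apply]
      refine (Loc.map_tmul _ _ _ _).trans ?_
      have : CliffordAlgebra.contractLeft (Q := (0 : QuadraticForm ℝ (OddVar n F →₀ ℝ)))
          (Finsupp.lapply ⟨j, hj⟩)
          (ExteriorAlgebra.ι ℝ (Finsupp.single (⟨j', hj'⟩ : OddVar n F) 1)) = 0 := by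
        refine (CliffordAlgebra.contractLeft_ι _ _ _).trans ?_
        rw [Finsupp.lapply_apply, Finsupp.single_eq_of_ne (by simpa using h), map_zero]
      rw [this, Loc.tmul_zero]

theorem vectorField_apply (c : Jet n F → Loc n F) (f : Loc n F) :
    vectorField c f = ∑ᶠ j, c j * pd j f := rfl

theorem vectorField_coord (c : Jet n F → Loc n F) (j : Jet n F) :
    vectorField c (coord j) = c j := by
  rw [vectorField_apply, finsum_eq_single _ j fun j' hj' => by
    rw [pd_coord_of_ne hj', mul_zero], pd_coord_self, mul_one]

theorem vectorField_xcoord (c : Jet n F → Loc n F) (m : Fin n) :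
    vectorField c (xcoord F m) = 0 := by
  rw [vectorField_apply]
  simp [pd_xcoord]

theorem isGDer_vectorField {p : ZMod 2} {c : Jet n F → Loc n F}
    (hc : ∀ j, HasParity (F.parity j.1 + p) (c j)) : IsGDer p (vectorField c) := by
  classical
  have h2 : ∀ q : ZMod 2, q + q = 0 := by decide
  -- the sum over the coordinates may be restricted to any finite set that contains all the
  -- coordinates on which the function depends
  have key : ∀ (f : Loc n F) (s : Finset (Jet n F)), {j | pd j f ≠ 0} ⊆ s →
      vectorField c f = ∑ j ∈ s, c j * pd j f := fun f s hs =>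
    finsum_eq_sum_of_support_subset _ fun j hj => hs fun h => hj (by simp [h])
  have hfin := fun f : Loc n F => finite_pd f
  refine ⟨fun f g => ?_, fun f => ?_⟩
  · let s := (hfin f).toFinset ∪ (hfin g).toFinset ∪ (hfin (f * g)).toFinset
    rw [key f s fun j hj => by simp_all [s], key g s fun j hj => by simp_all [s],
      key (f * g) s fun j hj => by simp_all [s], Finset.sum_mul, Finset.mul_sum,
      ← Finset.sum_add_distrib]
    refine Finset.sum_congr rfl fun j _ => ?_
    rw [(isGDer_pd j).leibniz, mul_add, mul_assoc, ← mul_assoc (c j) (twist _ f),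
      (hc j).mul_comm (twist _ f),
      twist_twist, add_right_comm, h2, zero_add, mul_assoc]
  · let s := (hfin f).toFinset ∪ (hfin (parityHom f)).toFinset
    rw [key f s fun j hj => by simp_all [s], key (parityHom f) s fun j hj => by simp_all [s],
      map_sum, Finset.smul_sum]
    refine Finset.sum_congr rfl fun j _ => ?_
    rw [(isGDer_pd j).map_parity, map_mul, hc, mul_smul_comm, smul_mul_assoc, smul_smul, sgn_add,
      mul_left_comm, sgn_mul_self, mul_one]

theorem isGDer_totalD (m : Fin n) : IsGDer 0 (totalD m : Module.End ℝ (Loc n F)) := by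
  refine (isGDer_dx m).add (isGDer_vectorField fun j => ?_)
  rw [add_zero]
  exact hasParity_coord (F := F) (j.1, _)

theorem totalD_coord (m : Fin n) (j : Jet n F) :
    totalD m (coord j) = coord (j.1, j.2 + MultiIdx.one m) := by
  rw [totalD, LinearMap.add_apply, dx_coord, zero_add, vectorField_coord]

theorem totalD_xcoord (m m' : Fin n) : totalD m (xcoord F m') = dx m (xcoord F m') := by
  rw [totalD, LinearMap.add_apply, vectorField_xcoord, add_zero]

theorem dx_xcoord (m m' : Fin n) :
    dx m (xcoord F m') = algebraMap ℝ _ (if m = m' then 1 else 0) := by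
  split_ifs with h
  · rw [h, dx_xcoord_self, map_one]
  · rw [dx_xcoord_of_ne h, map_zero]

theorem IsGDer.map_algebraMap {p : ZMod 2} {D : Module.End ℝ (Loc n F)} (hD : IsGDer p D) (r : ℝ) :
    D (algebraMap ℝ _ r) = 0 := by
  have h : D 1 = 0 := by simpa using hD.leibniz 1 1
  rw [Algebra.algebraMap_eq_smul_one, map_smul, h, smul_zero]

/-- Derivations that take the `x^μ` to constants commute as soon as they do on the jet
coordinates. -/
theorem IsGDer.commute_of_coord' {q : ZMod 2} {D D' : Module.End ℝ (Loc n F)} (hD : IsGDer 0 D)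
    (hD' : IsGDer q D') (hx : ∀ m, ∃ r, D (xcoord F m) = algebraMap ℝ _ r)
    (hx' : ∀ m, ∃ r, D' (xcoord F m) = algebraMap ℝ _ r)
    (hc : ∀ j, D (D' (coord j)) = D' (D (coord j))) : Commute D D' := by
  refine hD.commute_of_coord hD' (fun m => ?_) hc
  obtain ⟨r, hr⟩ := hx m
  obtain ⟨r', hr'⟩ := hx' m
  rw [hr, hr', hD.map_algebraMap, hD'.map_algebraMap]

end Derivations

/-! ### Iterated operators -/

section Iter

variable {n : ℕ}

@[elab_as_elim]
theorem MultiIdx.induction {P : MultiIdx n → Prop} (l : MultiIdx n) (zero : P 0)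
    (add_one : ∀ l i, P l → P (l + MultiIdx.one i)) : P l := by
  have key : ∀ l l₀ : MultiIdx n, P l₀ → P (l₀ + l) := by
    intro l
    induction l using Finsupp.induction_linear with
    | zero => simp
    | add l l' h h' =>
      intro l₀ h₀
      rw [← add_assoc]
      exact h' _ (h _ h₀)
    | single i k =>
      intro l₀ h₀
      induction k with
      | zero => simpa using h₀
      | succ k ih =>
        rw [Finsupp.single_add, ← add_assoc]
        exact add_one _ _ ih
  simpa using key l 0 zero

variable {M M' : Type u} [AddCommGroup M] [Module ℝ M] [AddCommGroup M'] [Module ℝ M']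

theorem iter_zero (D : Fin n → Module.End ℝ M) : iter D 0 = 1 := by
  simp [iter]

theorem map_iter (T : M →ₗ[ℝ] M') {D : Fin n → Module.End ℝ M} {D' : Fin n → Module.End ℝ M'}
    (h : ∀ i f, T (D i f) = D' i (T f)) (l : MultiIdx n) (f : M) :
    T (iter D l f) = iter D' l (T f) := by
  have hpow : ∀ (i : Fin n) (k : ℕ) f, T ((D i ^ k) f) = (D' i ^ k) (T f) := fun i k => by
    induction k with
    | zero =>
      intro f
      rfl
    | succ k ih =>
      intro f
      rw [pow_succ, pow_succ, Module.End.mul_apply, Module.End.mul_apply, ih, h]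
  unfold iter
  induction List.finRange n with
  | nil => rfl
  | cons i L ih =>
    rw [List.map_cons, List.prod_cons, List.map_cons, List.prod_cons, Module.End.mul_apply,
      Module.End.mul_apply, hpow, ih]

theorem iter_add_one {D : Fin n → Module.End ℝ M} (hD : ∀ i j, Commute (D i) (D j))
    (l : MultiIdx n) (i : Fin n) : iter D (l + MultiIdx.one i) = D i * iter D l := by
  have key : ∀ L : List (Fin n), L.Nodup →
      (L.map fun j => D j ^ (l + MultiIdx.one i) j).prod =
        if i ∈ L then D i * (L.map fun j => D j ^ l j).prod
        else (L.map fun j => D j ^ l j).prod := by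
    intro L
    induction L with
    | nil => simp
    | cons j L ih =>
      intro hL
      rw [List.nodup_cons] at hL
      rw [List.map_cons, List.prod_cons, List.map_cons, List.prod_cons, ih hL.2]
      by_cases hij : j = i
      · subst hij
        rw [if_neg hL.1, if_pos (by simp), Finsupp.add_apply, Finsupp.single_eq_same, pow_succ',
          mul_assoc]
      · rw [Finsupp.add_apply, Finsupp.single_eq_of_ne hij, add_zero]
        by_cases hi : i ∈ L
        · rw [if_pos hi, if_pos (by simp [hi]), ← mul_assoc, ← mul_assoc,
            ((hD j i).pow_left _).eq]
        · rw [if_neg hi, if_neg (by simp [hi, Ne.symm hij])]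
  have h := key _ (List.nodup_finRange n)
  rwa [if_pos (List.mem_finRange i)] at h

end Iter

/-! ### Prolonged vector fields and renaming of fields -/

section JetOperators

variable {n : ℕ} {F G : FieldContent.{u}}

theorem dx_comm (i j : Fin n) : Commute (dx i : Module.End ℝ (Loc n F)) (dx j) :=
  (isGDer_dx i).commute_of_coord' (isGDer_dx j) (fun m => ⟨_, dx_xcoord i m⟩)
    (fun m => ⟨_, dx_xcoord j m⟩) fun j => by simp [dx_coord]

theorem totalD_comm (i j : Fin n) : Commute (totalD i : Module.End ℝ (Loc n F)) (totalD j) :=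
  (isGDer_totalD i).commute_of_coord' (isGDer_totalD j)
    (fun m => ⟨_, (totalD_xcoord i m).trans (dx_xcoord i m)⟩)
    (fun m => ⟨_, (totalD_xcoord j m).trans (dx_xcoord j m)⟩) fun k => by
      simp only [totalD_coord, add_right_comm]

theorem iter_totalD_coord (A : F.Idx) (m m' : MultiIdx n) :
    iter totalD m' (coord (A, m)) = (coord (A, m + m') : Loc n F) := by
  induction m' using MultiIdx.induction with
  | zero => rw [iter_zero, add_zero, Module.End.one_apply]
  | add_one l i h =>
    rw [iter_add_one totalD_comm, Module.End.mul_apply, h, totalD_coord, add_assoc]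

theorem IsGDer.hasParity_iter {D : Fin n → Module.End ℝ (Loc n F)} (hD : ∀ i, IsGDer 0 (D i))
    {p : ZMod 2} {f : Loc n F} (hf : HasParity p f) (l : MultiIdx n) :
    HasParity p (iter D l f) := by
  have h := map_iter (parityHom (n := n) (F := F)).toLinearMap (D := D) (D' := D)
    (fun i f => by
      have := (hD i).map_parity f
      rw [sgn_zero, one_smul] at this
      exact this.symm) l f
  rw [HasParity]
  refine h.trans ?_
  change iter D l (parityHom f) = _
  rw [hf, map_smul]

theorem evol_coord (S : F.Idx → Loc n F) (A : F.Idx) (m : MultiIdx n) :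
    evol S (coord (A, m)) = iter totalD m (S A) := vectorField_coord _ _

theorem evol_xcoord (S : F.Idx → Loc n F) (m : Fin n) : evol S (xcoord F m) = 0 :=
  vectorField_xcoord _ _

theorem isGDer_evol {S : F.Idx → Loc n F} (hS : ∀ A, HasParity (F.parity A + 1) (S A)) :
    IsGDer 1 (evol S) :=
  isGDer_vectorField fun j => IsGDer.hasParity_iter isGDer_totalD (hS j.1) j.2

theorem totalD_comm_evol {S : F.Idx → Loc n F} (hS : ∀ A, HasParity (F.parity A + 1) (S A))
    (i : Fin n) : Commute (totalD i) (evol S) :=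
  (isGDer_totalD i).commute_of_coord' (isGDer_evol hS)
    (fun m => ⟨_, (totalD_xcoord i m).trans (dx_xcoord i m)⟩)
    (fun m => ⟨0, (evol_xcoord S m).trans (map_zero _).symm⟩) fun k => by
      rw [totalD_coord, evol_coord S k.1 k.2, evol_coord, iter_add_one totalD_comm,
        Module.End.mul_apply]

theorem ghostOp_coord (j : Jet n F) : ghostOp (coord j) = (F.gh j.1 : ℝ) • coord j :=
  vectorField_coord _ _

theorem ghostOp_xcoord (m : Fin n) : ghostOp (xcoord F m) = 0 := vectorField_xcoord _ _

theorem isGDer_ghostOp : IsGDer 0 (ghostOp : Module.End ℝ (Loc n F)) :=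
  isGDer_vectorField fun j => by
    rw [add_zero]
    exact (hasParity_coord j).smul _

theorem IsSuperHom.map_totalD_of_coord {φ : Loc n G →ₐ[ℝ] Loc n F} (hφ : IsSuperHom φ)
    (i : Fin n) (h : ∀ A m, φ (coord (A, m + MultiIdx.one i)) = totalD i (φ (coord (A, m))))
    (f : Loc n G) : φ (totalD i f) = totalD i (φ f) := by
  refine IsGDer.intertwine_of_coord hφ (isGDer_totalD i) (isGDer_totalD i) (fun m => ?_)
    (fun j => ?_) f
  · rw [totalD_xcoord, totalD_xcoord, dx_xcoord, dx_xcoord, AlgHom.commutes]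
  · rw [totalD_coord, h]

/-- A map of the sets of fields induces a homomorphism of the algebras of local functions. -/
theorem exists_relabel (σ : G.Idx → F.Idx) (hp : ∀ A, F.parity (σ A) = G.parity A)
    (hg : ∀ A, F.gh (σ A) = G.gh A) :
    ∃ φ : Loc n G →ₐ[ℝ] Loc n F, IsSuperHom φ ∧ (∀ A m, φ (coord (A, m)) = coord (σ A, m)) ∧
      (∀ i f, φ (totalD i f) = totalD i (φ f)) ∧ ∀ f, φ (ghostOp f) = ghostOp (φ f) := by
  obtain ⟨φ, hφ, h⟩ := exists_subst (n := n) (G := G) (F := F) (fun j => coord (σ j.1, j.2))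
    (fun j => hp j.1 ▸ hasParity_coord (F := F) (σ j.1, j.2))
  refine ⟨φ, hφ, fun A m => h (A, m), fun i => hφ.map_totalD_of_coord i fun A m => ?_,
    IsGDer.intertwine_of_coord hφ isGDer_ghostOp isGDer_ghostOp (fun m => ?_) fun j => ?_⟩
  · rw [h, h, totalD_coord]
  · rw [ghostOp_xcoord, ghostOp_xcoord, map_zero]
  · rw [ghostOp_coord, map_smul, h, ghostOp_coord, hg]

theorem rename_coord {r : Jet n F → Jet n G} (hr : ∀ j, G.parity (r j).1 = F.parity j.1)
    (j : Jet n F) : rename r hr (coord j) = coord (r j) := by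
  by_cases hj : F.parity j.1 = 0
  · rw [coord_of_even hj, coord_of_even ((hr j).trans hj), Loc.inclEven_apply, Loc.inclEven_apply]
    refine (Algebra.TensorProduct.map_tmul _ _ _ _).trans ?_
    rw [map_one]
    rfl
  · rw [coord_of_odd hj, coord_of_odd fun h => hj ((hr j).symm.trans h), Loc.inclOdd_apply,
      Loc.inclOdd_apply]
    refine (Algebra.TensorProduct.map_tmul _ _ _ _).trans ?_
    rw [map_one, ExteriorAlgebra.map_apply_ι, Finsupp.lmapDomain_apply, Finsupp.mapDomain_single]
    rfl

theorem rename_xcoord {r : Jet n F → Jet n G} (hr : ∀ j, G.parity (r j).1 = F.parity j.1)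
    (m : Fin n) : rename r hr (xcoord F m) = xcoord G m := by
  refine (Algebra.TensorProduct.map_tmul _ _ _ _).trans ?_
  rw [map_one]
  rfl

theorem isSuperHom_rename {r : Jet n F → Jet n G} (hr : ∀ j, G.parity (r j).1 = F.parity j.1) :
    IsSuperHom (rename r hr) :=
  IsSuperHom.of_coord (rename_xcoord hr) fun j => by
    rw [rename_coord, ← hr]
    exact hasParity_coord _

end JetOperators

/-! ### The vector fields of the parent theory -/

section ParentOperators

variable {n : ℕ} {F G : FieldContent.{u}}

theorem hasParity_pcoord (A : F.Idx) (m l : MultiIdx n) (I : Finset (Fin n)) :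
    HasParity (F.parity A + (I.card : ZMod 2)) (pcoord A m l I) :=
  hasParity_coord (F := parent n F) ((A, l, I), m)

/-- The vector field that shifts the two symmetric multi-indices. -/
def shiftF (a b : MultiIdx n) : Module.End ℝ (Loc n (parent n F)) :=
  vectorField fun j => pcoord j.1.1 (j.2 + a) (j.1.2.1 + b) j.1.2.2

/-- The common form of `d^F` and `σ^F`: an index `i` is moved from the skew-symmetric multi-index
to the symmetric ones, where it acts by the shifts `a i`, `b i`. -/
def koszulF (a b : Fin n → MultiIdx n) : Module.End ℝ (Loc n (parent n F)) :=
  vectorField fun j => ∑ i ∈ j.1.2.2, (sgn (F.parity j.1.1) * insSign i j.1.2.2) •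
    pcoord j.1.1 (j.2 + a i) (j.1.2.1 + b i) (j.1.2.2.erase i)

theorem dF_eq : (dF : Module.End ℝ (Loc n (parent n F))) = koszulF MultiIdx.one 0 := by
  simp [dF, koszulF]

theorem sigmaF_eq : (sigmaF : Module.End ℝ (Loc n (parent n F))) = koszulF 0 MultiIdx.one := by
  simp [sigmaF, koszulF]

theorem totalD_eq (i : Fin n) :
    (totalD i : Module.End ℝ (Loc n (parent n F))) = dx i + shiftF (MultiIdx.one i) 0 := by
  simp [totalD, shiftF, pcoord]
  rfl

theorem dyF_eq (i : Fin n) :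
    (dyF i : Module.End ℝ (Loc n (parent n F))) = shiftF 0 (MultiIdx.one i) := by
  simp [dyF, shiftF]

theorem totalY_eq (i : Fin n) :
    (totalY i : Module.End ℝ (Loc n (parent n F))) = dx i + shiftF 0 (MultiIdx.one i) := by
  rw [totalY, dyF_eq]

theorem shiftF_pcoord (a b : MultiIdx n) (A : F.Idx) (m l : MultiIdx n) (I : Finset (Fin n)) :
    shiftF a b (pcoord A m l I) = pcoord A (m + a) (l + b) I := vectorField_coord _ _

theorem koszulF_pcoord (a b : Fin n → MultiIdx n) (A : F.Idx) (m l : MultiIdx n)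
    (I : Finset (Fin n)) : koszulF a b (pcoord A m l I) =
      ∑ i ∈ I, (sgn (F.parity A) * insSign i I) • pcoord A (m + a i) (l + b i) (I.erase i) :=
  vectorField_coord _ _

theorem dthetaF_pcoord (i : Fin n) (A : F.Idx) (m l : MultiIdx n) (I : Finset (Fin n)) :
    dthetaF i (pcoord A m l I) = if i ∈ I then 0
      else (sgn (F.parity A) * insSign i I) • pcoord A m l (insert i I) :=
  vectorField_coord _ _

theorem isGDer_shiftF (a b : MultiIdx n) :
    IsGDer 0 (shiftF a b : Module.End ℝ (Loc n (parent n F))) :=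
  isGDer_vectorField fun j => by
    rw [add_zero]
    exact hasParity_pcoord _ _ _ _

theorem isGDer_koszulF (a b : Fin n → MultiIdx n) :
    IsGDer 1 (koszulF a b : Module.End ℝ (Loc n (parent n F))) :=
  isGDer_vectorField fun j => HasParity.sum fun i hi => by
    refine HasParity.smul _ ?_
    have h := hasParity_pcoord j.1.1 (j.2 + a i) (j.1.2.1 + b i) (j.1.2.2.erase i)
    have h2 : (j.1.2.2.card : ZMod 2) + 1 = ((j.1.2.2.erase i).card : ZMod 2) := by
      rw [← Finset.card_erase_add_one hi]
      push_cast
      rw [add_assoc]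
      exact add_zero _
    rwa [← h2, ← add_assoc] at h

theorem isGDer_dthetaF (i : Fin n) : IsGDer 1 (dthetaF i : Module.End ℝ (Loc n (parent n F))) :=
  isGDer_vectorField fun j => by
    split_ifs with hi
    · exact HasParity.zero _
    · refine HasParity.smul _ ?_
      have h := hasParity_pcoord j.1.1 j.2 j.1.2.1 (insert i j.1.2.2)
      rw [Finset.card_insert_of_notMem hi] at h
      push_cast at h
      rwa [← add_assoc] at h

theorem isGDer_totalY (i : Fin n) : IsGDer 0 (totalY i : Module.End ℝ (Loc n (parent n F))) := by
  rw [totalY_eq]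
  exact (isGDer_dx i).add (isGDer_shiftF _ _)

theorem shiftF_xcoord (a b : MultiIdx n) (m : Fin n) : shiftF a b (xcoord (parent n F) m) = 0 :=
  vectorField_xcoord _ _

theorem koszulF_xcoord (a b : Fin n → MultiIdx n) (m : Fin n) :
    koszulF a b (xcoord (parent n F) m) = 0 := vectorField_xcoord _ _

theorem dthetaF_xcoord (i m : Fin n) : dthetaF i (xcoord (parent n F) m) = 0 :=
  vectorField_xcoord _ _

theorem totalY_xcoord (i m : Fin n) :
    totalY i (xcoord (parent n F) m) = algebraMap ℝ _ (if i = m then 1 else 0) := by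
  rw [totalY_eq, LinearMap.add_apply, shiftF_xcoord, add_zero, dx_xcoord]

theorem dx_pcoord (i : Fin n) (A : F.Idx) (m l : MultiIdx n) (I : Finset (Fin n)) :
    dx i (pcoord A m l I) = 0 := dx_coord _ _

theorem dx_comm_shiftF (i : Fin n) (a b : MultiIdx n) :
    Commute (dx i) (shiftF a b : Module.End ℝ (Loc n (parent n F))) :=
  (isGDer_dx i).commute_of_coord' (isGDer_shiftF a b) (fun m => ⟨_, dx_xcoord i m⟩)
    (fun m => ⟨0, (shiftF_xcoord a b m).trans (map_zero _).symm⟩) fun ⟨⟨A, l, I⟩, m⟩ => by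
      change dx i (shiftF a b (pcoord A m l I)) = shiftF a b (dx i (pcoord A m l I))
      rw [shiftF_pcoord, dx_pcoord, dx_pcoord, map_zero]

theorem dx_comm_koszulF (i : Fin n) (a b : Fin n → MultiIdx n) :
    Commute (dx i) (koszulF a b : Module.End ℝ (Loc n (parent n F))) :=
  (isGDer_dx i).commute_of_coord' (isGDer_koszulF a b) (fun m => ⟨_, dx_xcoord i m⟩)
    (fun m => ⟨0, (koszulF_xcoord a b m).trans (map_zero _).symm⟩) fun ⟨⟨A, l, I⟩, m⟩ => by
      change dx i (koszulF a b (pcoord A m l I)) = koszulF a b (dx i (pcoord A m l I))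
      rw [koszulF_pcoord, dx_pcoord, map_zero, map_sum]
      exact Finset.sum_eq_zero fun k _ => by rw [map_smul, dx_pcoord, smul_zero]

theorem dx_comm_dthetaF (i k : Fin n) :
    Commute (dx i) (dthetaF k : Module.End ℝ (Loc n (parent n F))) :=
  (isGDer_dx i).commute_of_coord' (isGDer_dthetaF k) (fun m => ⟨_, dx_xcoord i m⟩)
    (fun m => ⟨0, (dthetaF_xcoord k m).trans (map_zero _).symm⟩) fun ⟨⟨A, l, I⟩, m⟩ => by
      change dx i (dthetaF k (pcoord A m l I)) = dthetaF k (dx i (pcoord A m l I))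
      rw [dthetaF_pcoord, dx_pcoord, map_zero]
      split_ifs
      · exact map_zero _
      · rw [map_smul, dx_pcoord, smul_zero]

theorem shiftF_comm (a b a' b' : MultiIdx n) :
    Commute (shiftF a b) (shiftF a' b' : Module.End ℝ (Loc n (parent n F))) :=
  (isGDer_shiftF a b).commute_of_coord (isGDer_shiftF a' b')
    (fun m => by simp only [shiftF_xcoord, map_zero]) fun ⟨⟨A, l, I⟩, m⟩ => by
      change shiftF a b (shiftF a' b' (pcoord A m l I)) = shiftF a' b' (shiftF a b (pcoord A m l I))
      simp only [shiftF_pcoord, add_right_comm]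

theorem shiftF_comm_koszulF (a b : MultiIdx n) (a' b' : Fin n → MultiIdx n) :
    Commute (shiftF a b) (koszulF a' b' : Module.End ℝ (Loc n (parent n F))) :=
  (isGDer_shiftF a b).commute_of_coord (isGDer_koszulF a' b')
    (fun m => by simp only [shiftF_xcoord, koszulF_xcoord, map_zero]) fun ⟨⟨A, l, I⟩, m⟩ => by
      change shiftF a b (koszulF a' b' (pcoord A m l I)) =
        koszulF a' b' (shiftF a b (pcoord A m l I))
      simp only [shiftF_pcoord, koszulF_pcoord, map_sum, map_smul, add_right_comm]

theorem shiftF_comm_dthetaF (a b : MultiIdx n) (i : Fin n) :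
    Commute (shiftF a b) (dthetaF i : Module.End ℝ (Loc n (parent n F))) :=
  (isGDer_shiftF a b).commute_of_coord (isGDer_dthetaF i)
    (fun m => by simp only [shiftF_xcoord, dthetaF_xcoord, map_zero]) fun ⟨⟨A, l, I⟩, m⟩ => by
      change shiftF a b (dthetaF i (pcoord A m l I)) = dthetaF i (shiftF a b (pcoord A m l I))
      simp only [shiftF_pcoord, dthetaF_pcoord]
      split_ifs
      · exact map_zero _
      · rw [map_smul, shiftF_pcoord]

theorem insSign_mul_self (i : Fin n) (I : Finset (Fin n)) : insSign i I * insSign i I = 1 := by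
  rw [insSign, ← mul_pow, neg_one_mul, neg_neg, one_pow]

theorem insSign_insert_self (i : Fin n) (I : Finset (Fin n)) :
    insSign i (insert i I) = insSign i I := by
  rw [insSign, insSign, Finset.filter_insert, if_neg (lt_irrefl i)]

/-- Inserting `i` shifts the place of `k` if `i < k`. -/
theorem insSign_insert {i k : Fin n} {I : Finset (Fin n)} (hi : i ∉ I) :
    insSign k (insert i I) = (if i < k then -1 else 1) * insSign k I := by
  rw [insSign, insSign, Finset.filter_insert]
  split_ifs
  · rw [Finset.card_insert_of_notMem (by simp [hi]), pow_succ']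
  · rw [one_mul]

/-- Two odd insertions anticommute. -/
theorem insSign_swap {i k : Fin n} {I : Finset (Fin n)} (hik : i ≠ k) (hi : i ∉ I) (hk : k ∉ I) :
    insSign i I * insSign k (insert i I) = -(insSign k I * insSign i (insert k I)) := by
  rw [insSign_insert hi, insSign_insert hk]
  rcases lt_or_gt_of_ne hik with h | h
  · rw [if_pos h, if_neg h.not_gt]
    ring
  · rw [if_neg h.not_gt, if_pos h]
    ring

theorem dthetaF_anticomm (i k : Fin n) :
    (dthetaF i * dthetaF k + dthetaF k * dthetaF i : Module.End ℝ (Loc n (parent n F))) = 0 := by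
  refine ((isGDer_dthetaF i).anticommutator (isGDer_dthetaF k)).ext IsGDer.zero
    (fun m => by simp [dthetaF_xcoord]) fun ⟨⟨A, l, I⟩, m⟩ => ?_
  change dthetaF i (dthetaF k (pcoord A m l I)) + dthetaF k (dthetaF i (pcoord A m l I)) = 0
  rw [dthetaF_pcoord, dthetaF_pcoord]
  by_cases hik : i = k
  · subst hik
    split_ifs with hi
    · simp
    · rw [map_smul, dthetaF_pcoord, if_pos (Finset.mem_insert_self _ _)]
      simp
  by_cases hi : i ∈ I
  · rw [if_pos hi, map_zero, add_zero]
    split_ifs with hk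
    · exact map_zero _
    · rw [map_smul, dthetaF_pcoord, if_pos (Finset.mem_insert_of_mem hi), smul_zero]
  by_cases hk : k ∈ I
  · rw [if_pos hk, if_neg hi, map_zero, zero_add, map_smul, dthetaF_pcoord,
      if_pos (Finset.mem_insert_of_mem hk), smul_zero]
  rw [if_neg hi, if_neg hk, map_smul, map_smul, dthetaF_pcoord, dthetaF_pcoord,
    if_neg (by simp [hi, hik]), if_neg (by simp [hk, Ne.symm hik]), Finset.insert_comm, smul_smul,
    smul_smul, ← add_smul]
  have h := insSign_swap hik hi hk
  rw [show sgn (F.parity A) * insSign k I * (sgn (F.parity A) * insSign i (insert k I)) +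
    sgn (F.parity A) * insSign i I * (sgn (F.parity A) * insSign k (insert i I)) =
    sgn (F.parity A) * sgn (F.parity A) * (insSign k I * insSign i (insert k I) +
      insSign i I * insSign k (insert i I)) by ring, h, add_neg_cancel, mul_zero, zero_smul]

/-- In the anticommutator only the term survives in which the index removed is the inserted `i`. -/
theorem koszulF_anticomm_dthetaF (a b : Fin n → MultiIdx n) (i : Fin n) :
    (koszulF a b * dthetaF i + dthetaF i * koszulF a b : Module.End ℝ (Loc n (parent n F))) =
      shiftF (a i) (b i) := by
  refine ((isGDer_koszulF a b).anticommutator (isGDer_dthetaF i)).ext (isGDer_shiftF _ _)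
    (fun m => by simp [dthetaF_xcoord, koszulF_xcoord, shiftF_xcoord]) fun ⟨⟨A, l, I⟩, m⟩ => ?_
  change koszulF a b (dthetaF i (pcoord A m l I)) + dthetaF i (koszulF a b (pcoord A m l I)) =
    shiftF (a i) (b i) (pcoord A m l I)
  have hs := sgn_mul_self (F.parity A)
  have hi1 := insSign_mul_self i (I.erase i)
  rw [dthetaF_pcoord, koszulF_pcoord, shiftF_pcoord, map_sum]
  simp only [map_smul, dthetaF_pcoord]
  by_cases hi : i ∈ I
  · rw [if_pos hi, map_zero, zero_add, Finset.sum_eq_single_of_mem i hi fun k _ hk => by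
      rw [if_pos (Finset.mem_erase.2 ⟨hk.symm, hi⟩), smul_zero], if_neg (Finset.notMem_erase i I),
      Finset.insert_erase hi, smul_smul]
    have h1 : insSign i I = insSign i (I.erase i) := by
      rw [← insSign_insert_self i (I.erase i), Finset.insert_erase hi]
    rw [h1, mul_mul_mul_comm, hs, hi1, mul_one, one_smul]
  · rw [if_neg hi, map_smul, koszulF_pcoord, Finset.sum_insert hi, smul_add, smul_smul,
      insSign_insert_self, Finset.erase_insert hi, mul_mul_mul_comm, hs, insSign_mul_self, mul_one,
      one_smul, add_assoc, Finset.smul_sum, ← Finset.sum_add_distrib]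
    rw [Finset.sum_eq_zero, add_zero]
    intro k hk
    have hik : i ≠ k := fun h => hi (h ▸ hk)
    have hie : i ∉ I.erase k := fun h => hi (Finset.mem_of_mem_erase h)
    rw [if_neg hie, smul_smul, smul_smul, Finset.erase_insert_of_ne hik, ← add_smul]
    have h := insSign_swap hik hie (Finset.notMem_erase k I)
    rw [Finset.insert_erase hk] at h
    have h1 : insSign k I = insSign k (I.erase k) := by
      rw [← insSign_insert_self k (I.erase k), Finset.insert_erase hk]
    have h2 : insSign k (insert i I) = (if i < k then -1 else 1) * insSign k (I.erase k) := by
      rw [insSign_insert hi, h1]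
    rw [insSign_insert hie] at h
    rw [h2, h1, show sgn (F.parity A) * insSign i I * (sgn (F.parity A) *
      ((if i < k then -1 else 1) * insSign k (I.erase k))) + sgn (F.parity A) *
        insSign k (I.erase k) * (sgn (F.parity A) * insSign i (I.erase k)) =
      sgn (F.parity A) * sgn (F.parity A) * (insSign i I *
      ((if i < k then -1 else 1) * insSign k (I.erase k)) +
        insSign k (I.erase k) * insSign i (I.erase k)) by ring]
    have h3 : insSign i I = (if k < i then -1 else 1) * insSign i (I.erase k) := by
      rw [← insSign_insert (Finset.notMem_erase k I), Finset.insert_erase hk]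
    rw [h3]
    rcases lt_or_gt_of_ne hik with hlt | hlt
    · rw [if_pos hlt, if_neg hlt.not_gt]
      convert zero_smul ℝ _ using 2
      ring
    · rw [if_neg hlt.not_gt, if_pos hlt]
      convert zero_smul ℝ _ using 2
      ring

end ParentOperators

section Descendants

variable {n : ℕ} {F G : FieldContent.{u}}

theorem totalD_comm_totalY (i k : Fin n) :
    Commute (totalD i) (totalY k : Module.End ℝ (Loc n (parent n F))) := by
  rw [totalD_eq, totalY_eq]
  exact ((dx_comm i k).add_right (dx_comm_shiftF i _ _)).add_left
    ((dx_comm_shiftF k _ _).symm.add_right (shiftF_comm _ _ _ _))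

theorem totalY_comm (i k : Fin n) :
    Commute (totalY i) (totalY k : Module.End ℝ (Loc n (parent n F))) := by
  rw [totalY_eq, totalY_eq]
  exact ((dx_comm i k).add_right (dx_comm_shiftF i _ _)).add_left
    ((dx_comm_shiftF k _ _).symm.add_right (shiftF_comm _ _ _ _))

theorem totalD_comm_dthetaF (i k : Fin n) :
    Commute (totalD i) (dthetaF k : Module.End ℝ (Loc n (parent n F))) := by
  rw [totalD_eq]
  exact (dx_comm_dthetaF i k).add_left (shiftF_comm_dthetaF _ _ _)

theorem totalY_comm_dthetaF (i k : Fin n) :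
    Commute (totalY i) (dthetaF k : Module.End ℝ (Loc n (parent n F))) := by
  rw [totalY_eq]
  exact (dx_comm_dthetaF i k).add_left (shiftF_comm_dthetaF _ _ _)

theorem totalD_pcoord (i : Fin n) (A : F.Idx) (m l : MultiIdx n) (I : Finset (Fin n)) :
    totalD i (pcoord A m l I) = pcoord A (m + MultiIdx.one i) l I := totalD_coord _ _

theorem totalY_pcoord (i : Fin n) (A : F.Idx) (m l : MultiIdx n) (I : Finset (Fin n)) :
    totalY i (pcoord A m l I) = pcoord A m (l + MultiIdx.one i) I := by
  rw [totalY_eq, LinearMap.add_apply, dx_pcoord, zero_add, shiftF_pcoord, add_zero]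

theorem iter_totalY_pcoord (A : F.Idx) (m l l' : MultiIdx n) (I : Finset (Fin n)) :
    iter totalY l' (pcoord A m l I) = pcoord A m (l + l') I := by
  induction l' using MultiIdx.induction with
  | zero => rw [iter_zero, add_zero, Module.End.one_apply]
  | add_one l i h =>
    rw [iter_add_one totalY_comm, Module.End.mul_apply, h, totalY_pcoord, add_assoc]

/-! ### Iterated `θ`-derivatives -/

theorem dthetaIter_empty : (dthetaIter ∅ : Module.End ℝ (Loc n (parent n F))) = 1 := by
  simp [dthetaIter]

theorem dthetaIter_insert {a : Fin n} {s : Finset (Fin n)} (h : ∀ b ∈ s, a < b) :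
    (dthetaIter (insert a s) : Module.End ℝ (Loc n (parent n F))) =
      dthetaF a * dthetaIter s := by
  rw [dthetaIter, dthetaIter, Finset.sort_insert (· ≤ ·) (fun b hb => (h b hb).le)
    fun ha => lt_irrefl a (h a ha), List.map_cons, List.prod_cons]

theorem insSign_of_lt {a : Fin n} {s : Finset (Fin n)} (h : ∀ b ∈ s, a < b) :
    insSign a s = 1 := by
  rw [insSign, Finset.filter_false_of_mem fun b hb => (h b hb).not_gt, Finset.card_empty, pow_zero]

theorem dthetaF_mul_dthetaIter (i : Fin n) (I : Finset (Fin n)) :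
    (dthetaF i * dthetaIter I : Module.End ℝ (Loc n (parent n F))) =
      if i ∈ I then 0 else insSign i I • dthetaIter (insert i I) := by
  have hsq : (dthetaF i * dthetaF i : Module.End ℝ (Loc n (parent n F))) = 0 := by
    have h := dthetaF_anticomm (F := F) i i
    refine LinearMap.ext fun f => ?_
    have h' := LinearMap.congr_fun h f
    rw [LinearMap.add_apply, ← two_smul ℝ] at h'
    exact (smul_eq_zero.1 h').resolve_left two_ne_zero
  induction I using Finset.induction_on_min with
  | empty =>
    rw [if_neg (Finset.notMem_empty i), insSign_of_lt (by simp), one_smul,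
      dthetaIter_insert (by simp)]
  | insert a s ha ih =>
    have has : a ∉ s := fun h => lt_irrefl a (ha a h)
    rw [dthetaIter_insert ha, ← mul_assoc]
    rcases lt_trichotomy i a with h | h | h
    · have hlt : ∀ b ∈ insert a s, i < b := fun b hb => by
        rcases Finset.mem_insert.1 hb with rfl | hb
        · exact h
        · exact h.trans (ha b hb)
      rw [if_neg fun hi => lt_irrefl i (hlt i hi), insSign_of_lt hlt, one_smul,
        dthetaIter_insert hlt, dthetaIter_insert ha, mul_assoc]
    · subst h
      rw [if_pos (Finset.mem_insert_self _ _), hsq, zero_mul]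
    · rw [eq_neg_of_add_eq_zero_left (show dthetaF i * dthetaF a * dthetaIter s +
        dthetaF a * dthetaF i * dthetaIter s = 0 by rw [← add_mul, dthetaF_anticomm, zero_mul]),
        mul_assoc, ih]
      by_cases hi : i ∈ s
      · rw [if_pos hi, if_pos (Finset.mem_insert_of_mem hi), mul_zero, neg_zero]
      · rw [if_neg hi, if_neg (by simp [hi, h.ne']), Finset.insert_comm, dthetaIter_insert
          (a := a) (s := insert i s) fun b hb => by
            rcases Finset.mem_insert.1 hb with rfl | hb
            · exact h
            · exact ha b hb, insSign_insert has, if_pos h, mul_smul_comm]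
        exact LinearMap.ext fun f => by simp

theorem map_dthetaIter (T : Loc n (parent n G) →ₗ[ℝ] Loc n (parent n F))
    (h : ∀ i f, T (dthetaF i f) = dthetaF i (T f)) (I : Finset (Fin n))
    (f : Loc n (parent n G)) : T (dthetaIter I f) = dthetaIter I (T f) := by
  induction I using Finset.induction_on_min with
  | empty => simp [dthetaIter_empty]
  | insert a s ha ih =>
    rw [dthetaIter_insert ha, dthetaIter_insert ha, Module.End.mul_apply, Module.End.mul_apply, h,
      ih]

theorem hasParity_dthetaIter {p : ZMod 2} {f : Loc n (parent n F)} (hf : HasParity p f)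
    (I : Finset (Fin n)) : HasParity (p + (I.card : ZMod 2)) (dthetaIter I f) := by
  induction I using Finset.induction_on_min with
  | empty => simpa [dthetaIter_empty] using hf
  | insert a s ha ih =>
    rw [dthetaIter_insert ha, Module.End.mul_apply,
      Finset.card_insert_of_notMem fun h => lt_irrefl a (ha a h)]
    have := (isGDer_dthetaF a).hasParity ih
    push_cast
    rwa [← add_assoc]

theorem dthetaIter_pcoord (A : F.Idx) (m l : MultiIdx n) (I : Finset (Fin n)) :
    dthetaIter I (pcoord A m l ∅) = sgn (F.parity A) ^ I.card • pcoord A m l I := by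
  induction I using Finset.induction_on_min with
  | empty => simp [dthetaIter_empty]
  | insert a s ha ih =>
    have has : a ∉ s := fun h => lt_irrefl a (ha a h)
    rw [dthetaIter_insert ha, Module.End.mul_apply, ih, map_smul, dthetaF_pcoord, if_neg has,
      insSign_of_lt ha, mul_one, smul_smul, Finset.card_insert_of_notMem has, pow_succ]

/-! ### The replacement of `x`-derivatives by `y`-derivatives -/

theorem isSuperHom_bar : IsSuperHom (bar n F) := isSuperHom_rename _

theorem bar_coord (A : F.Idx) (m : MultiIdx n) :
    bar n F (coord (A, m)) = pcoord A 0 m ∅ := rename_coord _ _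

/-- `f ↦ f̄` takes total `x`-derivatives to total `y`-derivatives, the explicit dependence on `x`
included. -/
theorem bar_totalD (i : Fin n) (f : Loc n F) : bar n F (totalD i f) = totalY i (bar n F f) := by
  refine IsGDer.intertwine_of_coord isSuperHom_bar (isGDer_totalD i) (isGDer_totalY i)
    (fun m => ?_) (fun ⟨A, m⟩ => ?_) f
  · rw [totalD_xcoord, dx_xcoord, totalY_xcoord, AlgHom.commutes]
  · rw [totalD_coord, bar_coord, bar_coord, totalY_pcoord]

theorem bar_dx (i : Fin n) (f : Loc n F) : bar n F (dx i f) = dx i (bar n F f) := by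
  refine IsGDer.intertwine_of_coord isSuperHom_bar (isGDer_dx i) (isGDer_dx i)
    (fun m => ?_) (fun ⟨A, m⟩ => ?_) f
  · rw [dx_xcoord, dx_xcoord, AlgHom.commutes]
  · rw [dx_coord, bar_coord, dx_pcoord, map_zero]

/-- `d^F` and `σ^F` vanish on functions of the `Ψ^A_()(μ)[]`, which have no skew-symmetric
indices. -/
theorem koszulF_bar (a b : Fin n → MultiIdx n) (f : Loc n F) : koszulF a b (bar n F f) = 0 := by
  refine (IsGDer.intertwine_of_coord isSuperHom_bar (IsGDer.zero (p := 1)) (isGDer_koszulF a b)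
    (fun m => ?_) (fun ⟨A, m⟩ => ?_) f).symm.trans ?_
  · rw [koszulF_xcoord, LinearMap.zero_apply, map_zero]
  · exact map_zero (bar n F)
  · rw [bar_coord, koszulF_pcoord, LinearMap.zero_apply, map_zero, Finset.sum_empty]

theorem bar_ghostOp (f : Loc n F) : bar n F (ghostOp f) = ghostOp (bar n F f) := by
  refine IsGDer.intertwine_of_coord isSuperHom_bar isGDer_ghostOp isGDer_ghostOp
    (fun m => ?_) (fun ⟨A, m⟩ => ?_) f
  · rw [ghostOp_xcoord, ghostOp_xcoord, map_zero]
  · rw [ghostOp_coord, map_smul, bar_coord]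
    refine Eq.trans ?_ (ghostOp_coord (F := parent n F) ((A, m, ∅), 0)).symm
    simp [parent, pcoord]

/-! ### Descendants -/

theorem hasParity_descendant {q : ZMod 2} {f : Loc n F} (hf : HasParity q f) (p : ZMod 2)
    (l : MultiIdx n) (I : Finset (Fin n)) :
    HasParity (q + (I.card : ZMod 2)) (descendant p f l I) :=
  HasParity.smul _ (hasParity_dthetaIter
    (IsGDer.hasParity_iter isGDer_totalY (isSuperHom_bar.hasParity hf) l) I)

theorem totalY_descendant (i : Fin n) (p : ZMod 2) (f : Loc n F) (l : MultiIdx n)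
    (I : Finset (Fin n)) :
    totalY i (descendant p f l I) = descendant p f (l + MultiIdx.one i) I := by
  rw [descendant, map_smul, map_dthetaIter (totalY i) fun k f =>
    LinearMap.congr_fun (totalY_comm_dthetaF i k).eq f, descendant, iter_add_one totalY_comm]
  rfl

theorem dthetaF_descendant (i : Fin n) (p : ZMod 2) (f : Loc n F) (l : MultiIdx n)
    (I : Finset (Fin n)) : dthetaF i (descendant p f l I) =
      if i ∈ I then 0 else (sgn p * insSign i I) • descendant p f l (insert i I) := by
  rw [descendant, map_smul, ← Module.End.mul_apply, dthetaF_mul_dthetaIter]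
  split_ifs with hi
  · rw [LinearMap.zero_apply, smul_zero]
  · rw [descendant, LinearMap.smul_apply, Finset.card_insert_of_notMem hi, smul_smul, smul_smul,
      pow_succ]
    congr 1
    rw [show sgn p * insSign i I * (sgn p ^ I.card * sgn p) =
      sgn p * sgn p * (sgn p ^ I.card * insSign i I) by ring, sgn_mul_self, one_mul]

/-- The sign in the definition of the descendants makes those of the fields `Ψ^A` the coordinates
`Ψ^A_(λ)[ν]`. -/
theorem descendant_coord (A : F.Idx) (l : MultiIdx n) (I : Finset (Fin n)) :
    descendant (F.parity A) (coord (A, 0)) l I = pcoord A 0 l I := by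
  rw [descendant, bar_coord, iter_totalY_pcoord, zero_add, dthetaIter_pcoord, smul_smul, ← mul_pow,
    sgn_mul_self, one_pow, one_smul]

theorem iter_totalD_pcoord (A : F.Idx) (m m' l : MultiIdx n) (I : Finset (Fin n)) :
    iter totalD m' (pcoord A m l I) = pcoord A (m + m') l I := iter_totalD_coord _ _ _

/-- All the coordinates of the parent theory are obtained from the `Ψ^A` by applying the total
derivatives and the `θ`-derivatives. -/
theorem coord_mem_of_closed (N : Submodule ℝ (Loc n (parent n F)))
    (hD : ∀ i, ∀ f ∈ N, totalD i f ∈ N) (hY : ∀ i, ∀ f ∈ N, totalY i f ∈ N)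
    (hθ : ∀ i, ∀ f ∈ N, dthetaF i f ∈ N) (hbar : ∀ A, bar n F (coord (A, 0)) ∈ N)
    (j : Jet n (parent n F)) : coord j ∈ N := by
  obtain ⟨⟨A, l, I⟩, m⟩ := j
  have h1 : ∀ l, iter totalY l (bar n F (coord (A, 0))) ∈ N := fun l => by
    induction l using MultiIdx.induction with
    | zero => simpa [iter_zero] using hbar A
    | add_one l i h =>
      rw [iter_add_one totalY_comm]
      exact hY i _ h
  have h2 : ∀ I, dthetaIter I (iter totalY l (bar n F (coord (A, 0)))) ∈ N := fun I => by
    induction I using Finset.induction_on_min with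
    | empty => simpa [dthetaIter_empty] using h1 l
    | insert a s ha ih =>
      rw [dthetaIter_insert ha]
      exact hθ a _ ih
  have h3 : pcoord A 0 l I ∈ N := by
    rw [← descendant_coord]
    exact N.smul_mem _ (h2 I)
  have h4 : ∀ m, iter totalD m (pcoord A 0 l I) ∈ N := fun m => by
    induction m using MultiIdx.induction with
    | zero => simpa [iter_zero] using h3
    | add_one m i h =>
      rw [iter_add_one totalD_comm]
      exact hD i _ h
  have := h4 m
  rwa [iter_totalD_pcoord, zero_add] at this

/-! ### The parent extension of a differential -/

section ParentDifferential

variable {S : F.Idx → Loc n F}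

theorem sBar_pcoord (S : F.Idx → Loc n F) (A : F.Idx) (m l : MultiIdx n) (I : Finset (Fin n)) :
    sBar S (pcoord A m l I) = iter totalD m (descendant (F.parity A + 1) (S A) l I) :=
  vectorField_coord _ _

theorem sBar_xcoord (S : F.Idx → Loc n F) (m : Fin n) : sBar S (xcoord (parent n F) m) = 0 :=
  vectorField_xcoord _ _

theorem isGDer_sBar (hS : ∀ A, HasParity (F.parity A + 1) (S A)) : IsGDer 1 (sBar S) :=
  isGDer_vectorField fun j => by
    have h := IsGDer.hasParity_iter isGDer_totalD
      (hasParity_descendant (hS j.1.1) (F.parity j.1.1 + 1) j.1.2.1 j.1.2.2) j.2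
    rwa [add_right_comm] at h

theorem totalD_comm_sBar (hS : ∀ A, HasParity (F.parity A + 1) (S A)) (i : Fin n) :
    Commute (totalD i) (sBar S) :=
  (isGDer_totalD i).commute_of_coord' (isGDer_sBar hS)
    (fun m => ⟨_, (totalD_xcoord i m).trans (dx_xcoord i m)⟩)
    (fun m => ⟨0, (sBar_xcoord S m).trans (map_zero _).symm⟩) fun ⟨⟨A, l, I⟩, m⟩ => by
      change totalD i (sBar S (pcoord A m l I)) = sBar S (totalD i (pcoord A m l I))
      rw [totalD_pcoord, sBar_pcoord, sBar_pcoord, iter_add_one totalD_comm, Module.End.mul_apply]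

theorem totalY_comm_sBar (hS : ∀ A, HasParity (F.parity A + 1) (S A)) (i : Fin n) :
    Commute (totalY i) (sBar S) :=
  (isGDer_totalY i).commute_of_coord' (isGDer_sBar hS) (fun m => ⟨_, totalY_xcoord i m⟩)
    (fun m => ⟨0, (sBar_xcoord S m).trans (map_zero _).symm⟩) fun ⟨⟨A, l, I⟩, m⟩ => by
      change totalY i (sBar S (pcoord A m l I)) = sBar S (totalY i (pcoord A m l I))
      rw [totalY_pcoord, sBar_pcoord, sBar_pcoord, ← totalY_descendant]
      exact map_iter (totalY i) (fun k f =>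
        LinearMap.congr_fun (totalD_comm_totalY k i).symm.eq f) _ _

theorem sBar_anticomm_dthetaF (hS : ∀ A, HasParity (F.parity A + 1) (S A)) (i : Fin n) :
    sBar S * dthetaF i + dthetaF i * sBar S = 0 := by
  refine ((isGDer_sBar hS).anticommutator (isGDer_dthetaF i)).ext IsGDer.zero
    (fun m => by simp [dthetaF_xcoord, sBar_xcoord]) fun ⟨⟨A, l, I⟩, m⟩ => ?_
  change sBar S (dthetaF i (pcoord A m l I)) + dthetaF i (sBar S (pcoord A m l I)) = 0
  rw [dthetaF_pcoord, sBar_pcoord, map_iter (dthetaF i) (D' := totalD) (fun k f =>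
        LinearMap.congr_fun (totalD_comm_dthetaF k i).symm.eq f), dthetaF_descendant]
  split_ifs
  · rw [map_zero, map_zero, add_zero]
  · rw [map_smul, sBar_pcoord, map_smul, ← add_smul, sgn_add, sgn_one]
    convert zero_smul ℝ _ using 2
    ring

theorem sBar_bar (hS : ∀ A, HasParity (F.parity A + 1) (S A)) (f : Loc n F) :
    sBar S (bar n F f) = bar n F (evol S f) := by
  refine (IsGDer.intertwine_of_coord isSuperHom_bar (isGDer_evol hS) (isGDer_sBar hS)
    (fun m => ?_) (fun ⟨A, m⟩ => ?_) f).symm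
  · rw [evol_xcoord, sBar_xcoord, map_zero]
  · rw [evol_coord, bar_coord, sBar_pcoord, iter_zero, Module.End.one_apply, descendant,
      dthetaIter_empty, Finset.card_empty, pow_zero, one_smul, Module.End.one_apply]
    exact map_iter (bar n F).toLinearMap bar_totalD _ _

theorem parentBRST_eq (S : F.Idx → Loc n F) :
    parentBRST S = koszulF MultiIdx.one 0 - koszulF 0 MultiIdx.one + sBar S := by
  rw [parentBRST, dF_eq, sigmaF_eq]

theorem isGDer_parentBRST (hS : ∀ A, HasParity (F.parity A + 1) (S A)) :
    IsGDer 1 (parentBRST S) := by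
  rw [parentBRST_eq]
  exact ((isGDer_koszulF _ _).sub (isGDer_koszulF _ _)).add (isGDer_sBar hS)

theorem parentBRST_xcoord (S : F.Idx → Loc n F) (m : Fin n) :
    parentBRST S (xcoord (parent n F) m) = 0 := by
  simp [parentBRST_eq, koszulF_xcoord, sBar_xcoord]

theorem totalD_comm_parentBRST (hS : ∀ A, HasParity (F.parity A + 1) (S A)) (i : Fin n) :
    Commute (totalD i) (parentBRST S) := by
  have h := totalD_comm_sBar hS i
  rw [parentBRST_eq]
  refine Commute.add_right (Commute.sub_right ?_ ?_) h <;> rw [totalD_eq] <;>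
    exact (dx_comm_koszulF _ _ _).add_left (shiftF_comm_koszulF _ _ _ _)

theorem totalY_comm_parentBRST (hS : ∀ A, HasParity (F.parity A + 1) (S A)) (i : Fin n) :
    Commute (totalY i) (parentBRST S) := by
  have h := totalY_comm_sBar hS i
  rw [parentBRST_eq]
  refine Commute.add_right (Commute.sub_right ?_ ?_) h <;> rw [totalY_eq] <;>
    exact (dx_comm_koszulF _ _ _).add_left (shiftF_comm_koszulF _ _ _ _)

/-- The explicit `x`-derivatives cancel in the anticommutator of the parent differential with
`∂^F/∂θ`. -/
theorem parentBRST_anticomm_dthetaF (hS : ∀ A, HasParity (F.parity A + 1) (S A)) (i : Fin n) :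
    parentBRST S * dthetaF i + dthetaF i * parentBRST S = totalD i - totalY i := by
  have h1 := koszulF_anticomm_dthetaF (F := F) MultiIdx.one 0 i
  have h2 := koszulF_anticomm_dthetaF (F := F) 0 MultiIdx.one i
  have h3 := sBar_anticomm_dthetaF hS i
  rw [parentBRST_eq, totalD_eq, totalY_eq, add_sub_add_left_eq_sub]
  simp only [Pi.zero_apply] at h1 h2
  rw [← h1, ← h2, add_mul, mul_add, sub_mul, mul_sub, eq_neg_of_add_eq_zero_left h3]
  abel

theorem parentBRST_bar (hS : ∀ A, HasParity (F.parity A + 1) (S A)) (f : Loc n F) :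
    parentBRST S (bar n F f) = bar n F (evol S f) := by
  rw [parentBRST_eq, LinearMap.add_apply, LinearMap.sub_apply, koszulF_bar, koszulF_bar,
    sBar_bar hS, sub_zero, zero_add]

end ParentDifferential

/-! ### Ghost number in the parent theory -/

theorem ghostOp_pcoord (A : F.Idx) (m l : MultiIdx n) (I : Finset (Fin n)) :
    ghostOp (pcoord A m l I) = ((F.gh A : ℝ) - I.card) • pcoord A m l I := by
  refine (ghostOp_coord (F := parent n F) ((A, l, I), m)).trans ?_
  simp [parent, pcoord]

theorem ghostOp_comm_totalD (i : Fin n) :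
    Commute ghostOp (totalD i : Module.End ℝ (Loc n F)) :=
  isGDer_ghostOp.commute_of_coord' (isGDer_totalD i)
    (fun m => ⟨0, (ghostOp_xcoord m).trans (map_zero _).symm⟩)
    (fun m => ⟨_, (totalD_xcoord i m).trans (dx_xcoord i m)⟩) fun j => by
      rw [ghostOp_coord, map_smul, totalD_coord, ghostOp_coord]

theorem ghostOp_comm_totalY (i : Fin n) :
    Commute ghostOp (totalY i : Module.End ℝ (Loc n (parent n F))) :=
  isGDer_ghostOp.commute_of_coord' (isGDer_totalY i)
    (fun m => ⟨0, (ghostOp_xcoord m).trans (map_zero _).symm⟩)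
    (fun m => ⟨_, totalY_xcoord i m⟩) fun ⟨⟨A, l, I⟩, m⟩ => by
      change ghostOp (totalY i (pcoord A m l I)) = totalY i (ghostOp (pcoord A m l I))
      rw [ghostOp_pcoord, map_smul, totalY_pcoord, ghostOp_pcoord]

theorem ghostOp_bracket_dthetaF (i : Fin n) :
    (ghostOp * dthetaF i - dthetaF i * ghostOp : Module.End ℝ (Loc n (parent n F))) =
      (-1 : ℝ) • dthetaF i := by
  have h := isGDer_ghostOp.bracket (isGDer_dthetaF (F := F) i)
  rw [zero_mul, sgn_zero, one_smul, zero_add] at h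
  refine h.ext ((isGDer_dthetaF i).smul _)
    (fun m => by simp [dthetaF_xcoord, ghostOp_xcoord]) fun ⟨⟨A, l, I⟩, m⟩ => ?_
  change ghostOp (dthetaF i (pcoord A m l I)) - dthetaF i (ghostOp (pcoord A m l I)) =
    (-1 : ℝ) • dthetaF i (pcoord A m l I)
  rw [ghostOp_pcoord, map_smul, dthetaF_pcoord]
  split_ifs with hi
  · rw [map_zero, smul_zero, smul_zero, sub_zero]
  · rw [map_smul, ghostOp_pcoord, Finset.card_insert_of_notMem hi, smul_smul, smul_smul, smul_smul,
      ← sub_smul]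
    congr 1
    push_cast
    ring

end Descendants

section ParentHom

variable {n : ℕ} {F G H : FieldContent.{u}}

/-! ### Functoriality of the parent theory -/

/-- Homomorphisms of parent theories that respect the total derivatives in `x` and `y` and the
`θ`-derivatives. -/
structure IsParentHom (Φ : Loc n (parent n G) →ₐ[ℝ] Loc n (parent n F)) : Prop where
  isSuperHom : IsSuperHom Φ
  map_totalD : ∀ i f, Φ (totalD i f) = totalD i (Φ f)
  map_totalY : ∀ i f, Φ (totalY i f) = totalY i (Φ f)
  map_dthetaF : ∀ i f, Φ (dthetaF i f) = dthetaF i (Φ f)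

namespace IsParentHom

theorem id : IsParentHom (AlgHom.id ℝ (Loc n (parent n F))) :=
  ⟨IsSuperHom.id, fun _ _ => rfl, fun _ _ => rfl, fun _ _ => rfl⟩

theorem comp {Φ : Loc n (parent n G) →ₐ[ℝ] Loc n (parent n F)}
    {Ψ : Loc n (parent n H) →ₐ[ℝ] Loc n (parent n G)} (hΦ : IsParentHom Φ) (hΨ : IsParentHom Ψ) :
    IsParentHom (Φ.comp Ψ) where
  isSuperHom := hΦ.isSuperHom.comp hΨ.isSuperHom
  map_totalD i f := by
    rw [AlgHom.comp_apply, hΨ.map_totalD, hΦ.map_totalD, AlgHom.comp_apply]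
  map_totalY i f := by
    rw [AlgHom.comp_apply, hΨ.map_totalY, hΦ.map_totalY, AlgHom.comp_apply]
  map_dthetaF i f := by
    rw [AlgHom.comp_apply, hΨ.map_dthetaF, hΦ.map_dthetaF, AlgHom.comp_apply]

variable {Φ : Loc n (parent n G) →ₐ[ℝ] Loc n (parent n F)}

/-- A homomorphism of parent theories is determined by the images of the original fields. -/
theorem ext {Φ' : Loc n (parent n G) →ₐ[ℝ] Loc n (parent n F)} (hΦ : IsParentHom Φ)
    (hΦ' : IsParentHom Φ') (h : ∀ f, Φ (bar n G f) = Φ' (bar n G f)) : Φ = Φ' := by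
  have hmem : ∀ f, f ∈ LinearMap.ker (Φ.toLinearMap - Φ'.toLinearMap) ↔ Φ f = Φ' f :=
    fun f => sub_eq_zero
  refine hΦ.isSuperHom.ext hΦ'.isSuperHom fun j => (hmem _).1 ?_
  refine coord_mem_of_closed _ (fun i f hf => ?_) (fun i f hf => ?_) (fun i f hf => ?_)
    (fun A => (hmem _).2 (h _)) j <;> rw [hmem] at hf ⊢
  · rw [hΦ.map_totalD, hΦ'.map_totalD, hf]
  · rw [hΦ.map_totalY, hΦ'.map_totalY, hf]
  · rw [hΦ.map_dthetaF, hΦ'.map_dthetaF, hf]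

theorem map_descendant (hΦ : IsParentHom Φ) {φ : Loc n G →ₐ[ℝ] Loc n F}
    (hφ : ∀ f, Φ (bar n G f) = bar n F (φ f)) (p : ZMod 2) (f : Loc n G) (l : MultiIdx n)
    (I : Finset (Fin n)) : Φ (descendant p f l I) = descendant p (φ f) l I := by
  rw [descendant, descendant, map_smul, ← hφ]
  congr 1
  refine (map_dthetaIter Φ.toLinearMap hΦ.map_dthetaF _ _).trans ?_
  congr 1
  exact map_iter Φ.toLinearMap hΦ.map_totalY _ _

theorem map_pcoord (hΦ : IsParentHom Φ) {φ : Loc n G →ₐ[ℝ] Loc n F}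
    (hφ : ∀ f, Φ (bar n G f) = bar n F (φ f)) (A : G.Idx) (l : MultiIdx n)
    (I : Finset (Fin n)) :
    Φ (pcoord A 0 l I) = descendant (G.parity A) (φ (coord (A, 0))) l I := by
  rw [← descendant_coord, hΦ.map_descendant hφ]

theorem map_iter_totalD (hΦ : IsParentHom Φ) (m : MultiIdx n) (f : Loc n (parent n G)) :
    Φ (iter totalD m f) = iter totalD m (Φ f) :=
  map_iter Φ.toLinearMap hΦ.map_totalD m f

/-- The parent extension of differentials is natural: only the commutators of the parent
differential with the derivatives and its action on the original fields matter. -/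
theorem map_parentBRST (hΦ : IsParentHom Φ) {φ : Loc n G →ₐ[ℝ] Loc n F}
    (hφ : ∀ f, Φ (bar n G f) = bar n F (φ f)) {T : G.Idx → Loc n G} {S : F.Idx → Loc n F}
    (hT : ∀ A, HasParity (G.parity A + 1) (T A)) (hS : ∀ A, HasParity (F.parity A + 1) (S A))
    (h : ∀ f, φ (evol T f) = evol S (φ f)) (f : Loc n (parent n G)) :
    Φ (parentBRST T f) = parentBRST S (Φ f) := by
  have hmem : ∀ f, f ∈ LinearMap.ker (Φ.toLinearMap ∘ₗ parentBRST T -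
      parentBRST S ∘ₗ Φ.toLinearMap) ↔ Φ (parentBRST T f) = parentBRST S (Φ f) :=
    fun f => sub_eq_zero
  refine IsGDer.intertwine_of_coord hΦ.isSuperHom (isGDer_parentBRST hT) (isGDer_parentBRST hS)
    (fun m => ?_) (fun j => (hmem _).1 ?_) f
  · rw [parentBRST_xcoord, parentBRST_xcoord, map_zero]
  refine coord_mem_of_closed _ (fun i f hf => ?_) (fun i f hf => ?_) (fun i f hf => ?_)
    (fun A => ?_) j <;> rw [hmem] at *
  · have h1 := LinearMap.congr_fun (totalD_comm_parentBRST hT i).eq f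
    have h2 := LinearMap.congr_fun (totalD_comm_parentBRST hS i).eq (Φ f)
    rw [Module.End.mul_apply, Module.End.mul_apply] at h1 h2
    rw [← h1, hΦ.map_totalD, hf, h2, hΦ.map_totalD]
  · have h1 := LinearMap.congr_fun (totalY_comm_parentBRST hT i).eq f
    have h2 := LinearMap.congr_fun (totalY_comm_parentBRST hS i).eq (Φ f)
    rw [Module.End.mul_apply, Module.End.mul_apply] at h1 h2
    rw [← h1, hΦ.map_totalY, hf, h2, hΦ.map_totalY]
  · have h1 := LinearMap.congr_fun (parentBRST_anticomm_dthetaF hT i) f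
    have h2 := LinearMap.congr_fun (parentBRST_anticomm_dthetaF hS i) (Φ f)
    rw [LinearMap.add_apply, Module.End.mul_apply, Module.End.mul_apply, LinearMap.sub_apply]
      at h1 h2
    rw [eq_sub_of_add_eq h1, hΦ.map_dthetaF, eq_sub_of_add_eq h2, map_sub, map_sub,
      hΦ.map_totalD, hΦ.map_totalY, hΦ.map_dthetaF, hf]
  · rw [parentBRST_bar hT, hφ, h, hφ, parentBRST_bar hS]

theorem map_ghostOp (hΦ : IsParentHom Φ) {φ : Loc n G →ₐ[ℝ] Loc n F}
    (hφ : ∀ f, Φ (bar n G f) = bar n F (φ f)) (h : ∀ f, φ (ghostOp f) = ghostOp (φ f))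
    (f : Loc n (parent n G)) : Φ (ghostOp f) = ghostOp (Φ f) := by
  have hmem : ∀ f, f ∈ LinearMap.ker (Φ.toLinearMap ∘ₗ ghostOp - ghostOp ∘ₗ Φ.toLinearMap) ↔
      Φ (ghostOp f) = ghostOp (Φ f) := fun f => sub_eq_zero
  refine IsGDer.intertwine_of_coord hΦ.isSuperHom isGDer_ghostOp isGDer_ghostOp
    (fun m => ?_) (fun j => (hmem _).1 ?_) f
  · rw [ghostOp_xcoord, ghostOp_xcoord, map_zero]
  refine coord_mem_of_closed _ (fun i f hf => ?_) (fun i f hf => ?_) (fun i f hf => ?_)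
    (fun A => ?_) j <;> rw [hmem] at *
  · have h1 := LinearMap.congr_fun (ghostOp_comm_totalD i).eq f
    have h2 := LinearMap.congr_fun (ghostOp_comm_totalD i).eq (Φ f)
    rw [Module.End.mul_apply, Module.End.mul_apply] at h1 h2
    rw [h1, hΦ.map_totalD, hf, hΦ.map_totalD, h2]
  · have h1 := LinearMap.congr_fun (ghostOp_comm_totalY i).eq f
    have h2 := LinearMap.congr_fun (ghostOp_comm_totalY i).eq (Φ f)
    rw [Module.End.mul_apply, Module.End.mul_apply] at h1 h2
    rw [h1, hΦ.map_totalY, hf, hΦ.map_totalY, h2]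
  · have h1 := LinearMap.congr_fun (ghostOp_bracket_dthetaF i) f
    have h2 := LinearMap.congr_fun (ghostOp_bracket_dthetaF i) (Φ f)
    rw [LinearMap.sub_apply, Module.End.mul_apply, Module.End.mul_apply, LinearMap.smul_apply]
      at h1 h2
    rw [eq_add_of_sub_eq h1, hΦ.map_dthetaF, eq_add_of_sub_eq h2, map_add, map_smul,
      hΦ.map_dthetaF, hΦ.map_dthetaF, hf]
  · rw [← bar_ghostOp, hφ, h, hφ, bar_ghostOp]

end IsParentHom

/-- A homomorphism of the algebras of local functions that commutes with the total derivatives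
extends to the parent theories, sending the descendants of the fields to the descendants of
their images. -/
theorem exists_parentHom {φ : Loc n G →ₐ[ℝ] Loc n F} (hφ : IsSuperHom φ)
    (hD : ∀ i f, φ (totalD i f) = totalD i (φ f)) :
    ∃ Φ : Loc n (parent n G) →ₐ[ℝ] Loc n (parent n F), IsParentHom Φ ∧
      ∀ f, Φ (bar n G f) = bar n F (φ f) := by
  obtain ⟨Φ, hΦ, h⟩ := exists_subst (n := n) (G := parent n G) (F := parent n F)
    (fun j => iter totalD j.2
      (descendant (G.parity j.1.1) (φ (coord (j.1.1, 0))) j.1.2.1 j.1.2.2))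
    fun j => IsGDer.hasParity_iter isGDer_totalD
      (hasParity_descendant (hφ.hasParity (hasParity_coord (j.1.1, 0))) _ _ _) _
  have hp : ∀ A m l I, Φ (pcoord A m l I) =
      iter totalD m (descendant (G.parity A) (φ (coord (A, 0))) l I) :=
    fun A m l I => h ((A, l, I), m)
  have hΦ' : IsParentHom Φ := by
    refine ⟨hΦ, fun i => IsGDer.intertwine_of_coord hΦ (isGDer_totalD i) (isGDer_totalD i)
      (fun m => ?_) fun ⟨⟨A, l, I⟩, m⟩ => ?_,
      fun i => IsGDer.intertwine_of_coord hΦ (isGDer_totalY i) (isGDer_totalY i)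
      (fun m => ?_) fun ⟨⟨A, l, I⟩, m⟩ => ?_,
      fun i => IsGDer.intertwine_of_coord hΦ (isGDer_dthetaF i) (isGDer_dthetaF i)
      (fun m => ?_) fun ⟨⟨A, l, I⟩, m⟩ => ?_⟩
    · rw [totalD_xcoord, totalD_xcoord, dx_xcoord, dx_xcoord, AlgHom.commutes]
    · change Φ (totalD i (pcoord A m l I)) = totalD i (Φ (pcoord A m l I))
      rw [totalD_pcoord, hp, hp, iter_add_one totalD_comm, Module.End.mul_apply]
    · rw [totalY_xcoord, totalY_xcoord, AlgHom.commutes]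
    · change Φ (totalY i (pcoord A m l I)) = totalY i (Φ (pcoord A m l I))
      rw [totalY_pcoord, hp, hp, ← totalY_descendant]
      exact (map_iter (totalY i) (fun k f =>
        LinearMap.congr_fun (totalD_comm_totalY k i).symm.eq f) _ _).symm
    · rw [dthetaF_xcoord, dthetaF_xcoord, map_zero]
    · change Φ (dthetaF i (pcoord A m l I)) = dthetaF i (Φ (pcoord A m l I))
      rw [dthetaF_pcoord, hp, map_iter (dthetaF i) (D' := totalD) (fun k f =>
        LinearMap.congr_fun (totalD_comm_dthetaF k i).symm.eq f), dthetaF_descendant]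
      split_ifs
      · rw [map_zero, map_zero]
      · rw [map_smul, hp, map_smul]
  refine ⟨Φ, hΦ', fun f => ?_⟩
  have key : Φ.comp (bar n G) = (bar n F).comp φ := by
    refine IsSuperHom.ext (hΦ.comp isSuperHom_bar) (isSuperHom_bar.comp hφ) fun ⟨A, m⟩ => ?_
    rw [AlgHom.comp_apply, AlgHom.comp_apply, bar_coord, hp, iter_zero, Module.End.one_apply,
      descendant, dthetaIter_empty, Finset.card_empty, pow_zero, one_smul, Module.End.one_apply]
    have h1 : coord (A, m) = iter totalD m (coord (A, 0) : Loc n G) := by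
      rw [iter_totalD_coord, zero_add]
    have h2 : φ (iter totalD m (coord (A, 0))) = iter totalD m (φ (coord (A, 0))) :=
      map_iter φ.toLinearMap hD _ _
    rw [h1, h2]
    exact (map_iter (bar n F).toLinearMap bar_totalD _ _).symm
  exact DFunLike.congr_fun key f

/-- It suffices to compare two differentials on the undifferentiated fields. -/
theorem evol_intertwine {φ : Loc n G →ₐ[ℝ] Loc n F} (hφ : IsSuperHom φ)
    (hD : ∀ i f, φ (totalD i f) = totalD i (φ f)) {T : G.Idx → Loc n G} {S : F.Idx → Loc n F}
    (hT : ∀ A, HasParity (G.parity A + 1) (T A)) (hS : ∀ A, HasParity (F.parity A + 1) (S A))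
    (h : ∀ A, φ (T A) = evol S (φ (coord (A, 0)))) (f : Loc n G) :
    φ (evol T f) = evol S (φ f) := by
  refine IsGDer.intertwine_of_coord hφ (isGDer_evol hT) (isGDer_evol hS) (fun m => ?_)
    (fun ⟨A, m⟩ => ?_) f
  · rw [evol_xcoord, evol_xcoord, map_zero]
  · have h1 : coord (A, m) = iter totalD m (coord (A, 0) : Loc n G) := by
      rw [iter_totalD_coord, zero_add]
    have h2 : ∀ g, φ (iter totalD m g) = iter totalD m (φ g) := map_iter φ.toLinearMap hD _
    rw [evol_coord, h1, h2, h2, h]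
    exact (map_iter (evol S) (fun k f =>
      LinearMap.congr_fun (totalD_comm_evol hS k).symm.eq f) _ _).symm

/-- On functions without explicit `x`-dependence the total `y`-derivatives are `∂^F/∂y`. -/
theorem iter_totalY_eq_iter_dyF {f : Loc n (parent n F)} (hf : ∀ m, dx m f = 0) (l : MultiIdx n) :
    iter totalY l f = iter dyF l f := by
  have hpow : ∀ (i : Fin n) (k : ℕ) (f : Loc n (parent n F)), (∀ m, dx m f = 0) →
      (totalY i ^ k) f = (dyF i ^ k) f ∧ ∀ m, dx m ((dyF i ^ k) f) = 0 := by
    intro i k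
    induction k with
    | zero => exact fun f hf => ⟨rfl, hf⟩
    | succ k ih =>
      intro f hf
      obtain ⟨h1, h2⟩ := ih f hf
      rw [pow_succ', pow_succ', Module.End.mul_apply, Module.End.mul_apply, h1, totalY,
        LinearMap.add_apply, h2, zero_add]
      refine ⟨rfl, fun m => ?_⟩
      have h3 := LinearMap.congr_fun (dx_comm_shiftF (F := F) m 0 (MultiIdx.one i)).eq
        ((dyF i ^ k) f)
      rw [Module.End.mul_apply, Module.End.mul_apply, h2, map_zero] at h3
      rwa [dyF_eq] at h3 ⊢
  have key : ∀ L : List (Fin n),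
      (L.map fun i => totalY i ^ l i).prod f = (L.map fun i => dyF i ^ l i).prod f ∧
        ∀ m, dx m ((L.map fun i => dyF i ^ l i).prod f) = 0 := by
    intro L
    induction L with
    | nil => exact ⟨rfl, hf⟩
    | cons i L ih =>
      rw [List.map_cons, List.prod_cons, List.map_cons, List.prod_cons, Module.End.mul_apply,
        Module.End.mul_apply, ih.1]
      exact hpow i _ _ ih.2
  exact (key _).1

end ParentHom

/-! ### Trivial pairs and their descendants -/

section Reduction

variable {n : ℕ} {F W P : FieldContent.{u}}

theorem FieldChange.isSuperHom {G : FieldContent.{u}} (e : FieldChange n G F) :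
    IsSuperHom (e.equiv : Loc n G →ₐ[ℝ] Loc n F) :=
  ⟨e.map_x, e.map_parity⟩

theorem isSuperHom_phiIncl : IsSuperHom (phiIncl (n := n) W P) := isSuperHom_rename _

theorem phiIncl_coord (i : P.Idx) (m : MultiIdx n) :
    phiIncl W P (coord (i, m)) = coord (phiIdx W i, m) := rename_coord _ _

theorem phiIncl_totalD (i : Fin n) (f : Loc n P) :
    phiIncl W P (totalD i f) = totalD i (phiIncl W P f) :=
  isSuperHom_phiIncl.map_totalD_of_coord i (fun A m => by
    rw [phiIncl_coord, phiIncl_coord, totalD_coord]) f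

/-- Setting `w = v = 0` is a left inverse of the inclusion of the functions of `φ`. -/
theorem exists_phiIncl_retraction : ∃ ρ : Loc n (withPairs W P) →ₐ[ℝ] Loc n P, IsSuperHom ρ ∧
    ∀ f, ρ (phiIncl W P f) = f := by
  obtain ⟨ρ, hρ, h⟩ := exists_subst (n := n) (G := withPairs W P) (F := P)
    (fun j => Sum.elim (fun _ => 0) (fun i => coord (i, j.2)) j.1) (by
      rintro ⟨(a | i), m⟩
      · exact HasParity.zero _
      · exact hasParity_coord (F := P) (i, m))
  refine ⟨ρ, hρ, fun f => ?_⟩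
  have : ρ.comp (phiIncl W P) = AlgHom.id ℝ _ :=
    (hρ.comp isSuperHom_phiIncl).ext IsSuperHom.id fun ⟨i, m⟩ => by
      rw [AlgHom.comp_apply, phiIncl_coord, h]
      rfl
  exact DFunLike.congr_fun this f

theorem IsBRST.hasParity {S : F.Idx → Loc n F} (hS : IsBRST S) (A : F.Idx) :
    HasParity (F.parity A + 1) (S A) := (hS.degree A).1

variable {S : F.Idx → Loc n F} {e : FieldChange n (withPairs W P) F} {SR : P.Idx → Loc n P}

theorem AlgTrivialPairs.hasParity_phiIncl (h : AlgTrivialPairs S e SR) (hS : IsBRST S)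
    (i : P.Idx) : HasParity (P.parity i + 1) (phiIncl W P (SR i)) := by
  have h1 : HasParity (P.parity i + 1) (e.equiv (phiIncl W P (SR i))) := by
    rw [← h.s_phi]
    exact (isGDer_evol hS.hasParity).hasParity
      (e.isSuperHom.hasParity (hasParity_coord (F := withPairs W P) (phiIdx W i, 0)))
  refine e.equiv.injective ?_
  rw [map_smul]
  exact (e.map_parity _).trans h1

/-- The parity of `S_R` is not among the hypotheses; it follows from `s φ = S_R[φ]`. -/
theorem AlgTrivialPairs.hasParity (h : AlgTrivialPairs S e SR) (hS : IsBRST S) (i : P.Idx) :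
    HasParity (P.parity i + 1) (SR i) := by
  obtain ⟨ρ, hρ, hρi⟩ := exists_phiIncl_retraction (n := n) (W := W) (P := P)
  have := hρ.hasParity (h.hasParity_phiIncl hS i)
  rwa [hρi] at this

/-- The differential in the new fields: `w ↦ v`, `v ↦ 0`, `φ ↦ S_R`. -/
def pairsBRST (W : FieldContent.{u}) (SR : P.Idx → Loc n P) :
    (withPairs W P).Idx → Loc n (withPairs W P) :=
  Sum.elim (Sum.elim (fun a => coord (vIdx P a, 0)) fun _ => 0) fun i => phiIncl W P (SR i)

theorem AlgTrivialPairs.hasParity_pairsBRST (h : AlgTrivialPairs S e SR) (hS : IsBRST S)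
    (A : (withPairs W P).Idx) :
    HasParity ((withPairs W P).parity A + 1) (pairsBRST W SR A) := by
  rcases A with (a | a) | i
  · exact hasParity_coord (F := withPairs W P) (vIdx P a, 0)
  · exact HasParity.zero _
  · exact h.hasParity_phiIncl hS i

/-- The change of fields takes the differential `w ↦ v`, `v ↦ 0`, `φ ↦ S_R` to `s`. -/
theorem AlgTrivialPairs.map_evol (h : AlgTrivialPairs S e SR) (hS : IsBRST S)
    (f : Loc n (withPairs W P)) :
    (e.equiv : _ →ₐ[ℝ] Loc n F) (evol (pairsBRST W SR) f) =
      evol S ((e.equiv : _ →ₐ[ℝ] Loc n F) f) := by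
  refine evol_intertwine e.isSuperHom e.map_totalD (h.hasParity_pairsBRST hS) hS.hasParity ?_ f
  rintro ((a | a) | i)
  · exact (h.s_w a).symm
  · refine (map_zero _).trans ?_
    have h1 := congrArg (evol S) (h.s_w a)
    rw [hS.nilpotent] at h1
    exact h1
  · exact (h.s_phi i).symm

theorem AlgTrivialPairs.map_evol_phi (h : AlgTrivialPairs S e SR) (hS : IsBRST S) (f : Loc n P) :
    (((e.equiv : _ →ₐ[ℝ] Loc n F).comp (phiIncl W P)) (evol SR f)) =
      evol S (((e.equiv : _ →ₐ[ℝ] Loc n F).comp (phiIncl W P)) f) := by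
  refine evol_intertwine (e.isSuperHom.comp isSuperHom_phiIncl)
    (fun i f => ?_) (h.hasParity hS) hS.hasParity (fun i => ?_) f
  · rw [AlgHom.comp_apply, phiIncl_totalD]
    exact e.map_totalD _ _
  · rw [AlgHom.comp_apply, AlgHom.comp_apply, phiIncl_coord]
    exact (h.s_phi i).symm

/-- The labels of `w_(λ)[ν]`, `v_(λ)[ν]`, `φ_(λ)[ν]` as labels of the parent theory of the fields
`w, v, φ`. -/
def unpairIdx (n : ℕ) (W P : FieldContent.{u}) :
    (withPairs (parent n W) (parent n P)).Idx → (parent n (withPairs W P)).Idx :=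
  Sum.elim (Sum.elim (fun b => (wIdx P b.1, b.2)) fun b => (vIdx P b.1, b.2))
    fun b => (phiIdx W b.1, b.2)

/-- The inverse of `unpairIdx`. -/
def pairIdx (n : ℕ) (W P : FieldContent.{u}) :
    (parent n (withPairs W P)).Idx → (withPairs (parent n W) (parent n P)).Idx
  | (Sum.inl (Sum.inl a), b) => Sum.inl (Sum.inl (a, b))
  | (Sum.inl (Sum.inr a), b) => Sum.inl (Sum.inr (a, b))
  | (Sum.inr i, b) => Sum.inr (i, b)

theorem pairIdx_unpairIdx (b : (withPairs (parent n W) (parent n P)).Idx) :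
    pairIdx n W P (unpairIdx n W P b) = b := by
  rcases b with (⟨a, b⟩ | ⟨a, b⟩) | ⟨i, b⟩ <;> rfl

theorem unpairIdx_pairIdx (b : (parent n (withPairs W P)).Idx) :
    unpairIdx n W P (pairIdx n W P b) = b := by
  rcases b with ⟨(a | a) | i, b⟩ <;> rfl

theorem parity_unpairIdx (b : (withPairs (parent n W) (parent n P)).Idx) :
    (parent n (withPairs W P)).parity (unpairIdx n W P b) =
      (withPairs (parent n W) (parent n P)).parity b := by
  rcases b with (b | b) | b
  · rfl
  · exact add_right_comm _ _ _
  · rfl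

theorem gh_unpairIdx (b : (withPairs (parent n W) (parent n P)).Idx) :
    (parent n (withPairs W P)).gh (unpairIdx n W P b) =
      (withPairs (parent n W) (parent n P)).gh b := by
  rcases b with (b | b) | b
  · rfl
  · exact add_sub_right_comm _ _ _
  · rfl

/-- The change of fields of the parent theory induced by a change of fields of the original
theory. -/
theorem exists_parent_fieldChange (e : FieldChange n (withPairs W P) F) :
    ∃ (eP : FieldChange n (withPairs (parent n W) (parent n P)) (parent n F))
      (Φ : Loc n (parent n (withPairs W P)) →ₐ[ℝ] Loc n (parent n F)), IsParentHom Φ ∧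
      (∀ f, Φ (bar n _ f) = bar n F ((e.equiv : _ →ₐ[ℝ] Loc n F) f)) ∧
      ∀ b m, eP.equiv (coord (b, m)) = Φ (coord (unpairIdx n W P b, m)) := by
  have he' : IsSuperHom (e.equiv.symm : Loc n F →ₐ[ℝ] Loc n (withPairs W P)) :=
    ⟨fun m => e.equiv.symm_apply_eq.2 (e.map_x m).symm, fun f =>
      e.equiv.symm_apply_eq.2 ((congrArg parityHom (e.equiv.apply_symm_apply f).symm).trans
        (e.map_parity _).symm)⟩
  obtain ⟨Φ, hΦ, hΦb⟩ := exists_parentHom e.isSuperHom e.map_totalD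
  obtain ⟨Ψ, hΨ, hΨb⟩ := exists_parentHom he' fun i f =>
    e.equiv.symm_apply_eq.2 ((congrArg (totalD i) (e.equiv.apply_symm_apply f).symm).trans
        (e.map_totalD i _).symm)
  have hΦΨ : Φ.comp Ψ = AlgHom.id ℝ _ := (hΦ.comp hΨ).ext IsParentHom.id fun f => by
    rw [AlgHom.comp_apply, hΨb, hΦb]
    exact congrArg (bar n F) (e.equiv.apply_symm_apply f)
  have hΨΦ : Ψ.comp Φ = AlgHom.id ℝ _ := (hΨ.comp hΦ).ext IsParentHom.id fun f => by
    rw [AlgHom.comp_apply, hΦb, hΨb]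
    exact congrArg (bar n _) (e.equiv.symm_apply_apply f)
  obtain ⟨R, hR, hRc, hRD, hRg⟩ := exists_relabel (n := n) (unpairIdx n W P) parity_unpairIdx
    gh_unpairIdx
  obtain ⟨R', hR', hRc', -, -⟩ := exists_relabel (n := n) (pairIdx n W P)
    (fun b => by rw [← parity_unpairIdx, unpairIdx_pairIdx])
    (fun b => by rw [← gh_unpairIdx, unpairIdx_pairIdx])
  -- `R` regroups the labels of the fields, `R'` undoes it
  have hRR' : R.comp R' = AlgHom.id ℝ _ := (hR.comp hR').ext IsSuperHom.id fun ⟨b, m⟩ => by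
    rw [AlgHom.comp_apply, hRc', hRc, unpairIdx_pairIdx]
    rfl
  have hR'R : R'.comp R = AlgHom.id ℝ _ := (hR'.comp hR).ext IsSuperHom.id fun ⟨b, m⟩ => by
    rw [AlgHom.comp_apply, hRc, hRc', pairIdx_unpairIdx]
    rfl
  refine ⟨{ equiv := AlgEquiv.ofAlgHom (Φ.comp R) (R'.comp Ψ) ?_ ?_
            map_x := fun m => ?_
            map_totalD := fun m f => ?_
            map_parity := fun f => ?_
            map_ghost := fun f => ?_ }, Φ, hΦ, hΦb, fun b m => congrArg Φ (hRc b m)⟩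
  · rw [AlgHom.comp_assoc, ← AlgHom.comp_assoc R, hRR', AlgHom.id_comp, hΦΨ]
  · rw [AlgHom.comp_assoc, ← AlgHom.comp_assoc Ψ, hΨΦ, AlgHom.id_comp, hR'R]
  · exact (hΦ.isSuperHom.comp hR).map_x m
  · exact (congrArg Φ (hRD m f)).trans (hΦ.map_totalD m _)
  · exact (hΦ.isSuperHom.comp hR).map_parity f
  · exact (congrArg Φ (hRg f)).trans (hΦ.map_ghostOp hΦb e.map_ghost _)

/-- Generators of an ideal may be changed by elements of the ideal of the other generators. -/
theorem ideal_span_union_eq {R ι : Type*} [Ring R] (A : Set R) (b c : ι → R)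
    (h : ∀ i, b i - c i ∈ Ideal.span A) :
    Ideal.span (A ∪ Set.range b) = Ideal.span (A ∪ Set.range c) := by
  have key : ∀ b c : ι → R, (∀ i, b i - c i ∈ Ideal.span A) →
      Ideal.span (A ∪ Set.range b) ≤ Ideal.span (A ∪ Set.range c) := by
    intro b c h
    rw [Ideal.span_le]
    rintro _ (hx | ⟨i, rfl⟩)
    · exact Ideal.subset_span (Or.inl hx)
    · rw [← sub_add_cancel (b i) (c i)]
      exact add_mem (Ideal.span_mono Set.subset_union_left (h i))
        (Ideal.subset_span (Or.inr ⟨i, rfl⟩))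
  refine le_antisymm (key b c h) (key c b fun i => ?_)
  rw [← neg_sub]
  exact neg_mem (h i)

/-- In the parent theory `s^P w_(λ)[ν] = v_(λ)[ν]` up to derivatives of the `w`'s. -/
theorem parentBRST_pairsBRST_w (SR : P.Idx → Loc n P) (a : W.Idx) (l : MultiIdx n)
    (I : Finset (Fin n)) :
    parentBRST (pairsBRST W SR) (pcoord (wIdx P a) 0 l I) - pcoord (vIdx P a) 0 l I =
      ∑ i ∈ I, (sgn (W.parity a) * insSign i I) •
        (totalD i (pcoord (wIdx P a) 0 l (I.erase i)) -
          pcoord (wIdx P a) 0 (l + MultiIdx.one i) (I.erase i)) := by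
  have hv : descendant ((withPairs W P).parity (wIdx P a) + 1)
      (pairsBRST W SR (wIdx P a)) l I = pcoord (vIdx P a) 0 l I :=
    descendant_coord (F := withPairs W P) (vIdx P a) l I
  rw [parentBRST_eq, LinearMap.add_apply, LinearMap.sub_apply, koszulF_pcoord, koszulF_pcoord,
    sBar_pcoord, iter_zero, Module.End.one_apply, hv, add_sub_cancel_right,
    ← Finset.sum_sub_distrib]
  refine Finset.sum_congr rfl fun i _ => ?_
  rw [← smul_sub, totalD_pcoord]
  simp only [Pi.zero_apply, add_zero]
  rfl

end Reduction
end ParentBRST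

end

theorem proposition2p2 (n : ℕ) (F W P : ParentBRST.FieldContent.{u})
    (S : F.Idx → ParentBRST.Loc n F) (hS : ParentBRST.IsBRST S)
    (e : ParentBRST.FieldChange n (ParentBRST.withPairs W P) F)
    (SR : P.Idx → ParentBRST.Loc n P)
    (h : ParentBRST.AlgTrivialPairs S e SR) :
    ∃ eP : ParentBRST.FieldChange n
        (ParentBRST.withPairs (ParentBRST.parent n W) (ParentBRST.parent n P))
        (ParentBRST.parent n F),
      -- the new fields are all the descendants of `w^a`, `v^a = s w^a`, `φ^i`
      (∀ (a : W.Idx) (l : ParentBRST.MultiIdx n) (I : Finset (Fin n)),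
        ParentBRST.newField eP (ParentBRST.wIdx (ParentBRST.parent n P) (a, l, I)) =
          ParentBRST.descendant (W.parity a)
            (ParentBRST.newField e (ParentBRST.wIdx P a)) l I) ∧
      (∀ (a : W.Idx) (l : ParentBRST.MultiIdx n) (I : Finset (Fin n)),
        ParentBRST.newField eP (ParentBRST.vIdx (ParentBRST.parent n P) (a, l, I)) =
          ParentBRST.descendant (W.parity a + 1)
            (ParentBRST.newField e (ParentBRST.vIdx P a)) l I) ∧
      (∀ (i : P.Idx) (l : ParentBRST.MultiIdx n) (I : Finset (Fin n)),
        ParentBRST.newField eP (ParentBRST.phiIdx (ParentBRST.parent n W) (i, l, I)) =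
          ParentBRST.descendant (P.parity i)
            (ParentBRST.newField e (ParentBRST.phiIdx W i)) l I) ∧
      -- for new fields without explicit `x`-dependence the `y`-descendants are those
      -- through `∂^F/∂y` alone
      (∀ (b : (ParentBRST.withPairs W P).Idx),
        (∀ m, ParentBRST.dx m (ParentBRST.newField e b) = 0) →
        ∀ (p : ZMod 2) (l : ParentBRST.MultiIdx n) (I : Finset (Fin n)),
          ParentBRST.descendant p (ParentBRST.newField e b) l I =
            ParentBRST.sgn p ^ I.card • ParentBRST.dthetaIter I
              (ParentBRST.iter ParentBRST.dyF l
                (ParentBRST.bar n F (ParentBRST.newField e b)))) ∧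
      -- they are generalized auxiliary fields of the parent theory, and the reduced theory is
      -- the parent extension of the reduced original theory
      ∃ V : (ParentBRST.parent n W).Idx → ParentBRST.Loc n (ParentBRST.parent n P),
        ParentBRST.IsGenAux (ParentBRST.parentBRST S) eP V ∧
        ParentBRST.IsReduced (ParentBRST.parentBRST S) eP V (ParentBRST.parentBRST SR) := by
  open ParentBRST in
  obtain ⟨eP, Φ, hΦ, hΦb, heP⟩ := exists_parent_fieldChange e
  have hw : ∀ a l I, newField eP (wIdx (parent n P) (a, l, I)) = Φ (pcoord (wIdx P a) 0 l I) :=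
    fun a l I => heP _ _
  have hv : ∀ a l I, newField eP (vIdx (parent n P) (a, l, I)) = Φ (pcoord (vIdx P a) 0 l I) :=
    fun a l I => heP _ _
  refine ⟨eP, fun a l I => ?_, fun a l I => ?_, fun i l I => ?_, fun b hb p l I => ?_,
    -- `s^P w_(λ)[ν]` is `v_(λ)[ν]` up to derivatives of the `w`'s, so `V = 0`
    fun _ => 0, ⟨fun a => ?_, ?_⟩, fun f => ?_⟩
  · exact (hw a l I).trans (hΦ.map_pcoord hΦb _ l I)
  · exact (hv a l I).trans (hΦ.map_pcoord hΦb _ l I)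
  · exact (heP _ _).trans (hΦ.map_pcoord hΦb (phiIdx W i) l I)
  · rw [descendant, iter_totalY_eq_iter_dyF fun m => ?_]
    rw [← bar_dx, hb, map_zero]
  · simp [HasDegree]
  · have hset : ∀ T : (parent n W).Idx → Loc n (parent n F),
        {f | ∃ a l, f = iter totalD l (T a)} =
          Set.range fun b : (parent n W).Idx × MultiIdx n => iter totalD b.2 (T b.1) := fun T => by
      ext f
      exact ⟨fun ⟨a, l, hf⟩ => ⟨(a, l), hf.symm⟩, fun ⟨b, hf⟩ => ⟨b.1, b.2, hf.symm⟩⟩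
    rw [equationIdeal, reductionIdeal, hset fun a => parentBRST S _, hset fun a => _ - _]
    refine ideal_span_union_eq _ _ _ ?_
    rintro ⟨⟨a, l, I⟩, m⟩
    have hsub : ∀ (r : ℝ) (f : Loc n (parent n F)) (J : Ideal (Loc n (parent n F))), f ∈ J →
        r • f ∈ J := fun r f J hf => by
      rw [Algebra.smul_def]
      exact J.mul_mem_left _ hf
    have hgen : ∀ m l I, iter totalD m (Φ (pcoord (wIdx P a) 0 l I)) ∈
        Ideal.span {f | ∃ b m, f = iter totalD m (newField eP (wIdx (parent n P) b))} :=
      fun m l I => Ideal.subset_span ⟨(a, l, I), m, by rw [hw]⟩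
    change iter totalD m (parentBRST S (newField eP (wIdx (parent n P) (a, l, I)))) -
      iter totalD m (newField eP (vIdx (parent n P) (a, l, I)) - eP.equiv (phiIncl _ _ 0)) ∈ _
    rw [map_zero, map_zero, sub_zero, hw, hv, ← hΦ.map_parentBRST hΦb (h.hasParity_pairsBRST hS)
      hS.hasParity (h.map_evol hS), ← map_sub, ← map_sub, parentBRST_pairsBRST_w, map_sum, map_sum]
    refine Ideal.sum_mem _ fun i _ => ?_
    rw [map_smul, map_smul, map_sub, map_sub, hΦ.map_totalD]
    refine hsub _ _ _ (sub_mem ?_ (hgen _ _ _))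
    have hm : iter totalD m (totalD i (Φ (pcoord (wIdx P a) 0 l (I.erase i)))) =
        iter totalD (m + MultiIdx.one i) (Φ (pcoord (wIdx P a) 0 l (I.erase i))) := by
      rw [iter_add_one totalD_comm, Module.End.mul_apply]
      exact (map_iter (totalD i) (fun k f =>
        LinearMap.congr_fun (totalD_comm i k).eq f) _ _).symm
    rw [hm]
    exact hgen _ _ _
  -- the functions of the `φ_(λ)[ν]` are stable under `s^P`, by naturality of the parent extension
  -- under the inclusion of the functions of the `φ`; the difference is therefore zero
  · obtain ⟨K, hK, hKb⟩ := exists_parentHom (isSuperHom_phiIncl (n := n) (W := W) (P := P))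
      phiIncl_totalD
    have hKe : eP.equiv.toAlgHom.comp (phiIncl (parent n W) (parent n P)) = Φ.comp K := by
      refine IsSuperHom.ext (eP.isSuperHom.comp isSuperHom_phiIncl)
        (hΦ.isSuperHom.comp hK.isSuperHom) fun ⟨⟨i, l, I⟩, m⟩ => ?_
      have h1 : K (pcoord i 0 l I) = pcoord (phiIdx W i) 0 l I := by
        rw [hK.map_pcoord hKb, phiIncl_coord]
        exact descendant_coord (F := withPairs W P) (phiIdx W i) l I
      have h2 : K (pcoord i m l I) = pcoord (phiIdx W i) m l I := by
        have := hK.map_iter_totalD m (pcoord i 0 l I)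
        rwa [h1, iter_totalD_pcoord, iter_totalD_pcoord, zero_add] at this
      exact (congrArg eP.equiv (phiIncl_coord (W := parent n W) (P := parent n P) (i, l, I) m)).trans
        ((heP _ _).trans (congrArg Φ h2.symm))
    have hcomp : ∀ f, eP.equiv (phiIncl (parent n W) (parent n P) f) = Φ.comp K f :=
      fun f => DFunLike.congr_fun hKe f
    rw [hcomp, hcomp, (hΦ.comp hK).map_parentBRST (φ := (e.equiv : _ →ₐ[ℝ] Loc n F).comp
      (phiIncl W P)) (fun f => by rw [AlgHom.comp_apply, hKb, hΦb, AlgHom.comp_apply])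
      (h.hasParity hS) hS.hasParity (h.map_evol_phi hS), sub_self]
    exact zero_mem _
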